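/- Let $k$ be an algebraically closed field of characteristic $0$ and $\Gamma$ a finite abelian group with character group $\hat\Gamma=\mathrm{Hom}(\Gamma,k^\times)$. Let $g_1,\dots,g_t\in\Gamma$ and $\chi_1,\dots,\chi_t\in\hat\Gamma$ with $\chi_i(g_j)\chi_j(g_i)=1$ for $i\neq j$ and $\chi_i(g_i)$ a primitive $r_i$-th root of unity, $r_i>1$; that is, $V=\bigoplus_{i=1}^t kv_i$ with $v_i\in V_{g_i}^{\chi_i}$ (action $h\to v_i=\chi_i(h)v_i$, coaction $v_i\mapsto g_i\otimes v_i$) is a quantum linear space in ${}^\Gamma_\Gamma\mathcal{YD}$. Write $\mathcal B(V)$ for its Nichols algebra and $\mathcal B(V)\#k[\Gamma]$ for the bosonization. Let $A$ be a finite-dimensional lifting of $\mathcal B(V)\#k[\Gamma]$ with matrix $(\alpha_{ij})$. That is, the coradical of $A$ is a Hopf subalgebra, $\mathrm{gr}\,A\cong\mathcal B(V)\#k[\Gamma]$ as graded Hopf algebras for the coradical filtration, and $A$ is generated by the group-likes $h\in\Gamma$ and elements $x_i$ that lift $v_i\#1$, with $\Delta x_i=x_i\otimes1+g_i\otimes x_i$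 and $$hx_i=\chi_i(h)x_ih,\qquad x_i^{r_i}=\alpha_{ii}(g_i^{r_i}-1),\qquad x_ix_j=\chi_j(g_i)x_jx_i+\alpha_{ij}(g_ig_j-1)\ (i\ne j),$$ where $\alpha_{ii}\in\{0,1\}$, $\alpha_{ii}=0$ if $g_i^{r_i}=1$ or $\chi_i^{r_i}\neq\epsilon$, and, for $i\ne j$, $\alpha_{ij}=0$ if $g_ig_j=1$ or $\chi_i\chi_j\neq\epsilon$, and $\alpha_{ji}=-\chi_i(g_j)\alpha_{ij}$. Assume that for $i\neq j$, $\alpha_{ij}\neq0$ implies $\chi_i=\chi_j$. Then the elements $hx_1^{m_1}\cdots x_t^{m_t}$ with $h\in\Gamma$, $0\le m_i<r_i$, are a basis of $A$. For $\gamma\in\hat\Gamma$ let $w(\gamma,x^m)\in A^*$ map $hx^m$ to $\gamma(h)$ for all $h\in\Gamma$ and the other basis elements to $0$; write $\gamma$ for $w(\gamma,1)\in A^*$ and $w_i$ for $w(\chi_i,x_i)$. The dual $A^*$ has the convolution product. Let $\Theta=\langle\chi_1,\dots,\chi_t\rangle\le\hat\Gamma$, $$\Omega=\{\gamma\in\hat\Gamma:\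 \gamma(\alpha_{ii}(g_i^{r_i}-1))=0=\gamma(\alpha_{ij}(g_ig_j-1))\text{ for all } i\ne j\},$$ where $\gamma$ is extended linearly to $k[\Gamma]$, and $\Gamma'=\langle\{g_i^{r_i}:\alpha_{ii}\ne0\}\cup\{g_ig_j: i\neq j,\ \alpha_{ij}\ne0\}\rangle\le\Gamma$. Composition with $\Gamma\to\Gamma/\Gamma'$ identifies the character group of $\Gamma/\Gamma'$ with $\Omega$. For $\gamma\in\hat\Gamma$ let $\bar\gamma$ be its image in $\hat\Gamma/\Theta$. 1. $\Theta\subseteq\Omega$, and $\gamma\mapsto w(\gamma,1)$ is a group isomorphism from $\Omega$ onto the group $G(A^*)$ of group-likes. 2. For $\Lambda\in\{\Theta,\Omega\}$ let $W=\bigoplus_i kw_i\in{}^\Lambda_\Lambda\mathcal{YD}$ with action $\gamma\to w_i=\gamma(g_i)w_i$ and coaction $w_i\mapsto\chi_i\otimes w_i$. There are pointed sub-Hopf algebras $C(\bar1)\subseteq B$ of $A^*$ and Hopf algebra isomorphisms $\mathcal B(W)\#k[\Theta]\cong C(\bar1)$ and $\mathcal B(W)\#k[\Omega]\cong B$, both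 sending $1\#\gamma$ to $w(\gamma,1)$ and $w_i\#1$ to $w(\chi_i,x_i)$. 3. For $\gamma\in\hat\Gamma$ the space $C(\bar\gamma)=\gamma C(\bar1)=C(\bar1)\gamma$ depends only on $\bar\gamma$ and is a subcoalgebra of $A^*$, and $A^*=\bigoplus_{\bar\gamma\in\hat\Gamma/\Theta}C(\bar\gamma)$ as a coalgebra. If $\gamma\in\Omega$, then $C(\bar\gamma)\cong C(\bar1)$ as coalgebras, and $B=\bigoplus_{\bar\gamma\in\Omega/\Theta}C(\bar\gamma)$. Moreover $$\mathrm{corad}\,A^*=k[\Omega]\ \oplus\bigoplus_{\bar\gamma\in\hat\Gamma/\Theta,\ \gamma\notin\Omega}\mathrm{corad}\,C(\bar\gamma),$$ where $k[\Omega]$ is the span of the group-likes $w(\gamma,1)$, $\gamma\in\Omega$. 4. $C(\bar\gamma)C(\bar\lambda)=C(\overline{\gamma\lambda})$ and $S(C(\bar\gamma))=C(\overline{\gamma^{-1}})$ for all $\bar\gamma,\bar\lambda\in\hat\Gamma/\Theta$. -/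

import Mathlib

open scoped TensorProduct
open Coalgebra

noncomputable section

/-- The character group of `G` with values in `k`. -/
abbrev CharGroup (k : Type*) [Field k] (G : Type*) [CommGroup G] : Type _ := G →* kˣ

/-- The dual `A^*` of a Hopf algebra `A`, with the convolution product
`(f * g)(a) = ∑ f(a₁) g(a₂)` and unit `ε`; for `A` finite dimensional it is a Hopf algebra with
`(Δ f)(a ⊗ b) = f(a b)`, `ε(f) = f(1)` and `S(f) = f ∘ S`. -/
def HopfDual (k : Type*) [Field k] (A : Type*) [Ring A] [HopfAlgebra k A] : Type _ :=
  WithConv (A →ₗ[k] k)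

namespace HopfDual

section Algebra

variable (k : Type*) [Field k] (A : Type*) [Ring A] [HopfAlgebra k A]

instance : Ring (HopfDual k A) := inferInstanceAs (Ring (WithConv (A →ₗ[k] k)))

instance : Algebra k (HopfDual k A) := inferInstanceAs (Algebra k (WithConv (A →ₗ[k] k)))

/-- The elements of `A^*` are the linear forms on `A`. -/
def toDual : HopfDual k A ≃ₗ[k] (A →ₗ[k] k) where
  toFun f := WithConv.ofConv f
  invFun f := WithConv.toConv f
  left_inv _ := rfl
  right_inv _ := rfl
  map_add' _ _ := rfl
  map_smul' _ _ := rfl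

instance : FunLike (HopfDual k A) A k where
  coe f := toDual k A f
  coe_injective _ _ h := (toDual k A).injective (DFunLike.coe_injective h)

instance : LinearMapClass (HopfDual k A) k A k where
  map_add f := (toDual k A f).map_add
  map_smulₛₗ f := (toDual k A f).map_smul

variable {k A}

@[simp] lemma toDual_apply (f : HopfDual k A) (a : A) : toDual k A f a = f a := rfl

@[simp] lemma toDual_symm_apply (f : A →ₗ[k] k) (a : A) : (toDual k A).symm f a = f a := rfl

@[ext] lemma ext {f g : HopfDual k A} (h : ∀ a, f a = g a) : f = g := DFunLike.ext f g h

@[simp] lemma zero_apply (a : A) : (0 : HopfDual k A) a = 0 := rfl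

@[simp] lemma add_apply (f g : HopfDual k A) (a : A) : (f + g) a = f a + g a := rfl

@[simp] lemma smul_apply (c : k) (f : HopfDual k A) (a : A) : (c • f) a = c * f a := rfl

@[simp] lemma one_apply (a : A) : (1 : HopfDual k A) a = counit (R := k) a := rfl

lemma mul_apply (f g : HopfDual k A) {a : A} {ι : Type*} (ra : Coalgebra.Repr k a ι) :
    (f * g) a = ∑ i ∈ ra.index, f (ra.left i) * g (ra.right i) :=
  ra.convMul_apply (R := k) (WithConv.toConv (toDual k A f)) (WithConv.toConv (toDual k A g))

end Algebra

variable {k : Type*} [Field k] {A : Type*} [Ring A] [HopfAlgebra k A] [Module.Finite k A]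

variable (k A) in
/-- `A^* ⊗ A^* ≃ (A ⊗ A)^*`, with `f ⊗ g` sent to `a ⊗ b ↦ f a * g b`. -/
def pair : HopfDual k A ⊗[k] HopfDual k A ≃ₗ[k] (A ⊗[k] A →ₗ[k] k) :=
  (TensorProduct.congr (toDual k A)
      (toDual k A)).trans
    (TensorProduct.dualDistribEquiv k A A)

@[simp] lemma pair_tmul (f g : HopfDual k A) (a b : A) :
    pair k A (f ⊗ₜ[k] g) (a ⊗ₜ[k] b) = f a * g b := by
  simp [pair]

variable (k A) in
/-- `A^* ⊗ (A^* ⊗ A^*) ≃ (A ⊗ (A ⊗ A))^*`. -/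
def pair₃ : HopfDual k A ⊗[k] (HopfDual k A ⊗[k] HopfDual k A) ≃ₗ[k]
    (A ⊗[k] (A ⊗[k] A) →ₗ[k] k) :=
  (TensorProduct.congr (toDual k A) (pair k A)).trans
    (TensorProduct.dualDistribEquiv k A (A ⊗[k] A))

@[simp] lemma pair₃_tmul (f : HopfDual k A) (T : HopfDual k A ⊗[k] HopfDual k A)
    (a : A) (b : A ⊗[k] A) :
    pair₃ k A (f ⊗ₜ[k] T) (a ⊗ₜ[k] b) = f a * pair k A T b := by
  simp [pair₃]

/-- The coproduct `Δ f (a ⊗ b) = f (a * b)` and the counit `ε f = f 1` of `A^*`. -/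
instance : CoalgebraStruct k (HopfDual k A) where
  comul := (pair k A).symm.toLinearMap ∘ₗ
    (LinearMap.mul' k A).lcomp k k ∘ₗ (toDual k A).toLinearMap
  counit := LinearMap.applyₗ (1 : A) ∘ₗ (toDual k A).toLinearMap

@[simp] lemma pair_comul (f : HopfDual k A) (a b : A) :
    pair k A (comul f) (a ⊗ₜ[k] b) = f (a * b) := by
  simp [comul]

@[simp] lemma counit_apply (f : HopfDual k A) : counit (R := k) f = f 1 := rfl

lemma ext_pair {S T : HopfDual k A ⊗[k] HopfDual k A}
    (h : ∀ a b, pair k A S (a ⊗ₜ b) = pair k A T (a ⊗ₜ b)) : S = T := by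
  apply (pair k A).injective
  ext a b
  exact h a b

lemma pair₃_assoc (T : HopfDual k A ⊗[k] HopfDual k A) (f : HopfDual k A) (a b c : A) :
    pair₃ k A (TensorProduct.assoc k _ _ _ (T ⊗ₜ f)) (a ⊗ₜ (b ⊗ₜ c)) =
      pair k A T (a ⊗ₜ b) * f c := by
  induction T with
  | zero => simp
  | tmul x y => simp [mul_assoc]
  | add x y hx hy => simp [TensorProduct.add_tmul, hx, hy, add_mul]

lemma pair₃_rTensor (T : HopfDual k A ⊗[k] HopfDual k A) (a b c : A) :
    pair₃ k A (TensorProduct.assoc k _ _ _ ((comul (R := k)).rTensor _ T)) (a ⊗ₜ (b ⊗ₜ c)) =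
      pair k A T ((a * b) ⊗ₜ c) := by
  induction T with
  | zero => simp
  | tmul x y => simp [pair₃_assoc]
  | add x y hx hy => simp [hx, hy]

lemma pair₃_lTensor (T : HopfDual k A ⊗[k] HopfDual k A) (a b c : A) :
    pair₃ k A ((comul (R := k)).lTensor _ T) (a ⊗ₜ (b ⊗ₜ c)) =
      pair k A T (a ⊗ₜ (b * c)) := by
  induction T with
  | zero => simp
  | tmul x y => simp
  | add x y hx hy => simp [hx, hy]

lemma lid_apply (T : HopfDual k A ⊗[k] HopfDual k A) (a : A) :
    (TensorProduct.lid k _ ((counit (R := k)).rTensor _ T)) a = pair k A T (1 ⊗ₜ a) := by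
  induction T with
  | zero => simp
  | tmul x y => simp
  | add x y hx hy => simp [hx, hy]

lemma rid_apply (T : HopfDual k A ⊗[k] HopfDual k A) (a : A) :
    (TensorProduct.rid k _ ((counit (R := k)).lTensor _ T)) a = pair k A T (a ⊗ₜ 1) := by
  induction T with
  | zero => simp
  | tmul x y => simp [mul_comm]
  | add x y hx hy => simp [hx, hy]

instance : Coalgebra k (HopfDual k A) where
  coassoc := by
    ext f : 1
    apply (pair₃ k A).injective
    ext a b c
    simp [pair₃_rTensor, pair₃_lTensor, mul_assoc]
  rTensor_counit_comp_comul := by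
    ext f : 1
    apply (TensorProduct.lid k (HopfDual k A)).injective
    ext a
    simpa using! lid_apply (comul f) a
  lTensor_counit_comp_comul := by
    ext f : 1
    apply (TensorProduct.rid k (HopfDual k A)).injective
    ext a
    simpa using! rid_apply (comul f) a

lemma pair_mul (S T : HopfDual k A ⊗[k] HopfDual k A) {a b : A} {ι κ : Type*}
    (ra : Coalgebra.Repr k a ι) (rb : Coalgebra.Repr k b κ) :
    pair k A (S * T) (a ⊗ₜ b) = ∑ i ∈ ra.index, ∑ j ∈ rb.index,
      pair k A S (ra.left i ⊗ₜ rb.left j) * pair k A T (ra.right i ⊗ₜ rb.right j) := by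
  induction S with
  | zero => simp
  | add x y hx hy => simp [add_mul, hx, hy, Finset.sum_add_distrib]
  | tmul f g =>
    induction T with
    | zero => simp
    | add x y hx hy => simp [mul_add, hx, hy, Finset.sum_add_distrib]
    | tmul f' g' =>
      rw [Algebra.TensorProduct.tmul_mul_tmul, pair_tmul, mul_apply _ _ ra, mul_apply _ _ rb,
        Finset.sum_mul_sum]
      refine Finset.sum_congr rfl fun i _ => Finset.sum_congr rfl fun j _ => ?_
      simp only [pair_tmul]
      ring

instance : Bialgebra k (HopfDual k A) :=
  Bialgebra.mk' k (HopfDual k A)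
    (by simp)
    (by
      intro f g
      have h := mul_apply f g (⟨{()}, fun _ => (1 : A), fun _ => 1,
        by simp [Algebra.TensorProduct.one_def]⟩ : Coalgebra.Repr k (1 : A) Unit)
      simpa using h)
    (by
      apply ext_pair
      intro a b
      simp [Algebra.TensorProduct.one_def])
    (by
      intro f g
      apply ext_pair
      intro a b
      rw [pair_mul _ _ (ℛ k a) (ℛ k b)]
      simp only [pair_comul]
      rw [mul_apply _ _ ((ℛ k a).mul (ℛ k b))]
      simp [Finset.sum_product])

/-- The antipode `S f = f ∘ S` of `A^*`. -/
instance : HopfAlgebraStruct k (HopfDual k A) where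
  antipode := (toDual k A).symm.toLinearMap ∘ₗ
    (HopfAlgebra.antipode k (A := A)).lcomp k k ∘ₗ
      (toDual k A).toLinearMap

@[simp] lemma antipode_apply (f : HopfDual k A) (a : A) :
    HopfAlgebra.antipode k f a = f (HopfAlgebra.antipode k a) := rfl

lemma mul'_rTensor (T : HopfDual k A ⊗[k] HopfDual k A) {a : A} {ι : Type*}
    (ra : Coalgebra.Repr k a ι) :
    (LinearMap.mul' k (HopfDual k A) ((HopfAlgebra.antipode k).rTensor _ T)) a =
      ∑ i ∈ ra.index, pair k A T (HopfAlgebra.antipode k (ra.left i) ⊗ₜ ra.right i) := by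
  induction T with
  | zero => simp
  | add x y hx hy => simp [hx, hy, Finset.sum_add_distrib]
  | tmul f g => 
    rw [LinearMap.rTensor_tmul, LinearMap.mul'_apply, mul_apply _ _ ra]
    simp

lemma mul'_lTensor (T : HopfDual k A ⊗[k] HopfDual k A) {a : A} {ι : Type*}
    (ra : Coalgebra.Repr k a ι) :
    (LinearMap.mul' k (HopfDual k A) ((HopfAlgebra.antipode k).lTensor _ T)) a =
      ∑ i ∈ ra.index, pair k A T (ra.left i ⊗ₜ HopfAlgebra.antipode k (ra.right i)) := by
  induction T with
  | zero => simp
  | add x y hx hy => simp [hx, hy, Finset.sum_add_distrib]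
  | tmul f g => 
    rw [LinearMap.lTensor_tmul, LinearMap.mul'_apply, mul_apply _ _ ra]
    simp

instance : HopfAlgebra k (HopfDual k A) where
  mul_antipode_rTensor_comul := by
    ext f a
    refine (mul'_rTensor (comul f) (ℛ k a)).trans ?_
    simp only [pair_comul]
    have := congrArg f (HopfAlgebra.sum_antipode_mul_eq_smul (ℛ k a))
    rw [map_sum] at this
    rw [this]
    simp [mul_comm, Algebra.algebraMap_eq_smul_one]
  mul_antipode_lTensor_comul := by
    ext f a
    refine (mul'_lTensor (comul f) (ℛ k a)).trans ?_
    simp only [pair_comul]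
    have := congrArg f (HopfAlgebra.sum_mul_antipode_eq_smul (ℛ k a))
    rw [map_sum] at this
    rw [this]
    simp [mul_comm, Algebra.algebraMap_eq_smul_one]

end HopfDual
section TensorSmash

/-! Let `G` be an abelian group, `g i ∈ G` and `χ i` characters of `G`. These data are the same as
the Yetter-Drinfeld module `V = ⊕ k v_i` over `k[G]` with `v_i ∈ V^{χ_i}_{g_i}`, that is with
action `h → v_i = χ_i(h) v_i` and coaction `v_i ↦ g_i ⊗ v_i`. -/

variable (k : Type*) [Field k] {G : Type*} [CommGroup G] {ι : Type*}
  (g : ι → G) (χ : ι → G →* kˣ)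

/-- The defining relations of `T(V) # k[G]`: those of the group `G` and `h v_i = χ_i(h) v_i h`. -/
inductive TensorSmashRel : FreeAlgebra k (G ⊕ ι) → FreeAlgebra k (G ⊕ ι) → Prop
  | one : TensorSmashRel (FreeAlgebra.ι k (Sum.inl 1)) 1
  | mul (h h' : G) : TensorSmashRel (FreeAlgebra.ι k (Sum.inl (h * h')))
      (FreeAlgebra.ι k (Sum.inl h) * FreeAlgebra.ι k (Sum.inl h'))
  | comm (h : G) (i : ι) : TensorSmashRel
      (FreeAlgebra.ι k (Sum.inl h) * FreeAlgebra.ι k (Sum.inr i))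
      ((χ i h : k) • (FreeAlgebra.ι k (Sum.inr i) * FreeAlgebra.ι k (Sum.inl h)))

/-- The bosonization `T(V) # k[G]` of the tensor algebra of `V`. Its algebra structure depends only
on the action of `G`, its coproduct `Δ v_i = v_i ⊗ 1 + g_i ⊗ v_i` also on the coaction. -/
@[nolint unusedArguments]
def TensorSmash (_g : ι → G) (χ : ι → G →* kˣ) : Type _ := RingQuot (TensorSmashRel k χ)

namespace TensorSmash

instance : Ring (TensorSmash k g χ) := inferInstanceAs (Ring (RingQuot (TensorSmashRel k χ)))

instance : Algebra k (TensorSmash k g χ) :=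
  inferInstanceAs (Algebra k (RingQuot (TensorSmashRel k χ)))

/-- The quotient map from the free algebra. -/
def mk : FreeAlgebra k (G ⊕ ι) →ₐ[k] TensorSmash k g χ := RingQuot.mkAlgHom k _

lemma mk_surjective : Function.Surjective (mk k g χ) := RingQuot.mkAlgHom_surjective k _

/-- The elements `1 # h` for `h ∈ G`. -/
def grp : G →* TensorSmash k g χ where
  toFun h := mk k g χ (FreeAlgebra.ι k (Sum.inl h))
  map_one' := (RingQuot.mkAlgHom_rel k TensorSmashRel.one).trans (map_one _)
  map_mul' h h' := (RingQuot.mkAlgHom_rel k (TensorSmashRel.mul h h')).trans (map_mul _ _ _)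

/-- The elements `v_i # 1`. -/
def vec (i : ι) : TensorSmash k g χ := mk k g χ (FreeAlgebra.ι k (Sum.inr i))

lemma grp_mul_vec (h : G) (i : ι) :
    grp k g χ h * vec k g χ i = (χ i h : k) • (vec k g χ i * grp k g χ h) := by
  have := RingQuot.mkAlgHom_rel k (TensorSmashRel.comm (χ := χ) h i)
  rw [map_smul, map_mul, map_mul] at this
  exact this

variable {k g χ}

section lift

variable {B : Type*} [Ring B] [Algebra k B] (a : G →* B) (b : ι → B)
  (hab : ∀ h i, a h * b i = (χ i h : k) • (b i * a h))

/-- The algebra map given by the images of `G` and of the `v_i`. -/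
def lift : TensorSmash k g χ →ₐ[k] B :=
  RingQuot.liftAlgHom k ⟨FreeAlgebra.lift k (Sum.elim a b), by
    intro x y h
    cases h with
    | one => simp
    | mul h h' => simp
    | comm h i => simpa using hab h i⟩

@[simp] lemma lift_grp (h : G) : lift (g := g) a b hab (grp k g χ h) = a h := by
  refine (RingQuot.liftAlgHom_mkAlgHom_apply k _ _ _).trans ?_
  simp

@[simp] lemma lift_vec (i : ι) : lift (g := g) a b hab (vec k g χ i) = b i := by
  refine (RingQuot.liftAlgHom_mkAlgHom_apply k _ _ _).trans ?_
  simp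

end lift

lemma algHom_ext {B : Type*} [Semiring B] [Algebra k B] {f f' : TensorSmash k g χ →ₐ[k] B}
    (h₁ : ∀ h, f (grp k g χ h) = f' (grp k g χ h))
    (h₂ : ∀ i, f (vec k g χ i) = f' (vec k g χ i)) : f = f' := by
  refine RingQuot.ringQuot_ext' k f f' (FreeAlgebra.hom_ext (funext fun x => ?_))
  cases x with
  | inl h => exact h₁ h
  | inr i => exact h₂ i

lemma induction {P : TensorSmash k g χ → Prop} (hs : ∀ c, P (algebraMap k _ c))
    (hg : ∀ h, P (grp k g χ h)) (hv : ∀ i, P (vec k g χ i))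
    (hadd : ∀ x y, P x → P y → P (x + y)) (hmul : ∀ x y, P x → P y → P (x * y)) (x) : P x := by
  obtain ⟨y, rfl⟩ := mk_surjective k g χ x
  induction y using FreeAlgebra.induction with
  | grade0 r => simpa using hs r
  | grade1 x =>
    cases x with
    | inl h => exact hg h
    | inr i => exact hv i
  | mul a b ha hb => simpa using hmul _ _ ha hb
  | add a b ha hb => simpa using hadd _ _ ha hb

variable (k g χ)

/-- The coproduct on `G`. -/
def comulGrp : G →* TensorSmash k g χ ⊗[k] TensorSmash k g χ where
  toFun h := grp k g χ h ⊗ₜ grp k g χ h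
  map_one' := by simp [Algebra.TensorProduct.one_def]
  map_mul' := by simp

lemma comulGrp_apply (h : G) : comulGrp k g χ h = grp k g χ h ⊗ₜ grp k g χ h := rfl

/-- The coproduct: `h ↦ h ⊗ h` and `v_i ↦ v_i ⊗ 1 + g_i ⊗ v_i`. -/
def comulHom : TensorSmash k g χ →ₐ[k] TensorSmash k g χ ⊗[k] TensorSmash k g χ :=
  lift (comulGrp k g χ)
    (fun i => vec k g χ i ⊗ₜ 1 + grp k g χ (g i) ⊗ₜ vec k g χ i)
    (by
      intro h i
      simp only [comulGrp_apply, mul_add, add_mul,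
        Algebra.TensorProduct.tmul_mul_tmul, grp_mul_vec, mul_one, one_mul, smul_add]
      rw [← map_mul, ← map_mul, mul_comm h (g i), TensorProduct.smul_tmul',
        TensorProduct.tmul_smul])

/-- The counit: `h ↦ 1` and `v_i ↦ 0`. -/
def counitHom : TensorSmash k g χ →ₐ[k] k := lift 1 0 (by simp)

@[simp] lemma comulHom_grp (h : G) :
    comulHom k g χ (grp k g χ h) = grp k g χ h ⊗ₜ grp k g χ h := lift_grp _ _ _ h

@[simp] lemma comulHom_vec (i : ι) : comulHom k g χ (vec k g χ i) =
    vec k g χ i ⊗ₜ 1 + grp k g χ (g i) ⊗ₜ vec k g χ i := lift_vec _ _ _ i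

@[simp] lemma counitHom_grp (h : G) : counitHom k g χ (grp k g χ h) = 1 := lift_grp _ _ _ h

@[simp] lemma counitHom_vec (i : ι) : counitHom k g χ (vec k g χ i) = 0 := lift_vec _ _ _ i

instance : Bialgebra k (TensorSmash k g χ) :=
  Bialgebra.ofAlgHom (comulHom k g χ) (counitHom k g χ)
    (by
      apply algHom_ext <;> intro x
      · simp
      · simp [TensorProduct.tmul_add, TensorProduct.add_tmul, Algebra.TensorProduct.one_def,
          add_assoc])
    (by apply algHom_ext <;> intro x <;> simp)
    (by apply algHom_ext <;> intro x <;> simp)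

@[simp] lemma comul_grp (h : G) :
    comul (R := k) (grp k g χ h) = grp k g χ h ⊗ₜ grp k g χ h := comulHom_grp k g χ h

@[simp] lemma comul_vec (i : ι) : comul (R := k) (vec k g χ i) =
    vec k g χ i ⊗ₜ 1 + grp k g χ (g i) ⊗ₜ vec k g χ i := comulHom_vec k g χ i

@[simp] lemma counit_grp (h : G) : counit (R := k) (grp k g χ h) = 1 := counitHom_grp k g χ h

@[simp] lemma counit_vec (i : ι) : counit (R := k) (vec k g χ i) = 0 := counitHom_vec k g χ i

/-- The antipode on `G`. -/
def antipodeGrp : G →* (TensorSmash k g χ)ᵐᵒᵖ where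
  toFun h := MulOpposite.op (grp k g χ h⁻¹)
  map_one' := by simp
  map_mul' h h' := by rw [← MulOpposite.op_mul, ← map_mul, mul_inv_rev]

lemma antipodeGrp_apply (h : G) : antipodeGrp k g χ h = MulOpposite.op (grp k g χ h⁻¹) := rfl

/-- The antipode, an anti-homomorphism: `h ↦ h⁻¹` and `v_i ↦ - g_i⁻¹ v_i`. -/
def antipodeHom : TensorSmash k g χ →ₐ[k] (TensorSmash k g χ)ᵐᵒᵖ :=
  lift (antipodeGrp k g χ)
    (fun i => MulOpposite.op (-(grp k g χ (g i)⁻¹ * vec k g χ i)))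
    (by
      intro h i
      simp only [antipodeGrp_apply, ← MulOpposite.op_mul, ← MulOpposite.op_smul]
      congr 1
      rw [neg_mul, mul_neg, smul_neg, ← mul_assoc, ← map_mul, mul_assoc, mul_comm h⁻¹,
        map_mul, mul_assoc, ← mul_smul_comm]
      congr 2
      rw [grp_mul_vec, smul_smul, ← Units.val_mul, ← map_mul]
      simp)

instance : HopfAlgebraStruct k (TensorSmash k g χ) where
  antipode := (MulOpposite.opLinearEquiv k).symm.toLinearMap ∘ₗ (antipodeHom k g χ).toLinearMap

@[simp] lemma antipode_grp (h : G) :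
    HopfAlgebra.antipode k (grp k g χ h) = grp k g χ h⁻¹ :=
  congrArg MulOpposite.unop (lift_grp _ _ _ h)

@[simp] lemma antipode_vec (i : ι) :
    HopfAlgebra.antipode k (vec k g χ i) = -(grp k g χ (g i)⁻¹ * vec k g χ i) :=
  congrArg MulOpposite.unop (lift_vec _ _ _ i)

lemma antipode_mul' (x y : TensorSmash k g χ) : HopfAlgebra.antipode k (x * y) =
    HopfAlgebra.antipode k y * HopfAlgebra.antipode k x :=
  congrArg MulOpposite.unop (map_mul (antipodeHom k g χ) x y)

lemma antipode_one' : HopfAlgebra.antipode k (1 : TensorSmash k g χ) = 1 :=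
  congrArg MulOpposite.unop (map_one (antipodeHom k g χ))

lemma antipode_algebraMap (c : k) :
    HopfAlgebra.antipode k (algebraMap k (TensorSmash k g χ) c) = algebraMap k _ c :=
  congrArg MulOpposite.unop ((antipodeHom k g χ).commutes c)

lemma antipode_left (x : TensorSmash k g χ) :
    LinearMap.mul' k _ ((HopfAlgebra.antipode k).rTensor _ (comul (R := k) x)) =
      algebraMap k _ (counit (R := k) x) := by
  induction x using induction with
  | hs c => simp [Algebra.TensorProduct.algebraMap_apply, antipode_algebraMap]
  | hg h => simp [← map_mul]
  | hv i => simp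
  | hadd x y hx hy => simp only [map_add, hx, hy]
  | hmul x y hx hy =>
    rw [← (ℛ k x).eq] at hx
    rw [← (ℛ k y).eq] at hy
    rw [← ((ℛ k x).mul (ℛ k y)).eq]
    simp only [map_sum, LinearMap.rTensor_tmul, LinearMap.mul'_apply] at hx hy ⊢
    simp only [Coalgebra.Repr.mul_index, Coalgebra.Repr.mul_left, Coalgebra.Repr.mul_right,
      Finset.sum_product_right, antipode_mul', Bialgebra.counit_mul]
    calc _ = ∑ j ∈ (ℛ k y).index, HopfAlgebra.antipode k ((ℛ k y).left j) *
          (∑ i ∈ (ℛ k x).index, HopfAlgebra.antipode k ((ℛ k x).left i) * (ℛ k x).right i) *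
            (ℛ k y).right j := by
          simp only [Finset.mul_sum, Finset.sum_mul, mul_assoc]
      _ = _ := by
          rw [hx]
          simp only [← Algebra.commutes, mul_assoc]
          rw [← Finset.mul_sum, hy, map_mul]

lemma antipode_right (x : TensorSmash k g χ) :
    LinearMap.mul' k _ ((HopfAlgebra.antipode k).lTensor _ (comul (R := k) x)) =
      algebraMap k _ (counit (R := k) x) := by
  induction x using induction with
  | hs c => simp [Algebra.TensorProduct.algebraMap_apply, antipode_one']
  | hg h => simp [← map_mul]
  | hv i => simp [← mul_assoc, ← map_mul, antipode_one']
  | hadd x y hx hy => simp only [map_add, hx, hy]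
  | hmul x y hx hy =>
    rw [← (ℛ k x).eq] at hx
    rw [← (ℛ k y).eq] at hy
    rw [← ((ℛ k x).mul (ℛ k y)).eq]
    simp only [map_sum, LinearMap.lTensor_tmul, LinearMap.mul'_apply] at hx hy ⊢
    simp only [Coalgebra.Repr.mul_index, Coalgebra.Repr.mul_left, Coalgebra.Repr.mul_right,
      Finset.sum_product, antipode_mul', Bialgebra.counit_mul]
    calc _ = ∑ i ∈ (ℛ k x).index, (ℛ k x).left i *
          (∑ j ∈ (ℛ k y).index, (ℛ k y).left j * HopfAlgebra.antipode k ((ℛ k y).right j)) *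
            HopfAlgebra.antipode k ((ℛ k x).right i) := by
          simp only [Finset.mul_sum, Finset.sum_mul, mul_assoc]
      _ = _ := by
          rw [hy]
          simp only [← Algebra.commutes, mul_assoc]
          rw [← Finset.mul_sum, hx, ← map_mul, mul_comm]

instance : HopfAlgebra k (TensorSmash k g χ) where
  mul_antipode_rTensor_comul := LinearMap.ext (antipode_left k g χ)
  mul_antipode_lTensor_comul := LinearMap.ext (antipode_right k g χ)

/-- The component of degree `n` of `T(V) # k[G]`. -/
def deg (n : ℕ) : Submodule k (TensorSmash k g χ) :=
  Submodule.span k {z | ∃ (h : G) (l : List ι), l.length = n ∧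
    z = grp k g χ h * (l.map (vec k g χ)).prod}

end TensorSmash

/-- The largest Hopf ideal of `T(V) # k[G]` contained in the part of degree at least `2`. It is
`I(V) # k[G]`, where `I(V)` is the kernel of the map from `T(V)` to the Nichols algebra `B(V)`. -/
def nicholsIdeal : Ideal (TensorSmash k g χ) :=
  sSup {J | J.IsTwoSided ∧ J.IsHopfIdeal k ∧
    J.restrictScalars k ≤ ⨆ n ≥ 2, TensorSmash.deg k g χ n}

lemma nicholsIdeal_induction {p : TensorSmash k g χ → Prop}
    (mem : ∀ J : Ideal (TensorSmash k g χ), J.IsTwoSided → J.IsHopfIdeal k →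
      J ≤ nicholsIdeal k g χ → ∀ x ∈ J, p x)
    (zero : p 0) (add : ∀ x y, p x → p y → p (x + y))
    {x : TensorSmash k g χ} (hx : x ∈ nicholsIdeal k g χ) : p x := by
  rw [nicholsIdeal, sSup_eq_iSup'] at hx
  exact Submodule.iSup_induction _ (motive := p) hx
    (fun J x hx => mem J.1 J.2.1 J.2.2.1 (le_sSup J.2) x hx) zero add

instance : (nicholsIdeal k g χ).IsTwoSided where
  mul_mem_of_left b ha := by
    refine nicholsIdeal_induction k g χ (p := fun x => x * b ∈ nicholsIdeal k g χ) ?_ ?_ ?_ ha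
    · intro J hJ _ hle x hx
      exact hle (J.mul_mem_right b hx)
    · simp
    · intro x y hx hy
      rw [add_mul]
      exact add_mem hx hy

instance : (nicholsIdeal k g χ).IsHopfIdeal k where
  counit_eq_zero x hx := by
    refine nicholsIdeal_induction k g χ (p := fun x => counit (R := k) x = 0) ?_ ?_ ?_ hx
    · intro J _ hJ _ x hx
      exact hJ.counit_eq_zero hx
    · simp
    · intro x y hx hy
      rw [map_add, hx, hy, add_zero]
  map_mkQ_comul_eq_zero x hx := by
    refine nicholsIdeal_induction k g χ (p := fun x => TensorProduct.map
        ((nicholsIdeal k g χ).restrictScalars k).mkQ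
        ((nicholsIdeal k g χ).restrictScalars k).mkQ (comul (R := k) x) = 0) ?_ ?_ ?_ hx
    · intro J _ hJ hle x hx
      have hle' : J.restrictScalars k ≤ (nicholsIdeal k g χ).restrictScalars k := hle
      rw [← Submodule.factor_comp_mk hle', TensorProduct.map_comp, LinearMap.comp_apply,
        hJ.map_mkQ_comul_eq_zero hx, map_zero]
    · simp
    · intro x y hx hy
      rw [map_add, map_add, hx, hy, add_zero]
  antipode_mem x hx := by
    refine nicholsIdeal_induction k g χ
      (p := fun x => HopfAlgebra.antipode k x ∈ nicholsIdeal k g χ) ?_ ?_ ?_ hx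
    · intro J _ hJ hle x hx
      exact hle (hJ.antipode_mem hx)
    · simp
    · intro x y hx hy
      rw [map_add]
      exact add_mem hx hy

/-- `B(V) # k[G]`, the bosonization of the Nichols algebra `B(V)`. -/
abbrev NicholsSmash : Type _ := TensorSmash k g χ ⧸ nicholsIdeal k g χ

namespace NicholsSmash

/-- The quotient map `T(V) # k[G] → B(V) # k[G]`. -/
def mk : TensorSmash k g χ →ₐc[k] NicholsSmash k g χ :=
  Bialgebra.Quotient.mkBialgHom (nicholsIdeal k g χ)

/-- The element `1 # h` of `B(V) # k[G]`. -/
def grp (h : G) : NicholsSmash k g χ := mk k g χ (TensorSmash.grp k g χ h)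

/-- The element `v_i # 1` of `B(V) # k[G]`. -/
def vec (i : ι) : NicholsSmash k g χ := mk k g χ (TensorSmash.vec k g χ i)

/-- The component of degree `n` of `B(V) # k[G]`. -/
def deg (n : ℕ) : Submodule k (NicholsSmash k g χ) :=
  (TensorSmash.deg k g χ n).map (Ideal.Quotient.mkₐ k (nicholsIdeal k g χ)).toLinearMap

end NicholsSmash

end TensorSmash

section Coradical

variable (k : Type*) [Field k] {C : Type*} [AddCommGroup C] [Module k C] [Coalgebra k C]

/-- `D` is a subcoalgebra of `C`: `Δ(D) ⊆ D ⊗ D`. -/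
def IsSubcoalgebra (D : Submodule k C) : Prop :=
  ∀ d ∈ D, comul (R := k) d ∈ LinearMap.range (TensorProduct.map D.subtype D.subtype)

/-- `E` is a simple subcoalgebra of `C`. -/
def IsSimpleSubcoalgebra (E : Submodule k C) : Prop :=
  IsSubcoalgebra k E ∧ E ≠ ⊥ ∧ ∀ F ≤ E, IsSubcoalgebra k F → F = ⊥ ∨ F = E

/-- The coradical of a subcoalgebra `D` of `C`: the sum of the simple subcoalgebras of `D`. -/
def corad (D : Submodule k C) : Submodule k C :=
  sSup {E | IsSimpleSubcoalgebra k E ∧ E ≤ D}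

/-- A subcoalgebra `D` is pointed if its simple subcoalgebras are one-dimensional. -/
def IsPointed (D : Submodule k C) : Prop :=
  ∀ E ≤ D, IsSimpleSubcoalgebra k E → Module.finrank k E = 1

variable (C) in
/-- The coradical filtration of `C`: `C_0` is the coradical of `C` and
`C_{n+1} = Δ⁻¹(C ⊗ C_n + C_0 ⊗ C)`. -/
def coradFil : ℕ → Submodule k C
  | 0 => corad k ⊤
  | n + 1 => (LinearMap.range ((coradFil n).subtype.lTensor C) ⊔
      LinearMap.range ((corad k (⊤ : Submodule k C)).subtype.rTensor C)).comap (comul (R := k))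

/-- The subcoalgebras `D` and `E` of `C` are isomorphic as coalgebras. -/
def SubcoalgebraIso (D E : Submodule k C) : Prop :=
  ∃ e : D ≃ₗ[k] E, (∀ d : D, counit (R := k) (e d : C) = counit (R := k) (d : C)) ∧
    ∀ d : D, ∃ T : D ⊗[k] D,
      comul (R := k) (d : C) = TensorProduct.map D.subtype D.subtype T ∧
      comul (R := k) (e d : C) =
        TensorProduct.map E.subtype E.subtype (TensorProduct.map e.toLinearMap e.toLinearMap T)

end Coradical

/-- `B` is a sub-Hopf algebra of `H`. -/
def IsHopfSubalgebra {k : Type*} [Field k] {H : Type*} [Ring H] [HopfAlgebra k H]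
    (B : Subalgebra k H) : Prop :=
  IsSubcoalgebra k (Subalgebra.toSubmodule B) ∧ ∀ b ∈ B, HopfAlgebra.antipode k b ∈ B

section Lifting

variable {k : Type*} [Field k] {G : Type*} [CommGroup G] {t : ℕ}

/-- `A` is a lifting of `B(V) # k[G]`: the coradical of `A` is a sub-Hopf algebra, and `symb`
is an isomorphism of graded Hopf algebras from the associated graded Hopf algebra
`gr A = ⊕ A_n / A_{n-1}` of the coradical filtration to `B(V) # k[G]`. It is given by its
components, the maps `symb n` from `A_n` onto the part of degree `n` with kernel `A_{n-1}`. -/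
structure Lifting (g : Fin t → G) (χ : Fin t → CharGroup k G)
    (A : Type*) [Ring A] [HopfAlgebra k A] where
  corad_isHopfSubalgebra : ∃ B : Subalgebra k A,
    Subalgebra.toSubmodule B = corad k ⊤ ∧ IsHopfSubalgebra B
  symb (n : ℕ) : coradFil k A n →ₗ[k] NicholsSmash k g χ
  range_symb (n : ℕ) : LinearMap.range (symb n) = NicholsSmash.deg k g χ n
  ker_symb_zero : LinearMap.ker (symb 0) = ⊥
  ker_symb_succ (n : ℕ) :
    LinearMap.ker (symb (n + 1)) = (coradFil k A n).comap (coradFil k A (n + 1)).subtype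
  symb_one : ∃ h : (1 : A) ∈ coradFil k A 0, symb 0 ⟨1, h⟩ = 1
  symb_mul (m n : ℕ) (a : coradFil k A m) (b : coradFil k A n) :
    ∃ h : (a * b : A) ∈ coradFil k A (m + n), symb (m + n) ⟨a * b, h⟩ = symb m a * symb n b
  symb_counit (a : coradFil k A 0) : counit (R := k) (symb 0 a) = counit (R := k) (a : A)
  /-- In degree `n` the coproduct of `gr A` is induced by
  `Δ : A_n → ∑_{i + j = n} A_i ⊗ A_j`. -/
  symb_comul (n : ℕ) (a : coradFil k A n) :
    ∃ T : ∀ p : ℕ × ℕ, coradFil k A p.1 ⊗[k] coradFil k A p.2,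
      comul (R := k) (a : A) = ∑ p ∈ Finset.HasAntidiagonal.antidiagonal n,
        TensorProduct.map (coradFil k A p.1).subtype (coradFil k A p.2).subtype (T p) ∧
      comul (R := k) (symb n a) = ∑ p ∈ Finset.HasAntidiagonal.antidiagonal n,
        TensorProduct.map (symb p.1) (symb p.2) (T p)

/-- `V` is a quantum linear space. -/
def IsQuantumLinearSpace (g : Fin t → G) (χ : Fin t → CharGroup k G) : Prop :=
  ∀ i j, i ≠ j → χ i (g j) * χ j (g i) = 1

/-- The conditions on the matrix of a lifting of a quantum linear space. -/
structure IsLiftingMatrix (g : Fin t → G) (χ : Fin t → CharGroup k G) (r : Fin t → ℕ)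
    (α : Matrix (Fin t) (Fin t) k) : Prop where
  diag_eq (i : Fin t) : α i i = 0 ∨ α i i = 1
  diag_eq_zero (i : Fin t) : g i ^ r i = 1 ∨ χ i ^ r i ≠ 1 → α i i = 0
  eq_zero (i j : Fin t) : i ≠ j → g i * g j = 1 ∨ χ i * χ j ≠ 1 → α i j = 0
  swap (i j : Fin t) : i ≠ j → α j i = -((χ i (g j) : k) * α i j)

/-- `A` is a lifting of `B(V) # k[G]` with matrix `α`: the liftings `x i` of the `v_i # 1` are
`(1, g_i)`-primitive, generate `A` together with the group `G` of group-likes, and satisfy the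
relations given by `α`. -/
structure LiftingWithMatrix (g : Fin t → G) (χ : Fin t → CharGroup k G) (r : Fin t → ℕ)
    (α : Matrix (Fin t) (Fin t) k) (A : Type*) [Ring A] [HopfAlgebra k A]
    extends Lifting g χ A where
  grp : G →* A
  x : Fin t → A
  grp_isGroupLike (h : G) : IsGroupLikeElem k (grp h)
  symb_grp (h : G) : ∃ hh : grp h ∈ coradFil k A 0, symb 0 ⟨grp h, hh⟩ = NicholsSmash.grp k g χ h
  comul_x (i : Fin t) : comul (R := k) (x i) = x i ⊗ₜ 1 + grp (g i) ⊗ₜ x i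
  symb_x (i : Fin t) : ∃ hi : x i ∈ coradFil k A 1, symb 1 ⟨x i, hi⟩ = NicholsSmash.vec k g χ i
  generate : Algebra.adjoin k (Set.range grp ∪ Set.range x) = ⊤
  grp_mul_x (h : G) (i : Fin t) : grp h * x i = (χ i h : k) • (x i * grp h)
  x_pow (i : Fin t) : x i ^ r i = α i i • (grp (g i ^ r i) - 1)
  x_mul_x (i j : Fin t) : i ≠ j →
    x i * x j = (χ j (g i) : k) • (x j * x i) + α i j • (grp (g i * g j) - 1)

/-- The ordered monomial `x_1^{m_1} ⋯ x_t^{m_t}`. -/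
def monomialOf {A : Type*} [Monoid A] (x : Fin t → A) (m : Fin t → ℕ) : A :=
  (List.ofFn fun i => x i ^ m i).prod

/-- `Θ`, the subgroup of the character group generated by the `χ_i`. -/
def Theta (χ : Fin t → CharGroup k G) : Subgroup (CharGroup k G) :=
  Subgroup.closure (Set.range χ)

/-- `Ω`, the subgroup of the characters that vanish on `α_{ii} (g_i^{r_i} - 1)` and on
`α_{ij} (g_i g_j - 1)` for `i ≠ j`. -/
def Omega (g : Fin t → G) (r : Fin t → ℕ) (α : Matrix (Fin t) (Fin t) k) :
    Subgroup (CharGroup k G) where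
  carrier := {γ | (∀ i, α i i * ((γ (g i ^ r i) : k) - 1) = 0) ∧
    ∀ i j, i ≠ j → α i j * ((γ (g i * g j) : k) - 1) = 0}
  one_mem' := by simp
  mul_mem' := by
    intro γ γ' h h'
    have aux (c u v : k) (hu : c * (u - 1) = 0) (hv : c * (v - 1) = 0) :
        c * (u * v - 1) = 0 := by linear_combination v * hu + hv
    exact ⟨fun i => aux _ _ _ (h.1 i) (h'.1 i), fun i j hij => aux _ _ _ (h.2 i j hij)
      (h'.2 i j hij)⟩
  inv_mem' := by
    intro γ h
    have aux (c : k) (u : kˣ) (hu : c * ((u : k) - 1) = 0) : c * ((u⁻¹ : kˣ) - 1 : k) = 0 := by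
      have := u.inv_mul
      linear_combination (-(u⁻¹ : kˣ) : k) * hu + c * this
    exact ⟨fun i => aux _ _ (h.1 i), fun i j hij => aux _ _ (h.2 i j hij)⟩

/-- `Γ'`, the subgroup generated by the `g_i^{r_i}` with `α_{ii} ≠ 0` and the `g_i g_j`, `i ≠ j`,
with `α_{ij} ≠ 0`. -/
def GammaPrime (g : Fin t → G) (r : Fin t → ℕ) (α : Matrix (Fin t) (Fin t) k) : Subgroup G :=
  Subgroup.closure ({h | ∃ i, α i i ≠ 0 ∧ h = g i ^ r i} ∪
    {h | ∃ i j, i ≠ j ∧ α i j ≠ 0 ∧ h = g i * g j})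

/-- The `χ_i` as elements of a subgroup `Λ` of the character group that contains them. -/
def dualDeg {χ : Fin t → CharGroup k G} {Λ : Subgroup (CharGroup k G)} (h : Theta χ ≤ Λ)
    (i : Fin t) : Λ :=
  ⟨χ i, h (Subgroup.subset_closure ⟨i, rfl⟩)⟩

/-- The `g_i` as characters `γ ↦ γ(g_i)` of a subgroup `Λ` of the character group. -/
def dualChar (Λ : Subgroup (CharGroup k G)) (g : Fin t → G) (i : Fin t) : CharGroup k Λ :=
  (MonoidHom.eval (g i)).comp Λ.subtype

/-- `B(W) # k[Λ]`, where `Θ ≤ Λ` and `W = ⊕ k w_i` with `w_i ∈ W^{g_i}_{χ_i}`, that is with action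
`γ → w_i = γ(g_i) w_i` and coaction `w_i ↦ χ_i ⊗ w_i`. -/
abbrev DualNicholsSmash (g : Fin t → G) {χ : Fin t → CharGroup k G}
    {Λ : Subgroup (CharGroup k G)} (h : Theta χ ≤ Λ) : Type _ :=
  NicholsSmash k (dualDeg h) (dualChar Λ g)

/-- For a basis `h x^m` of `A`, the element `w(γ, x^n)` of `A^*`, which maps `h x^n` to `γ(h)` and
the other basis elements to `0`. -/
def dualElt {A : Type*} [Ring A] [HopfAlgebra k A] {r : Fin t → ℕ}
    (b : Module.Basis (G × (∀ i, Fin (r i))) k A) (γ : CharGroup k G) (n : Fin t → ℕ) :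
    HopfDual k A :=
  (HopfDual.toDual k A).symm
    (b.constr k fun p => if (fun i => (p.2 i : ℕ)) = n then (γ p.1 : k) else 0)

end Lifting

end

/-! The relations of `A` differ from those of `B(V) # k[Γ]` only by multiples of `h - 1`, where `h`
runs over the generators of `Γ'`. If `χ_i = χ_j` whenever `α_ij ≠ 0`, then every `χ_l` is trivial on
`Γ'` (`IsLiftingMatrix.theta_le_omega`), so `Γ'` is central in `A`. The forms on `A` that are
invariant under `Γ'` are then a subcoalgebra of `A^*`, and they do not see the deformation: for them
`x_i^{r_i}` is zero and the `x_i` commute up to scalars. They treat words in the `x_i` as if `A`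
were graded (`apply_grp_mul_word_eq_zero`). By degree, `w(γ,1)` with `γ ∈ Ω` is then multiplicative
and `w_i` is a skew derivation, which gives their coproducts.

The monomials span by reordering words. For independence, forms on `B(V) # k[Γ]` detect degrees 0
and 1 and are pulled back along `symb`. Higher degrees follow from the coproduct
(`exists_functional_monomial`), because the coefficient of `x_i ⊗ x^{m-e_i}` in `Δ x^m` is, up to a
unit, a quantum integer that is nonzero for `0 < m_i < r_i`.

The algebra map `T(W) # k[Λ] → A^*` respects degrees, and independence of characters makes it
injective in degrees 0 and 1. For `Λ ≤ Ω` its kernel is thus a Hopf ideal in degree at least 2.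
Conversely, a Hopf ideal `J` in degree at least 2 maps to forms that vanish on the generators of
`A`. Since `Δ J ⊆ J ⊗ T + T ⊗ J`, the elements killed by all these forms are closed under products,
so the forms are zero. Hence the kernel is the Nichols ideal (`mem_nicholsIdeal_iff`). The image
consists of the forms invariant under the annihilator of `Λ` (`range_tensorMap`): this is `C(1̄)`
for `Θ` and `B` for `Ω`.

The common kernel of the `χ_i` is central, so its weight spaces in `A^*` are subcoalgebras. By
duality distinct classes modulo `Θ` give distinct weights, and these spaces are the `C(γ̄)`. Every
`w(γ,1)` is invertible, group-like or not, and multiplication by it permutes them. Finally, the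
`x_i` act on `B` by right translation as nilpotent operators that commute up to scalars. Every
nonzero subcoalgebra of `B` therefore contains a nonzero weight vector killed by all of them, and
such a vector is a multiple of a group-like `w(γ,1)` (`exists_eq_span_of_isSimpleSubcoalgebra`). -/

noncomputable section

/-! ### Isotypic decomposition for a finite abelian group -/

section Isotypic

variable {k : Type*} [Field k] {H : Type*} [CommGroup H] {V : Type*} [AddCommGroup V] [Module k V]

/-- The space of vectors on which a group `H` acts through the character `ψ`. -/
def isotypic (ρ : H →* Module.End k V) (ψ : CharGroup k H) : Submodule k V where
  carrier := {v | ∀ h, ρ h v = (ψ h : k) • v}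
  add_mem' := by
    intro v w hv hw h
    rw [map_add, hv h, hw h, smul_add]
  zero_mem' := by simp
  smul_mem' := by
    intro c v hv h
    rw [map_smul, hv h, smul_comm]

lemma mem_isotypic {ρ : H →* Module.End k V} {ψ : CharGroup k H} {v : V} :
    v ∈ isotypic ρ ψ ↔ ∀ h, ρ h v = (ψ h : k) • v := Iff.rfl

lemma sum_char_eq_zero [Fintype H] {ψ : CharGroup k H} (h : ψ ≠ 1) : ∑ x, (ψ x : k) = 0 :=
  sum_hom_units_eq_zero ((Units.coeHom k).comp ψ) fun h' => h (by
    ext x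
    simpa using DFunLike.congr_fun h' x)

/-- The projection to the isotypic component, as an average over the group. -/
def isotypicProj [Fintype H] (ρ : H →* Module.End k V) (ψ : CharGroup k H) : Module.End k V :=
  (Fintype.card H : k)⁻¹ • ∑ h, (ψ h⁻¹ : k) • ρ h

lemma isotypicProj_apply [Fintype H] (ρ : H →* Module.End k V) (ψ : CharGroup k H) (v : V) :
    isotypicProj ρ ψ v = (Fintype.card H : k)⁻¹ • ∑ h, (ψ h⁻¹ : k) • ρ h v := by
  simp [isotypicProj, LinearMap.sum_apply]

lemma isotypicProj_mem [Fintype H] (ρ : H →* Module.End k V) (ψ : CharGroup k H) (v : V) :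
    isotypicProj ρ ψ v ∈ isotypic ρ ψ := by
  intro h
  rw [isotypicProj_apply, map_smul, smul_comm (ψ h : k)]
  congr 1
  rw [map_sum, Finset.smul_sum,
    ← Equiv.sum_comp (Equiv.mulLeft h) (fun x => (ψ h : k) • (ψ x⁻¹ : k) • ρ x v)]
  refine Finset.sum_congr rfl fun x _ => ?_
  rw [map_smul, ← Module.End.mul_apply, ← map_mul, smul_smul, Equiv.coe_mulLeft, mul_inv_rev,
    ← Units.val_mul, ← map_mul ψ, mul_inv_cancel_comm_assoc]

lemma isotypicProj_of_mem [CharZero k] [Fintype H] {ρ : H →* Module.End k V} {ψ : CharGroup k H} {v : V}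
    (hv : v ∈ isotypic ρ ψ) : isotypicProj ρ ψ v = v := by
  rw [isotypicProj_apply]
  have : ∀ h ∈ Finset.univ, (ψ h⁻¹ : k) • ρ h v = v := fun h _ => by
    rw [hv h, smul_smul, ← Units.val_mul, ← map_mul]
    simp
  rw [Finset.sum_congr rfl this, Finset.sum_const, Finset.card_univ, ← Nat.cast_smul_eq_nsmul k,
    smul_smul, inv_mul_cancel₀ (by simp), one_smul]

lemma isotypicProj_of_mem_ne [Fintype H] {ρ : H →* Module.End k V} {ψ ψ' : CharGroup k H} {v : V}
    (hv : v ∈ isotypic ρ ψ') (h : ψ' ≠ ψ) : isotypicProj ρ ψ v = 0 := by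
  rw [isotypicProj_apply]
  have : ∀ h ∈ Finset.univ, (ψ h⁻¹ : k) • ρ h v = (((ψ⁻¹ * ψ') h : kˣ) : k) • v := fun h _ => by
    rw [hv h, smul_smul, ← Units.val_mul]
    simp
  rw [Finset.sum_congr rfl this, ← Finset.sum_smul, sum_char_eq_zero, zero_smul, smul_zero]
  intro h'
  exact h (inv_mul_eq_one.1 h').symm

variable [CharZero k] [Finite H]

/-- The averaging projection for `ψ` fixes its own component and kills all others. -/
lemma iSupIndep_isotypic (ρ : H →* Module.End k V) : iSupIndep (isotypic ρ) := by
  have := Fintype.ofFinite H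
  intro ψ
  rw [Submodule.disjoint_def]
  intro v hv hv'
  rw [← isotypicProj_of_mem hv]
  have : (⨆ ψ', ⨆ (_ : ψ' ≠ ψ), isotypic ρ ψ') ≤ LinearMap.ker (isotypicProj ρ ψ) :=
    iSup₂_le fun ψ' h w hw => isotypicProj_of_mem_ne hw h
  exact this hv'

variable [IsAlgClosed k]

instance : HasEnoughRootsOfUnity k (Monoid.exponent H) := by
  have : NeZero ((Monoid.exponent H : ℕ) : k) :=
    ⟨Nat.cast_ne_zero.2 Monoid.exponent_ne_zero_of_finite⟩
  infer_instance

instance : Finite (CharGroup k H) :=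
  Finite.of_equiv _
    (CommGroup.monoidHom_mulEquiv_of_hasEnoughRootsOfUnity H k).some.toEquiv.symm

/-- Double duality for subgroups of the character group. -/
lemma mem_of_forall_apply_eq_one (Θ : Subgroup (CharGroup k H)) {γ : CharGroup k H}
    (h : ∀ x, (∀ θ ∈ Θ, θ x = 1) → γ x = 1) : γ ∈ Θ := by
  rw [← OrderDual.ofDual_toDual Θ,
    ← (CommGroup.subgroupOrderIsoSubgroupMonoidHom H k).apply_symm_apply (OrderDual.toDual Θ)]
  rw [CommGroup.mem_subgroupOrderIsoSubgroupMonoidHom_iff]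
  intro x hx
  exact h x ((CommGroup.mem_subgroupOrderIsoSubgroupMonoidHom_symm_iff k Θ x).1 hx)

/-- Summing over the characters first leaves only `h = 1`, since some character separates any other
`h` from `1`; there are as many characters as group elements. -/
lemma sum_isotypicProj [Fintype H] [Fintype (CharGroup k H)] (ρ : H →* Module.End k V) (v : V) :
    ∑ ψ, isotypicProj ρ ψ v = v := by
  simp only [isotypicProj_apply]
  rw [← Finset.smul_sum, Finset.sum_comm]
  simp only [← Finset.sum_smul]
  rw [Finset.sum_eq_single 1]
  · have hc : Fintype.card (CharGroup k H) = Fintype.card H := by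
      rw [← Nat.card_eq_fintype_card, ← Nat.card_eq_fintype_card]
      exact CommGroup.card_monoidHom_of_hasEnoughRootsOfUnity H k
    simp [hc, smul_smul]
  · intro h _ hh
    have key : ∑ ψ : CharGroup k H, (ψ h⁻¹ : k) = 0 := by
      refine sum_hom_units_eq_zero ((Units.coeHom k).comp (MonoidHom.eval h⁻¹)) fun h' => ?_
      obtain ⟨ψ, hψ⟩ := CommGroup.exists_apply_ne_one_of_hasEnoughRootsOfUnity H k
        (inv_ne_one.2 hh)
      exact hψ (by simpa using DFunLike.congr_fun h' ψ)
    rw [key, zero_smul]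
  · simp

/-- A stable subspace is the sum of its isotypic components. -/
lemma le_iSup_isotypic_inf (ρ : H →* Module.End k V) {E : Submodule k V}
    (hE : ∀ h, ∀ v ∈ E, ρ h v ∈ E) : E ≤ ⨆ ψ, isotypic ρ ψ ⊓ E := by
  have := Fintype.ofFinite H
  have := Fintype.ofFinite (CharGroup k H)
  intro v hv
  rw [← sum_isotypicProj ρ v]
  refine Submodule.sum_mem _ fun ψ _ => Submodule.mem_iSup_of_mem ψ ⟨isotypicProj_mem ρ ψ v, ?_⟩
  rw [isotypicProj_apply]
  exact E.smul_mem _ (E.sum_mem fun h _ => E.smul_mem _ (hE h v hv))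

/-- The source of weight vectors inside nonzero subcoalgebras. -/
lemma exists_isotypic_inf_ne_bot (ρ : H →* Module.End k V) {E : Submodule k V}
    (hE : ∀ h, ∀ v ∈ E, ρ h v ∈ E) (h0 : E ≠ ⊥) : ∃ ψ, isotypic ρ ψ ⊓ E ≠ ⊥ := by
  by_contra! h
  exact h0 (le_bot_iff.1 ((le_iSup_isotypic_inf ρ hE).trans (by simp [h])))

end Isotypic

/-- The characters of `G / N` are the characters of `G` that are trivial on `N`. -/
def quotientCharEquiv {k G : Type*} [Field k] [CommGroup G] (N : Subgroup G)
    (Λ : Subgroup (CharGroup k G)) (h : ∀ γ, γ ∈ Λ ↔ ∀ x ∈ N, γ x = 1) :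
    CharGroup k (G ⧸ N) ≃* Λ where
  toFun ψ := ⟨ψ.comp (QuotientGroup.mk' N), (h _).2 fun x hx => by
    simp [(QuotientGroup.eq_one_iff x).2 hx]⟩
  invFun γ := QuotientGroup.lift N γ.1 ((h _).1 γ.2)
  left_inv ψ := by ext x; rfl
  right_inv γ := by ext x; rfl
  map_mul' ψ ψ' := rfl

/-! ### Translations of linear forms and subcoalgebras of the dual -/

namespace HopfDual

variable {k : Type*} [Field k] {A : Type*} [Ring A] [HopfAlgebra k A]

variable (k) in
/-- `f ↦ f(a ·)`. -/
def leftTranslate (a : A) : HopfDual k A →ₗ[k] HopfDual k A :=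
  (toDual k A).symm.toLinearMap ∘ₗ (LinearMap.mulLeft k a).lcomp k k ∘ₗ (toDual k A).toLinearMap

variable (k) in
/-- `f ↦ f(· a)`. -/
def rightTranslate (a : A) : HopfDual k A →ₗ[k] HopfDual k A :=
  (toDual k A).symm.toLinearMap ∘ₗ (LinearMap.mulRight k a).lcomp k k ∘ₗ (toDual k A).toLinearMap

@[simp] lemma leftTranslate_apply (a : A) (f : HopfDual k A) (b : A) :
    leftTranslate k a f b = f (a * b) := rfl

@[simp] lemma rightTranslate_apply (a : A) (f : HopfDual k A) (b : A) :
    rightTranslate k a f b = f (b * a) := rfl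

@[simp] lemma sum_apply {ι : Type*} (s : Finset ι) (f : ι → HopfDual k A) (a : A) :
    (∑ i ∈ s, f i) a = ∑ i ∈ s, f i a := by
  rw [← toDual_apply, map_sum, LinearMap.sum_apply]
  rfl

section Subcoalgebra

variable (k) in
/-- Evaluation of the first tensor factor. -/
def evalLeft (a : A) : HopfDual k A ⊗[k] HopfDual k A →ₗ[k] HopfDual k A :=
  (TensorProduct.lid k _).toLinearMap ∘ₗ
    ((LinearMap.applyₗ a ∘ₗ (toDual k A).toLinearMap).rTensor _)

variable (k) in
/-- Evaluation of the second tensor factor. -/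
def evalRight (a : A) : HopfDual k A ⊗[k] HopfDual k A →ₗ[k] HopfDual k A :=
  (TensorProduct.rid k _).toLinearMap ∘ₗ
    ((LinearMap.applyₗ a ∘ₗ (toDual k A).toLinearMap).lTensor _)

@[simp] lemma evalLeft_tmul (a : A) (f f' : HopfDual k A) :
    evalLeft k a (f ⊗ₜ f') = f a • f' := by
  simp [evalLeft]

@[simp] lemma evalRight_tmul (a : A) (f f' : HopfDual k A) :
    evalRight k a (f ⊗ₜ f') = f' a • f := by
  simp [evalRight]

lemma evalLeft_lTensor (π : HopfDual k A →ₗ[k] HopfDual k A) (T : HopfDual k A ⊗[k] HopfDual k A)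
    (a : A) : evalLeft k a (π.lTensor _ T) = π (evalLeft k a T) := by
  induction T with
  | zero => simp
  | tmul f f' => simp
  | add x y hx hy => simp [hx, hy]

lemma evalRight_rTensor (π : HopfDual k A →ₗ[k] HopfDual k A) (T : HopfDual k A ⊗[k] HopfDual k A)
    (a : A) : evalRight k a (π.rTensor _ T) = π (evalRight k a T) := by
  induction T with
  | zero => simp
  | tmul f f' => simp
  | add x y hx hy => simp [hx, hy]

variable [Module.Finite k A]

lemma pair_eq_evalLeft (T : HopfDual k A ⊗[k] HopfDual k A) (a b : A) :
    pair k A T (a ⊗ₜ b) = evalLeft k a T b := by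
  induction T with
  | zero => simp
  | tmul f f' => simp
  | add x y hx hy => simp [hx, hy]

lemma pair_eq_evalRight (T : HopfDual k A ⊗[k] HopfDual k A) (a b : A) :
    pair k A T (a ⊗ₜ b) = evalRight k b T a := by
  induction T with
  | zero => simp
  | tmul f f' => simp [mul_comm]
  | add x y hx hy => simp [hx, hy]

/-- Slices of `Δ f` are translates of `f`; this turns statements about coproducts into statements
about bimodules. -/
lemma evalLeft_comul (a : A) (f : HopfDual k A) :
    evalLeft k a (comul f) = leftTranslate k a f := by
  ext b
  rw [← pair_eq_evalLeft, pair_comul, leftTranslate_apply]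

lemma evalRight_comul (a : A) (f : HopfDual k A) :
    evalRight k a (comul f) = rightTranslate k a f := by
  ext b
  rw [← pair_eq_evalRight, pair_comul, rightTranslate_apply]

/-- The subcoalgebras of `A^*` are its sub-bimodules over `A`. -/
lemma isSubcoalgebra_iff {E : Submodule k (HopfDual k A)} :
    IsSubcoalgebra k E ↔ ∀ f ∈ E, ∀ a, leftTranslate k a f ∈ E ∧ rightTranslate k a f ∈ E := by
  constructor
  · intro hE f hf a
    obtain ⟨T, hT⟩ := hE f hf
    have h₁ : evalLeft k a (TensorProduct.map E.subtype E.subtype T) ∈ E := by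
      induction T generalizing f with
      | zero => simp
      | tmul x y => simpa using E.smul_mem _ y.2
      | add x y hx hy =>
        rw [map_add, map_add]
        refine add_mem ?_ ?_
        · clear hT hx hy
          induction x with
          | zero => simp
          | tmul x y => simpa using E.smul_mem _ y.2
          | add x y hx hy => simpa using add_mem hx hy
        · clear hT hx hy
          induction y with
          | zero => simp
          | tmul x y => simpa using E.smul_mem _ y.2
          | add x y hx hy => simpa using add_mem hx hy
    have h₂ : evalRight k a (TensorProduct.map E.subtype E.subtype T) ∈ E := by
      clear hT h₁
      induction T with
      | zero => simp
      | tmul x y => simpa using E.smul_mem _ x.2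
      | add x y hx hy => simpa using add_mem hx hy
    rw [hT] at h₁ h₂
    rw [evalLeft_comul] at h₁
    rw [evalRight_comul] at h₂
    exact ⟨h₁, h₂⟩
  · intro hE f hf
    -- A linear projection onto `E` fixes all translates of `f`, so applying it to either factor
    -- does not change `Δ f`; applying it to both puts `Δ f` in `E ⊗ E`.
    obtain ⟨π', hπ'⟩ := LinearMap.exists_leftInverse_of_injective E.subtype (by simp)
    have hπ (x : HopfDual k A) (hx : x ∈ E) : (E.subtype ∘ₗ π') x = x :=
      congrArg E.subtype (LinearMap.congr_fun hπ' ⟨x, hx⟩)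
    have hL : (E.subtype ∘ₗ π').lTensor _ (comul f) = comul f := by
      apply ext_pair
      intro a b
      rw [pair_eq_evalLeft, pair_eq_evalLeft, evalLeft_lTensor, evalLeft_comul,
        hπ _ (hE f hf a).1]
    have hR : (E.subtype ∘ₗ π').rTensor _ (comul f) = comul f := by
      apply ext_pair
      intro a b
      rw [pair_eq_evalRight, pair_eq_evalRight, evalRight_rTensor, evalRight_comul,
        hπ _ (hE f hf b).2]
    refine ⟨TensorProduct.map π' π' (comul f), ?_⟩
    rw [← LinearMap.comp_apply, ← TensorProduct.map_comp, ← LinearMap.rTensor_comp_lTensor,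
      LinearMap.comp_apply, hL, hR]

lemma isSubcoalgebra_inf {E F : Submodule k (HopfDual k A)} (hE : IsSubcoalgebra k E)
    (hF : IsSubcoalgebra k F) : IsSubcoalgebra k (E ⊓ F) := by
  rw [isSubcoalgebra_iff] at *
  exact fun f hf a => ⟨⟨(hE f hf.1 a).1, (hF f hf.2 a).1⟩, ⟨(hE f hf.1 a).2, (hF f hf.2 a).2⟩⟩

lemma isGroupLikeElem_iff {f : HopfDual k A} :
    IsGroupLikeElem k f ↔ f 1 = 1 ∧ ∀ a b, f (a * b) = f a * f b := by
  constructor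
  · intro h
    refine ⟨h.counit_eq_one, fun a b => ?_⟩
    rw [← pair_comul, h.comul_eq_tmul_self, pair_tmul]
  · rintro ⟨h₁, h₂⟩
    exact ⟨h₁, ext_pair fun a b => by rw [pair_comul, pair_tmul, h₂]⟩

lemma isSimpleSubcoalgebra_span {f : HopfDual k A} (hf : IsGroupLikeElem k f) :
    IsSimpleSubcoalgebra k (Submodule.span k {f}) := by
  refine ⟨isSubcoalgebra_iff.2 ?_, ?_, ?_⟩
  · obtain ⟨-, hm⟩ := isGroupLikeElem_iff.1 hf
    intro f' hf' a
    obtain ⟨c, rfl⟩ := Submodule.mem_span_singleton.1 hf'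
    refine ⟨Submodule.mem_span_singleton.2 ⟨c * f a, ?_⟩,
      Submodule.mem_span_singleton.2 ⟨c * f a, ?_⟩⟩
    · ext b
      simp [hm, mul_assoc]
    · ext b
      simp only [smul_apply, rightTranslate_apply, hm]
      ring
  · simpa using hf.ne_zero
  · intro F hF _
    rw [or_iff_not_imp_left]
    intro h0
    refine le_antisymm hF ?_
    obtain ⟨x, hx, hx0⟩ := F.ne_bot_iff.1 h0
    obtain ⟨c, rfl⟩ := Submodule.mem_span_singleton.1 (hF hx)
    rw [Submodule.span_singleton_le_iff_mem]
    have hc : c ≠ 0 := by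
      rintro rfl
      simp at hx0
    simpa [smul_smul, hc] using F.smul_mem c⁻¹ hx

end Subcoalgebra

/-! ### Linear forms of a given weight -/

section Weight

variable {H : Type*} [CommGroup H]

variable (k) in
/-- The action of a group of elements of `A` on `A^*` by translation. -/
def translate (p : H →* A) : H →* Module.End k (HopfDual k A) where
  toFun h := leftTranslate k (p h)
  map_one' := by
    ext f a
    simp
  map_mul' h h' := by
    ext f a
    simp only [leftTranslate_apply, Module.End.mul_apply]
    -- Left translation of forms reverses products; it is an action because `H` is commutative.
    rw [mul_comm h h', map_mul p, mul_assoc]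

/-- The linear forms `f` with `f(h a) = ψ(h) f(a)`. -/
abbrev weight (p : H →* A) (ψ : CharGroup k H) : Submodule k (HopfDual k A) :=
  isotypic (translate k p) ψ

lemma mem_weight {p : H →* A} {ψ : CharGroup k H} {f : HopfDual k A} :
    f ∈ weight p ψ ↔ ∀ h a, f (p h * a) = ψ h * f a := by
  rw [mem_isotypic]
  exact forall_congr' fun h => DFunLike.ext_iff

/-- The representation of the coproduct of a group-like element. -/
def groupLikeRepr {a : A} (ha : IsGroupLikeElem k a) : Coalgebra.Repr k a Unit :=
  ⟨{()}, fun _ => a, fun _ => a, by simp [ha.comul_eq_tmul_self]⟩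

/-- As `p h` is group-like, it multiplies both factors of each term of `Δ a`, so the weights
multiply. -/
lemma mul_mem_weight {p : H →* A} (hp : ∀ h, IsGroupLikeElem k (p h)) {ψ ψ' : CharGroup k H}
    {f f' : HopfDual k A} (hf : f ∈ weight p ψ) (hf' : f' ∈ weight p ψ') :
    f * f' ∈ weight p (ψ * ψ') := by
  rw [mem_weight] at *
  intro h a
  rw [mul_apply f f' (ℛ k a), mul_apply f f' ((groupLikeRepr (hp h)).mul (ℛ k a))]
  simp [groupLikeRepr, hf, hf', Finset.mul_sum]
  exact Finset.sum_congr rfl fun _ _ => by ring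

lemma one_mem_weight {p : H →* A} (hp : ∀ h, IsGroupLikeElem k (p h)) :
    (1 : HopfDual k A) ∈ weight p 1 := by
  rw [mem_weight]
  intro h a
  simp [(hp h).counit_eq_one]

/-- The subalgebra of the linear forms `f` with `f(h a) = f(a)`. -/
def invariants (p : H →* A) (hp : ∀ h, IsGroupLikeElem k (p h)) : Subalgebra k (HopfDual k A) where
  __ := weight p 1
  one_mem' := one_mem_weight hp
  mul_mem' hf hf' := by
    have := mul_mem_weight hp hf hf'
    rwa [show (1 : CharGroup k H) * 1 = 1 by ext; simp] at this
  algebraMap_mem' c := by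
    rw [Algebra.algebraMap_eq_smul_one]
    exact Submodule.smul_mem _ c (one_mem_weight hp)

variable [Module.Finite k A]

/-- Right translates keep the weight in any case. Left translates keep it because `p h` is central.
-/
lemma isSubcoalgebra_weight {p : H →* A} (hc : ∀ h a, p h * a = a * p h) (ψ : CharGroup k H) :
    IsSubcoalgebra k (weight p ψ) := by
  rw [isSubcoalgebra_iff]
  intro f hf a
  rw [mem_weight] at hf
  constructor
  · rw [mem_weight]
    intro h b
    rw [leftTranslate_apply, leftTranslate_apply, ← mul_assoc, ← hc, mul_assoc, hf]
  · rw [mem_weight]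
    intro h b
    rw [rightTranslate_apply, rightTranslate_apply, mul_assoc, hf]

lemma antipode_mem_weight {p : H →* A} (hp : ∀ h, IsGroupLikeElem k (p h))
    (hc : ∀ h a, p h * a = a * p h) {ψ : CharGroup k H} {f : HopfDual k A} (hf : f ∈ weight p ψ) :
    HopfAlgebra.antipode k f ∈ weight p ψ⁻¹ := by
  rw [mem_weight] at *
  intro h a
  have hS : HopfAlgebra.antipode k (p h) = p h⁻¹ := by
    refine left_inv_eq_right_inv (hp h).antipode_mul_cancel ?_
    rw [← map_mul]
    simp
  rw [antipode_apply, antipode_apply, HopfAlgebra.antipode_mul_antidistrib, hS, ← hc, hf, map_inv,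
    MonoidHom.inv_apply]

lemma isHopfSubalgebra_invariants {p : H →* A} (hp : ∀ h, IsGroupLikeElem k (p h))
    (hc : ∀ h a, p h * a = a * p h) : IsHopfSubalgebra (invariants p hp) := by
  refine ⟨isSubcoalgebra_weight hc 1, fun f hf => ?_⟩
  have := antipode_mem_weight hp hc (show f ∈ weight p 1 from hf)
  rwa [show (1 : CharGroup k H)⁻¹ = 1 by ext; simp] at this

end Weight

end HopfDual

/-! ### Gaussian binomial coefficients and expansions of ordered products -/

section GaussBinom

variable {k : Type*} [Field k]

/-- The Gaussian binomial coefficients. -/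
def gaussBinom (q : k) : ℕ → ℕ → k
  | _, 0 => 1
  | 0, _ + 1 => 0
  -- The power of `q` arises when a last factor `X` is moved left past `Y^(n - j)`. For `n < j` the
  -- subtraction truncates, but there the coefficient `gaussBinom q n j` is zero.
  | n + 1, j + 1 => q ^ (n - j) * gaussBinom q n j + gaussBinom q n (j + 1)

@[simp] lemma gaussBinom_zero (q : k) (n : ℕ) : gaussBinom q n 0 = 1 := by
  cases n <;> rfl

lemma gaussBinom_succ (q : k) (n j : ℕ) : gaussBinom q (n + 1) (j + 1) =
    q ^ (n - j) * gaussBinom q n j + gaussBinom q n (j + 1) := rfl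

lemma gaussBinom_eq_zero (q : k) {n j : ℕ} (h : n < j) : gaussBinom q n j = 0 := by
  induction n generalizing j with
  | zero =>
    obtain ⟨j, rfl⟩ := Nat.exists_eq_succ_of_ne_zero (by omega : j ≠ 0)
    rfl
  | succ n ih =>
    obtain ⟨j, rfl⟩ := Nat.exists_eq_succ_of_ne_zero (by omega : j ≠ 0)
    rw [Nat.succ_eq_add_one, gaussBinom_succ, ih (by omega), ih (by omega)]
    simp

@[simp] lemma gaussBinom_self (q : k) (n : ℕ) : gaussBinom q n n = 1 := by
  induction n with
  | zero => rfl
  | succ n ih => simp [gaussBinom_succ, ih, gaussBinom_eq_zero q (Nat.lt_succ_self n)]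

lemma gaussBinom_one (q : k) (n : ℕ) : gaussBinom q n 1 = ∑ i ∈ Finset.range n, q ^ i := by
  induction n with
  | zero => rfl
  | succ n ih => rw [gaussBinom_succ, ih, Finset.sum_range_succ]; simp [add_comm]

/-- Times `q - 1`, the quantum integer becomes `q^n - 1`, which is nonzero below the order of `q`.
-/
lemma gaussBinom_one_ne_zero {q : k} {n N : ℕ} (hq : IsPrimitiveRoot q N) (h₁ : 1 ≤ n)
    (h₂ : n < N) : gaussBinom q n 1 ≠ 0 := by
  rw [gaussBinom_one]
  intro h
  have := geom_sum_mul q n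
  rw [h, zero_mul] at this
  exact hq.pow_ne_one_of_pos_of_lt (by omega) h₂ (sub_eq_zero.1 this.symm)

/-- The `q`-binomial theorem. -/
lemma add_pow_of_skew {B : Type*} [Ring B] [Algebra k B] {X Y : B} {q : k}
    (h : Y * X = q • (X * Y)) (n : ℕ) : (X + Y) ^ n =
      ∑ a ∈ Finset.range (n + 1), gaussBinom q n a • (X ^ a * Y ^ (n - a)) := by
  have hY (b : ℕ) : Y ^ b * X = q ^ b • (X * Y ^ b) := by
    induction b with
    | zero => simp
    | succ b ih => rw [pow_succ', mul_assoc, ih, mul_smul_comm, ← mul_assoc, h, smul_mul_assoc,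
        smul_smul, mul_assoc, ← pow_succ]
  induction n with
  | zero => simp
  | succ n ih =>
    rw [pow_succ, ih, mul_add, Finset.sum_range_succ' _ (n + 1)]
    simp only [gaussBinom_succ, add_smul, Finset.sum_add_distrib, add_assoc]
    congr 1
    · rw [Finset.sum_mul]
      refine Finset.sum_congr rfl fun a _ => ?_
      rw [smul_mul_assoc, mul_assoc, hY, mul_smul_comm, ← mul_assoc, ← pow_succ, smul_smul,
        mul_comm, Nat.add_sub_add_right]
    · rw [Finset.sum_range_succ (fun a => gaussBinom q n (a + 1) • _),
        gaussBinom_eq_zero q (Nat.lt_succ_self n), zero_smul, add_zero, Finset.sum_range_succ',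
        add_mul, Finset.sum_mul]
      congr 1
      · refine Finset.sum_congr rfl fun a ha => ?_
        rw [Finset.mem_range] at ha
        rw [smul_mul_assoc, mul_assoc, ← pow_succ, Nat.add_sub_add_right]
        congr 3
        omega
      · simp [pow_succ]

lemma List.prod_ofFn_sum {B : Type*} [Ring B] {t : ℕ} (s : Fin t → Finset ℕ)
    (f : Fin t → ℕ → B) : (List.ofFn fun i => ∑ a ∈ s i, f i a).prod =
      ∑ p ∈ Fintype.piFinset s, (List.ofFn fun i => f i (p i)).prod := by
  induction t with
  | zero => simp
  | succ t ih =>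
    rw [List.ofFn_succ, List.prod_cons, ih, Finset.sum_mul_sum, ← Finset.sum_product']
    refine Finset.sum_nbij' (fun x => Fin.cons x.1 x.2) (fun p => (p 0, Fin.tail p)) ?_ ?_ ?_ ?_ ?_
    · intro x hx
      rw [Finset.mem_product] at hx
      rw [Fintype.mem_piFinset]
      refine Fin.cases hx.1 ?_
      simpa [Fintype.mem_piFinset] using hx.2
    · intro p hp
      rw [Fintype.mem_piFinset] at hp
      rw [Finset.mem_product, Fintype.mem_piFinset]
      exact ⟨hp 0, fun i => hp i.succ⟩
    · intro x _
      simp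
    · intro p _
      simp
    · intro x _
      simp [List.ofFn_succ]

lemma List.prod_ofFn_smul {B : Type*} [Ring B] [Algebra k B] {t : ℕ} (c : Fin t → k)
    (f : Fin t → B) : (List.ofFn fun i => c i • f i).prod = (∏ i, c i) • (List.ofFn f).prod := by
  induction t with
  | zero => simp
  | succ t ih => rw [List.ofFn_succ, List.prod_cons, ih, Fin.prod_univ_succ, List.ofFn_succ,
      List.prod_cons, smul_mul_smul_comm]

lemma List.prod_ofFn_tmul {B : Type*} [Ring B] [Algebra k B] {t : ℕ} (u v : Fin t → B) :
    (List.ofFn fun i => u i ⊗ₜ[k] v i).prod = (List.ofFn u).prod ⊗ₜ (List.ofFn v).prod := by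
  induction t with
  | zero => simp [Algebra.TensorProduct.one_def]
  | succ t ih => simp [List.ofFn_succ, ih]

end GaussBinom

/-! ### The coproduct of an ordered monomial -/

section Lifting

variable {k : Type*} [Field k] {G : Type*} [CommGroup G] {t : ℕ} {g : Fin t → G}
  {χ : Fin t → CharGroup k G} {r : Fin t → ℕ} {α : Matrix (Fin t) (Fin t) k}
  {A : Type*} [Ring A] [HopfAlgebra k A]

/-- The group element `∏ g_i^{n_i}`. -/
def groupMonomial (g : Fin t → G) (n : Fin t → ℕ) : G := ∏ i, g i ^ n i

@[simp] lemma groupMonomial_zero : groupMonomial g 0 = 1 := by simp [groupMonomial]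

@[simp] lemma groupMonomial_single (i : Fin t) : groupMonomial g (Pi.single i 1) = g i := by
  classical
  rw [groupMonomial, Finset.prod_eq_single i]
  · simp
  · intro j _ hj
    simp [hj]
  · simp

lemma monomialOf_zero (x : Fin t → A) : monomialOf x 0 = 1 := by simp [monomialOf]

lemma List.prod_ofFn_eq_single {B : Type*} [Monoid B] (f : Fin t → B) (i : Fin t)
    (h : ∀ j, j ≠ i → f j = 1) : (List.ofFn f).prod = f i := by
  induction t with
  | zero => exact i.elim0
  | succ t ih =>
    rw [List.ofFn_succ, List.prod_cons]
    refine Fin.cases (fun h => ?_) (fun i h => ?_) i h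
    · rw [List.prod_eq_one, mul_one]
      intro b hb
      obtain ⟨j, rfl⟩ := (List.mem_ofFn' _ _).1 hb
      exact h _ (Fin.succ_ne_zero j)
    · rw [h 0 (Fin.succ_ne_zero i).symm, one_mul]
      exact ih _ i fun j hj => h _ (by simpa using hj)

lemma monomialOf_single (x : Fin t → A) (i : Fin t) :
    monomialOf x (Pi.single i 1) = x i := by
  rw [monomialOf, List.prod_ofFn_eq_single _ i]
  · simp
  · intro j hj
    simp [hj]

namespace LiftingWithMatrix

variable (L : LiftingWithMatrix g χ r α A)

lemma x_mul_grp (i : Fin t) (h : G) :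
    L.x i * L.grp h = ((χ i h)⁻¹ : kˣ) • (L.grp h * L.x i) := by
  rw [L.grp_mul_x, ← Units.smul_def, inv_smul_smul]

lemma x_pow_mul_grp (i : Fin t) (n : ℕ) (h : G) :
    L.x i ^ n * L.grp h = ((χ i h)⁻¹ ^ n : kˣ) • (L.grp h * L.x i ^ n) := by
  induction n with
  | zero => simp
  | succ n ih =>
    rw [pow_succ', mul_assoc, ih, mul_smul_comm, ← mul_assoc, L.x_mul_grp, smul_mul_assoc,
      smul_smul, ← pow_succ, mul_assoc]

lemma comul_x_pow (i : Fin t) (n : ℕ) : comul (R := k) (L.x i ^ n) =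
    ∑ a ∈ Finset.range (n + 1), gaussBinom (χ i (g i) : k) n a •
      ((L.x i ^ a * L.grp (g i ^ (n - a))) ⊗ₜ[k] (L.x i ^ (n - a))) := by
  rw [Bialgebra.comul_pow, L.comul_x, add_pow_of_skew (q := (χ i (g i) : k))]
  · refine Finset.sum_congr rfl fun a _ => ?_
    simp
  · simp [L.grp_mul_x, TensorProduct.smul_tmul']

/-- Only the existence of the unit `s` matters, and its value in the two extreme cases, where no
group element passes a power of some `x_i`. These give the outer coefficients of the coproduct. -/
lemma exists_prod_reorder (a : Fin t → ℕ) (c : Fin t → G) (l : List (Fin t)) : ∃ s : kˣ,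
    (a = 0 → s = 1) ∧ (c = 1 → s = 1) ∧
      (l.map fun i => L.x i ^ a i * L.grp (c i)).prod =
        s • (L.grp (l.map c).prod * (l.map fun i => L.x i ^ a i).prod) := by
  induction l with
  | nil => exact ⟨1, by simp⟩
  | cons i l ih =>
    obtain ⟨s, h₁, h₂, h₃⟩ := ih
    -- `x_i^{a_i}` moves past its own group element and past those already collected from the tail.
    refine ⟨s * (χ i (c i * (l.map c).prod))⁻¹ ^ a i, ?_, ?_, ?_⟩
    · intro h
      simp [h₁ h, h]
    · intro h
      rw [h₂ h, h]
      have : (l.map (1 : Fin t → G)).prod = 1 := List.prod_eq_one (by simp)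
      simp [this]
    · simp only [List.map_cons, List.prod_cons]
      rw [h₃, mul_smul_comm, ← mul_assoc, mul_assoc (L.x i ^ a i), ← map_mul, L.x_pow_mul_grp,
        smul_mul_assoc, smul_smul, mul_assoc]

/-- The coefficients are products of Gaussian binomials and reordering units. Later arguments use
only the values at `0` and `m` and the nonvanishing at `e_i`, so the formula stays hidden behind an
existential. -/
lemma exists_comulCoeff : ∃ C : (Fin t → ℕ) → (Fin t → ℕ) → k,
    (∀ m, C m 0 = 1) ∧ (∀ m, C m m = 1) ∧
    (∀ m i, IsPrimitiveRoot (χ i (g i)) (r i) → 1 ≤ m i → m i < r i →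
      C m (Pi.single i 1) ≠ 0) ∧
    ∀ h m, comul (R := k) (L.grp h * monomialOf L.x m) =
      ∑ a ∈ Fintype.piFinset fun i => Finset.range (m i + 1),
        C m a • ((L.grp (h * groupMonomial g (m - a)) * monomialOf L.x a) ⊗ₜ[k]
          (L.grp h * monomialOf L.x (m - a))) := by
  choose s h₁ h₂ h₃ using fun a c => L.exists_prod_reorder a c (List.finRange t)
  refine ⟨fun m a => (∏ i, gaussBinom (χ i (g i) : k) (m i) (a i)) *
    s a (fun i => g i ^ (m i - a i)), ?_, ?_, ?_, ?_⟩
  · intro m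
    simp [h₁]
  · intro m
    have : (fun i => g i ^ (m i - m i)) = 1 := by ext; simp
    simp only [this, h₂]
    simp
  · intro m i hi h1 h2
    refine mul_ne_zero ?_ (Units.ne_zero _)
    rw [Finset.prod_ne_zero_iff]
    intro j _
    by_cases hj : j = i
    · subst hj
      rw [Pi.single_eq_same]
      exact gaussBinom_one_ne_zero (IsPrimitiveRoot.coe_units_iff.2 hi) h1 h2
    · simp [hj]
  · intro h m
    rw [Bialgebra.comul_mul, (L.grp_isGroupLike h).comul_eq_tmul_self]
    have e₁ : comul (R := k) (monomialOf L.x m) =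
        (List.ofFn fun i => comul (R := k) (L.x i ^ m i)).prod := by
      rw [monomialOf, ← Bialgebra.comulAlgHom_apply, map_list_prod, List.map_ofFn]
      rfl
    rw [e₁]
    simp only [L.comul_x_pow]
    rw [List.prod_ofFn_sum, Finset.mul_sum]
    refine Finset.sum_congr rfl fun a _ => ?_
    rw [List.prod_ofFn_smul, List.prod_ofFn_tmul]
    have e₂ : (List.ofFn fun i => L.x i ^ a i * L.grp (g i ^ (m i - a i))).prod =
        s a (fun i => g i ^ (m i - a i)) •
          (L.grp (groupMonomial g (m - a)) * monomialOf L.x a) := by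
      rw [List.ofFn_eq_map, h₃]
      simp only [groupMonomial, monomialOf, ← List.ofFn_eq_map, List.prod_ofFn, Pi.sub_apply]
    rw [e₂, Units.smul_def, mul_smul_comm, Algebra.TensorProduct.tmul_mul_tmul, mul_smul_comm,
      TensorProduct.smul_tmul', TensorProduct.smul_tmul', smul_smul, ← TensorProduct.smul_tmul',
      ← mul_assoc, ← map_mul]
    rfl

/-- The coefficients of the coproducts of the ordered monomials. -/
def comulCoeff (m a : Fin t → ℕ) : k := L.exists_comulCoeff.choose m a

@[simp] lemma comulCoeff_zero (m : Fin t → ℕ) : L.comulCoeff m 0 = 1 :=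
  L.exists_comulCoeff.choose_spec.1 m

@[simp] lemma comulCoeff_self (m : Fin t → ℕ) : L.comulCoeff m m = 1 :=
  L.exists_comulCoeff.choose_spec.2.1 m

lemma comulCoeff_single_ne_zero {m : Fin t → ℕ} {i : Fin t}
    (hi : IsPrimitiveRoot (χ i (g i)) (r i)) (h1 : 1 ≤ m i) (h2 : m i < r i) :
    L.comulCoeff m (Pi.single i 1) ≠ 0 :=
  L.exists_comulCoeff.choose_spec.2.2.1 m i hi h1 h2

/-- The coproduct of `h x^m`. -/
def reprMonomial (h : G) (m : Fin t → ℕ) :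
    Coalgebra.Repr k (L.grp h * monomialOf L.x m) (Fin t → ℕ) where
  index := Fintype.piFinset fun i => Finset.range (m i + 1)
  left a := L.comulCoeff m a • (L.grp (h * groupMonomial g (m - a)) * monomialOf L.x a)
  right a := L.grp h * monomialOf L.x (m - a)
  eq := by
    simp only [← TensorProduct.smul_tmul']
    exact (L.exists_comulCoeff.choose_spec.2.2.2 h m).symm

end LiftingWithMatrix

end Lifting

/-! ### Words in the `x_i` and the spanning monomials -/

section Words

variable {t : ℕ}

/-- The word `1^{m_1} 2^{m_2} ⋯`. -/
def sortedWord (m : Fin t → ℕ) : List (Fin t) :=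
  (List.ofFn fun i => List.replicate (m i) i).flatten

lemma length_sortedWord (m : Fin t → ℕ) : (sortedWord m).length = ∑ i, m i := by
  simp [sortedWord, List.length_flatten, List.map_ofFn, List.sum_ofFn]

lemma count_sortedWord (m : Fin t → ℕ) (i : Fin t) : (sortedWord m).count i = m i := by
  rw [sortedWord, List.count_flatten, List.map_ofFn, List.sum_ofFn, Finset.sum_eq_single i]
  · simp
  · intro j _ hj
    simp [List.count_replicate, hj]
  · simp

lemma prod_sortedWord {B : Type*} [Monoid B] (x : Fin t → B) (m : Fin t → ℕ) :
    ((sortedWord m).map x).prod = monomialOf x m := by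
  rw [sortedWord, List.map_flatten, List.prod_flatten, monomialOf, List.map_ofFn, List.map_ofFn]
  congr 2
  funext i
  simp

end Words

section Lifting

variable {k : Type*} [Field k] {G : Type*} [CommGroup G] {t : ℕ} {g : Fin t → G}
  {χ : Fin t → CharGroup k G} {r : Fin t → ℕ} {α : Matrix (Fin t) (Fin t) k}
  {A : Type*} [Ring A] [HopfAlgebra k A]

namespace LiftingWithMatrix

variable (L : LiftingWithMatrix g χ r α A)

/-- The product of the `x_i` along a word. -/
def word (l : List (Fin t)) : A := (l.map L.x).prod

@[simp] lemma word_nil : L.word [] = 1 := rfl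

@[simp] lemma word_cons (i : Fin t) (l : List (Fin t)) :
    L.word (i :: l) = L.x i * L.word l := by simp [word]

@[simp] lemma word_append (l l' : List (Fin t)) :
    L.word (l ++ l') = L.word l * L.word l' := by simp [word]

lemma word_sortedWord (m : Fin t → ℕ) : L.word (sortedWord m) = monomialOf L.x m :=
  prod_sortedWord L.x m

/-- Exchanging two adjacent letters costs a scalar and an error `α_ij (g_i g_j - 1)` times a shorter
word. The family `F` that absorbs the errors is left open: it is a length filtration for spanning,
and constant for forms invariant under `Γ'`. -/
lemma exists_word_sub_mem_of_perm {F : ℕ → Submodule k A}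
    (h₁ : ∀ n i, ∀ a ∈ F n, L.x i * a ∈ F (n + 1))
    (h₂ : ∀ i j l, i ≠ j →
      α i j • ((L.grp (g i * g j) - 1) * L.word l) ∈ F (l.length + 2))
    {l l' : List (Fin t)} (h : l.Perm l') : ∃ c : k, L.word l - c • L.word l' ∈ F l.length := by
  induction h with
  | nil => exact ⟨1, by simp⟩
  | cons i h ih =>
    obtain ⟨c, hc⟩ := ih
    refine ⟨c, ?_⟩
    have := h₁ _ i _ hc
    rwa [mul_sub, mul_smul_comm, ← word_cons, ← word_cons] at this
  | swap i j l =>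
    by_cases hij : j = i
    · subst hij
      exact ⟨1, by simp⟩
    · refine ⟨χ i (g j), ?_⟩
      have := h₂ j i l hij
      simp only [word_cons, ← mul_assoc, L.x_mul_x j i hij, add_mul, smul_mul_assoc,
        add_sub_cancel_left, List.length_cons]
      exact this
  | trans h h' ih ih' =>
    obtain ⟨c, hc⟩ := ih
    obtain ⟨c', hc'⟩ := ih'
    refine ⟨c * c', ?_⟩
    rw [← h.length_eq] at hc'
    have := add_mem hc (Submodule.smul_mem _ c hc')
    rwa [smul_sub, smul_smul, sub_add_sub_cancel] at this

/-- Modulo the lower terms, a word is zero or a multiple of an ordered monomial of the same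
degree. -/
lemma word_mem_or_exists_monomial {F : ℕ → Submodule k A}
    (h₁ : ∀ n i, ∀ a ∈ F n, L.x i * a ∈ F (n + 1))
    (h₂ : ∀ i j l, i ≠ j →
      α i j • ((L.grp (g i * g j) - 1) * L.word l) ∈ F (l.length + 2))
    (h₃ : ∀ i l, α i i • ((L.grp (g i ^ r i) - 1) * L.word l) ∈ F (l.length + r i))
    (l : List (Fin t)) : L.word l ∈ F l.length ∨ ∃ (m : Fin t → ℕ) (c : k),
      (∀ i, m i < r i) ∧ ∑ i, m i = l.length ∧ L.word l - c • monomialOf L.x m ∈ F l.length := by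
  by_cases hl : ∃ i, r i ≤ l.count i
  · left
    obtain ⟨i, hi⟩ := hl
    -- Move `r_i` copies of the letter `i` to the front, where the power relation replaces them by
    -- an error.
    obtain ⟨l', hl'⟩ := (List.replicate_sublist_iff.2 hi).exists_perm_append
    obtain ⟨c, hc⟩ := L.exists_word_sub_mem_of_perm h₁ h₂ hl'
    have h : L.word (List.replicate (r i) i ++ l') ∈ F l.length := by
      rw [word_append, word, List.map_replicate, List.prod_replicate, L.x_pow, smul_mul_assoc,
        hl'.length_eq, List.length_append, List.length_replicate, add_comm]
      exact h₃ i l'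
    simpa using add_mem hc (Submodule.smul_mem _ c h)
  · right
    push Not at hl
    have hp : l.Perm (sortedWord fun i => l.count i) :=
      List.perm_iff_count.2 fun i => (count_sortedWord (fun j => l.count j) i).symm
    obtain ⟨c, hc⟩ := L.exists_word_sub_mem_of_perm h₁ h₂ hp
    refine ⟨fun i => l.count i, c, hl, ?_, ?_⟩
    · rw [← length_sortedWord, hp.length_eq]
    · rwa [← word_sortedWord]

lemma x_mul_grp_mul (i : Fin t) (h : G) (a : A) :
    L.x i * (L.grp h * a) = ((χ i h)⁻¹ : kˣ) • (L.grp h * (L.x i * a)) := by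
  rw [← mul_assoc, L.x_mul_grp, smul_mul_assoc, mul_assoc]

lemma span_word : Submodule.span k {a | ∃ h l, a = L.grp h * L.word l} = ⊤ := by
  set T := Submodule.span k {a | ∃ h l, a = L.grp h * L.word l} with hT
  have key : ∀ a ∈ Algebra.adjoin k (Set.range L.grp ∪ Set.range L.x), ∀ b ∈ T, a * b ∈ T := by
    intro a ha
    induction ha using Algebra.adjoin_induction with
    | mem a ha =>
      intro b hb
      induction hb using Submodule.span_induction with
      | zero => simp
      | add x y _ _ hx hy => rw [mul_add]; exact add_mem hx hy
      | smul c x _ hx => rw [mul_smul_comm]; exact T.smul_mem c hx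
      | mem b hb =>
        obtain ⟨h, l, rfl⟩ := hb
        rcases ha with ⟨h', rfl⟩ | ⟨i, rfl⟩
        · refine Submodule.subset_span ⟨h' * h, l, ?_⟩
          rw [map_mul, mul_assoc]
        · rw [L.x_mul_grp_mul, Units.smul_def]
          refine T.smul_mem _ (Submodule.subset_span ⟨h, i :: l, ?_⟩)
          rw [word_cons]
    | algebraMap c => intro b hb; rw [← Algebra.smul_def]; exact T.smul_mem c hb
    | add x y _ _ hx hy => intro b hb; rw [add_mul]; exact add_mem (hx b hb) (hy b hb)
    | mul x y _ _ hx hy => intro b hb; rw [mul_assoc]; exact hx _ (hy b hb)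
  rw [eq_top_iff]
  intro a _
  have h1 : (1 : A) ∈ T := Submodule.subset_span ⟨1, [], by simp⟩
  simpa using key a (by rw [L.generate]; trivial) 1 h1

/-- The ordered monomials `h x^m`, `0 ≤ m_i < r_i`, span `A`. -/
lemma span_monomial (hr : ∀ i, 1 < r i) : Submodule.span k {a | ∃ (h : G) (m : Fin t → ℕ),
    (∀ i, m i < r i) ∧ a = L.grp h * monomialOf L.x m} = ⊤ := by
  set S := Submodule.span k {a | ∃ (h : G) (m : Fin t → ℕ),
    (∀ i, m i < r i) ∧ a = L.grp h * monomialOf L.x m} with hS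
  -- The inequality is strict, so that `F l.length` holds only terms shorter than `l`. The group
  -- elements are needed because the error terms contain them.
  let F (n : ℕ) : Submodule k A :=
    Submodule.span k {a | ∃ h l, l.length < n ∧ a = L.grp h * L.word l}
  have hFx (n : ℕ) (i : Fin t) (a : A) (ha : a ∈ F n) : L.x i * a ∈ F (n + 1) := by
    induction ha using Submodule.span_induction with
    | zero => simp
    | add x y _ _ hx hy => rw [mul_add]; exact add_mem hx hy
    | smul c x _ hx => rw [mul_smul_comm]; exact Submodule.smul_mem _ c hx
    | mem b hb =>
      obtain ⟨h, l, hl, rfl⟩ := hb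
      rw [L.x_mul_grp_mul, Units.smul_def]
      refine Submodule.smul_mem _ _ (Submodule.subset_span ⟨h, i :: l, by simpa, ?_⟩)
      rw [word_cons]
  have hF (n : ℕ) (c : k) (h : G) (l : List (Fin t)) (hn : 0 < n) :
      c • ((L.grp h - 1) * L.word l) ∈ F (l.length + n) := by
    refine Submodule.smul_mem _ _ ?_
    rw [sub_mul, one_mul]
    refine sub_mem (Submodule.subset_span ⟨h, l, by omega, rfl⟩)
      (Submodule.subset_span ⟨1, l, by omega, by simp⟩)
  have main (n : ℕ) : F n ≤ S := by
    induction n with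
    | zero =>
      refine Submodule.span_le.2 ?_
      rintro a ⟨h, l, hl, -⟩
      omega
    | succ n ih =>
      refine Submodule.span_le.2 ?_
      rintro a ⟨h, l, hl, rfl⟩
      have hFg (a : A) (ha : a ∈ F l.length) : L.grp h * a ∈ S := by
        induction ha using Submodule.span_induction with
        | zero => simp
        | add x y _ _ hx hy => rw [mul_add]; exact add_mem hx hy
        | smul c x _ hx => rw [mul_smul_comm]; exact Submodule.smul_mem _ c hx
        | mem b hb =>
          obtain ⟨h', l', hl', rfl⟩ := hb
          refine ih (Submodule.subset_span ⟨h * h', l', by omega, ?_⟩)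
          rw [map_mul, mul_assoc]
      rcases L.word_mem_or_exists_monomial hFx (fun i j l _ => hF 2 _ _ l (by omega))
        (fun i l => hF (r i) _ _ l (by have := hr i; omega)) l with h' | ⟨m, c, hm, -, h'⟩
      · exact hFg _ h'
      · have := add_mem (hFg _ h')
          (S.smul_mem c (Submodule.subset_span ⟨h, m, hm, rfl⟩))
        rwa [mul_sub, mul_smul_comm, sub_add_cancel] at this
  rw [eq_top_iff, ← L.span_word]
  refine Submodule.span_le.2 ?_
  rintro a ⟨h, l, rfl⟩
  exact main (l.length + 1) (Submodule.subset_span ⟨h, l, by omega, rfl⟩)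

lemma grp_mul_x_of_eq_one {h : G} (hh : ∀ i, χ i h = 1) (i : Fin t) :
    L.grp h * L.x i = L.x i * L.grp h := by
  rw [L.grp_mul_x, hh]
  simp

/-- The group elements on which all `χ_i` are trivial are central in `A`. -/
lemma grp_mul_comm {h : G} (hh : ∀ i, χ i h = 1) (a : A) : L.grp h * a = a * L.grp h := by
  have ha : a ∈ Algebra.adjoin k (Set.range L.grp ∪ Set.range L.x) := by
    rw [L.generate]
    trivial
  induction ha using Algebra.adjoin_induction with
  | mem a ha =>
    rcases ha with ⟨h', rfl⟩ | ⟨i, rfl⟩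
    · rw [← map_mul, ← map_mul, mul_comm]
    · exact L.grp_mul_x_of_eq_one hh i
  | algebraMap c => exact (Algebra.commutes c _).symm
  | add x y _ _ hx hy => rw [mul_add, add_mul, hx, hy]
  | mul x y _ _ hx hy => rw [← mul_assoc, hx, mul_assoc, hy, mul_assoc]

end LiftingWithMatrix

end Lifting

/-! ### Forms on `B(V) # k[G]` that detect degrees 0 and 1 -/

section NicholsFunctionals

variable {k : Type*} [Field k] {G : Type*} [CommGroup G] {ι : Type*}
  {g : ι → G} {χ : ι → G →* kˣ}

lemma mem_iSup_deg_of_mem_nicholsIdeal {x : TensorSmash k g χ} (hx : x ∈ nicholsIdeal k g χ) :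
    x ∈ ⨆ n ≥ 2, TensorSmash.deg k g χ n := by
  rw [nicholsIdeal, sSup_eq_iSup'] at hx
  exact Submodule.iSup_induction _ (motive := fun x => x ∈ ⨆ n ≥ 2, TensorSmash.deg k g χ n) hx
    (fun J x hx => J.2.2.2 hx) (zero_mem _) fun x y hx hy => add_mem hx hy

/-- An algebra map that kills all products of two `v_i`'s is defined on `B(V) # k[G]`. -/
def NicholsSmash.liftOfMulEqZero {B : Type*} [Ring B] [Algebra k B] (a : G →* B) (b : ι → B)
    (hab : ∀ h i, a h * b i = (χ i h : k) • (b i * a h)) (hb : ∀ i j, b i * b j = 0) :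
    NicholsSmash k g χ →ₐ[k] B :=
  Ideal.Quotient.liftₐ _ (TensorSmash.lift a b hab) fun x hx => by
    have : (⨆ n ≥ 2, TensorSmash.deg k g χ n) ≤
        LinearMap.ker (TensorSmash.lift (g := g) a b hab).toLinearMap := by
      refine iSup₂_le fun n hn => Submodule.span_le.2 ?_
      rintro _ ⟨h, l, hl, rfl⟩
      obtain ⟨i, j, l, rfl⟩ : ∃ i j l', l = i :: j :: l' := by
        match l, hl with
        | i :: j :: l', _ => exact ⟨i, j, l', rfl⟩
        | [_], hl => simp at hl; omega
        | [], hl => simp at hl; omega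
      simp [← mul_assoc (b i), hb]
    exact this (mem_iSup_deg_of_mem_nicholsIdeal hx)

section

variable {B : Type*} [Ring B] [Algebra k B] (a : G →* B) (b : ι → B)
    (hab : ∀ h i, a h * b i = (χ i h : k) • (b i * a h)) (hb : ∀ i j, b i * b j = 0)

lemma NicholsSmash.liftOfMulEqZero_grp (h : G) :
    liftOfMulEqZero (g := g) a b hab hb (grp k g χ h) = a h :=
  TensorSmash.lift_grp a b hab h

lemma NicholsSmash.liftOfMulEqZero_vec (i : ι) :
    liftOfMulEqZero (g := g) a b hab hb (vec k g χ i) = b i :=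
  TensorSmash.lift_vec a b hab i

end

/-- The coefficient of a group element. -/
def groupCoeff (k : Type*) [Field k] {G : Type*} [CommGroup G] (h : G) :
    MonoidAlgebra k G →ₗ[k] k :=
  Finsupp.lapply h ∘ₗ (MonoidAlgebra.coeffLinearEquiv k).toLinearMap

lemma groupCoeff_of [DecidableEq G] (h h' : G) :
    groupCoeff k h (MonoidAlgebra.of k G h') = if h' = h then 1 else 0 := by
  change (MonoidAlgebra.single h' (1 : k)).coeff h = _
  rw [MonoidAlgebra.coeff_single, Finsupp.single_apply]

/-- Sending all `v_i` to zero gives a map to the group algebra, where coefficients can be read off.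
-/
lemma NicholsSmash.exists_functional_grp [DecidableEq G] (h₀ : G) :
    ∃ f : NicholsSmash k g χ →ₗ[k] k, ∀ h, f (grp k g χ h) = if h = h₀ then 1 else 0 := by
  refine ⟨groupCoeff k h₀ ∘ₗ (liftOfMulEqZero (B := MonoidAlgebra k G) (MonoidAlgebra.of k G) 0 (by simp)
    (by simp)).toLinearMap, fun h => ?_⟩
  rw [← groupCoeff_of]
  exact congrArg (groupCoeff k h₀)
    (liftOfMulEqZero_grp (B := MonoidAlgebra k G) (MonoidAlgebra.of k G) 0 (by simp) (by simp) h)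

/-- The diagonal matrices `diag(h, χ(h)⁻¹ h)`. -/
def twistedDiag (χ : G →* kˣ) : G →* Matrix (Fin 2) (Fin 2) (MonoidAlgebra k G) where
  toFun h := Matrix.diagonal ![MonoidAlgebra.of k G h, (χ h⁻¹ : k) • MonoidAlgebra.of k G h]
  map_one' := by
    ext i j
    fin_cases i <;> fin_cases j <;> simp [MonoidAlgebra.one_def]
  map_mul' h h' := by
    rw [Matrix.diagonal_mul_diagonal]
    congr 1
    ext i : 1
    fin_cases i
    · simp
    · change (χ (h * h')⁻¹ : k) • MonoidAlgebra.of k G (h * h') =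
        ((χ h⁻¹ : k) • MonoidAlgebra.of k G h) * ((χ h'⁻¹ : k) • MonoidAlgebra.of k G h')
      rw [smul_mul_smul_comm, ← Units.val_mul, ← map_mul χ, mul_inv, map_mul (MonoidAlgebra.of k G)]

/-- Represent `h` by `diag(h, χ_i(h)⁻¹ h)`, `v_i` by the matrix unit `E_01` and the other `v_j` by
zero. Products of two vectors vanish, so the Nichols ideal is killed, and `h v_i` has upper right
entry `h`. -/
lemma NicholsSmash.exists_functional_vec [DecidableEq ι] (i : ι)
    (ψ : MonoidAlgebra k G →ₗ[k] k) : ∃ f : NicholsSmash k g χ →ₗ[k] k,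
      ∀ h j, f (grp k g χ h * vec k g χ j) = if j = i then ψ (MonoidAlgebra.of k G h) else 0 := by
  have hab : ∀ h j, twistedDiag (χ i) h *
      (if j = i then Matrix.single 0 1 (1 : MonoidAlgebra k G) else 0) =
      (χ j h : k) • ((if j = i then Matrix.single 0 1 (1 : MonoidAlgebra k G) else 0) *
        twistedDiag (χ i) h) := by
    intro h j
    split_ifs with hj
    · subst hj
      ext i' j'
      fin_cases i' <;> fin_cases j' <;>
        simp [twistedDiag, Matrix.diagonal_mul, Matrix.mul_diagonal, Matrix.single]
    · simp
  refine ⟨ψ ∘ₗ (LinearMap.proj 1 ∘ₗ LinearMap.proj 0) ∘ₗ (Matrix.ofLinearEquiv k).symm.toLinearMap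
    ∘ₗ (liftOfMulEqZero (twistedDiag (χ i))
    (fun j => if j = i then Matrix.single 0 1 1 else 0) hab ?_).toLinearMap, fun h j => ?_⟩
  · intro j j'
    split_ifs <;> simp
  · simp only [LinearMap.comp_apply, AlgHom.toLinearMap_apply, map_mul]
    rw [liftOfMulEqZero_grp, liftOfMulEqZero_vec]
    split_ifs
    · simp [twistedDiag]
    · simp

end NicholsFunctionals

/-! ### Linear independence of the ordered monomials -/

section Lifting

variable {k : Type*} [Field k] {G : Type*} [CommGroup G] {t : ℕ} {g : Fin t → G}
  {χ : Fin t → CharGroup k G} {r : Fin t → ℕ} {α : Matrix (Fin t) (Fin t) k}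
  {A : Type*} [Ring A] [HopfAlgebra k A]

namespace LiftingWithMatrix

variable (L : LiftingWithMatrix g χ r α A)

/-- The symbol map transports the form from degree 0 of `B(V) # k[G]` to the coradical of `A`; over
a field it extends to `A`. -/
lemma exists_functional_grp [DecidableEq G] (h₀ : G) :
    ∃ f : A →ₗ[k] k, ∀ h, f (L.grp h) = if h = h₀ then 1 else 0 := by
  obtain ⟨f, hf⟩ := NicholsSmash.exists_functional_grp (g := g) (χ := χ) h₀
  obtain ⟨f', hf'⟩ := LinearMap.exists_extend (f ∘ₗ L.symb 0)
  refine ⟨f', fun h => ?_⟩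
  obtain ⟨hh, e⟩ := L.symb_grp h
  rw [← hf, ← e]
  exact LinearMap.congr_fun hf' ⟨L.grp h, hh⟩

lemma grp_mem_coradFil_one (h : G) : L.grp h ∈ coradFil k A 1 := by
  obtain ⟨hh, -⟩ := L.symb_grp h
  refine Submodule.mem_sup_left ?_
  rw [(L.grp_isGroupLike h).comul_eq_tmul_self]
  exact ⟨L.grp h ⊗ₜ ⟨L.grp h, hh⟩, rfl⟩

/-- The form is pulled back along `symb 1`, whose kernel is the coradical; hence it vanishes on
group elements. -/
lemma exists_functional_vec (i : Fin t) (ψ : MonoidAlgebra k G →ₗ[k] k) :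
    ∃ f : A →ₗ[k] k, (∀ h, f (L.grp h) = 0) ∧
      ∀ h j, f (L.grp h * L.x j) = if j = i then ψ (MonoidAlgebra.of k G h) else 0 := by
  obtain ⟨f, hf⟩ := NicholsSmash.exists_functional_vec (g := g) (χ := χ) i ψ
  obtain ⟨f', hf'⟩ := LinearMap.exists_extend (f ∘ₗ L.symb 1)
  refine ⟨f', fun h => ?_, fun h j => ?_⟩
  · obtain ⟨hh, -⟩ := L.symb_grp h
    have e : L.symb 1 ⟨L.grp h, L.grp_mem_coradFil_one h⟩ = 0 := by
      rw [← LinearMap.mem_ker, L.ker_symb_succ 0]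
      exact hh
    refine (LinearMap.congr_fun hf' ⟨L.grp h, L.grp_mem_coradFil_one h⟩).trans ?_
    rw [LinearMap.comp_apply, e, map_zero]
  · obtain ⟨hh, e⟩ := L.symb_grp h
    obtain ⟨hj, e'⟩ := L.symb_x j
    obtain ⟨hm, em⟩ := L.symb_mul 0 1 ⟨L.grp h, hh⟩ ⟨L.x j, hj⟩
    rw [e, e'] at em
    rw [← hf, ← em]
    exact LinearMap.congr_fun hf' ⟨L.grp h * L.x j, hm⟩

/-- A functional that detects `h₀ x^{m₀}` among the ordered monomials of at most the same
degree. -/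
lemma exists_functional_monomial [DecidableEq G] (hr : ∀ i, IsPrimitiveRoot (χ i (g i)) (r i))
    (n : ℕ) (h₀ : G) (m₀ : Fin t → ℕ) (hm₀ : ∀ i, m₀ i < r i) (hn : ∑ i, m₀ i = n) :
    ∃ f : A →ₗ[k] k, ∀ h m, (∀ i, m i < r i) → ∑ i, m i ≤ n →
      f (L.grp h * monomialOf L.x m) = if h = h₀ ∧ m = m₀ then 1 else 0 := by
  have sum_zero (m : Fin t → ℕ) (h : ∑ i, m i = 0) : m = 0 := by
    funext i
    exact (Finset.sum_eq_zero_iff.1 h) i (Finset.mem_univ i)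
  have sum_one (m : Fin t → ℕ) (h : ∑ i, m i = 1) : ∃ i, m = Pi.single i 1 := by
    obtain ⟨i, hi⟩ : ∃ i, m i ≠ 0 := by
      by_contra! h'
      simp [h'] at h
    refine ⟨i, ?_⟩
    rw [← Finset.add_sum_erase _ _ (Finset.mem_univ i)] at h
    funext j
    by_cases hj : j = i
    · subst hj
      rw [Pi.single_eq_same]
      omega
    · rw [Pi.single_eq_of_ne hj]
      have : ∑ l ∈ Finset.univ.erase i, m l = 0 := by omega
      exact Finset.sum_eq_zero_iff.1 this j (by simp [hj])
  induction n generalizing h₀ m₀ with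
  | zero =>
    obtain ⟨f, hf⟩ := L.exists_functional_grp h₀
    refine ⟨f, fun h m _ hm => ?_⟩
    rw [sum_zero m₀ hn, sum_zero m (by omega), monomialOf_zero, mul_one, hf]
    simp
  | succ n ih =>
    obtain ⟨i, hi⟩ : ∃ i, m₀ i ≠ 0 := by
      by_contra! h'
      simp [h'] at hn
    rcases Nat.eq_zero_or_pos n with rfl | hpos
    · obtain ⟨i, rfl⟩ := sum_one m₀ hn
      obtain ⟨f, hf₁, hf₂⟩ := L.exists_functional_vec i (groupCoeff k h₀)
      refine ⟨f, fun h m _ hm => ?_⟩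
      rcases Nat.le_one_iff_eq_zero_or_eq_one.1 hm with hm | hm
      · rw [sum_zero m hm, monomialOf_zero, mul_one, hf₁, if_neg]
        rintro ⟨-, h'⟩
        simpa using congrFun h' i
      · obtain ⟨j, rfl⟩ := sum_one m hm
        rw [monomialOf_single, hf₂, groupCoeff_of, ← ite_and]
        refine if_congr ?_ rfl rfl
        rw [and_comm]
        refine and_congr_right fun _ => ⟨fun h => by rw [h], fun h => ?_⟩
        by_contra hij
        have := congrFun h j
        simp [hij] at this
    · have e₀ : m₀ - Pi.single i 1 + Pi.single i 1 = m₀ := by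
        funext j
        by_cases hj : j = i
        · subst hj
          simp
          omega
        · simp [hj]
      have hsum (a b : Fin t → ℕ) : ∑ i, (a + b) i = ∑ i, a i + ∑ i, b i :=
        Finset.sum_add_distrib
      have hsingle : ∑ j, (Pi.single i 1 : Fin t → ℕ) j = 1 := by simp
      obtain ⟨f, hf⟩ := ih h₀ (m₀ - Pi.single i 1)
        (fun j => lt_of_le_of_lt (Nat.sub_le _ _) (hm₀ j)) (by
          have := hsum (m₀ - Pi.single i 1) (Pi.single i 1)
          rw [e₀, hsingle] at this
          omega)
      -- The augmentation makes `φ` blind to the group element in the left tensor factor, which is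
      -- shifted by `g^{m-a}`. The element `h` is detected by `f` on the right factor.
      obtain ⟨φ, hφ₁, hφ₂⟩ := L.exists_functional_vec i
        (MonoidAlgebra.lift k k G 1).toLinearMap
      have hC : L.comulCoeff m₀ (Pi.single i 1) ≠ 0 :=
        L.comulCoeff_single_ne_zero (hr i) (by omega) (hm₀ i)
      refine ⟨(L.comulCoeff m₀ (Pi.single i 1))⁻¹ •
        (LinearMap.mul' k k ∘ₗ TensorProduct.map φ f ∘ₗ comul), fun h m hm hmn => ?_⟩
      rw [LinearMap.smul_apply, LinearMap.comp_apply, LinearMap.comp_apply,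
        ← (L.reprMonomial h m).eq, map_sum, map_sum]
      simp only [TensorProduct.map_tmul, LinearMap.mul'_apply]
      have hle (a) (ha : a ∈ (L.reprMonomial h m).index) : m - a + a = m := by
        funext j
        have := Finset.mem_range.1 ((Fintype.mem_piFinset.1 ha) j)
        simp only [Pi.add_apply, Pi.sub_apply]
        omega
      -- `φ` kills `a = 0`, so the right factor has degree at most `n`, where `f` is known. A
      -- nonzero value forces that degree to be `n`; since `m` has degree at most `n + 1`, `a` then
      -- has degree 1, and `φ` singles out `e_i`.
      have hterm (a) (ha : a ∈ (L.reprMonomial h m).index)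
          (h0 : φ ((L.reprMonomial h m).left a) * f ((L.reprMonomial h m).right a) ≠ 0) :
          a = Pi.single i 1 ∧ h = h₀ ∧ m = m₀ := by
        have hs := hsum (m - a) a
        rw [hle a ha] at hs
        have ha0 : ∑ j, a j ≠ 0 := by
          intro ha0
          apply h0
          simp [reprMonomial, sum_zero a ha0, monomialOf_zero, hφ₁, -map_mul]
        have hr' := right_ne_zero_of_mul h0
        have hl' := left_ne_zero_of_mul h0
        rw [show (L.reprMonomial h m).right a = L.grp h * monomialOf L.x (m - a) from rfl,
          hf h (m - a) (fun j => lt_of_le_of_lt (Nat.sub_le _ _) (hm j)) (by omega)] at hr'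
        obtain ⟨h₁, h₂⟩ := (ite_ne_right_iff.1 hr').1
        have hs' := hsum (m₀ - Pi.single i 1) (Pi.single i 1)
        rw [e₀, hsingle, ← h₂] at hs'
        obtain ⟨j, rfl⟩ := sum_one a (by omega)
        have hj : j = i := by
          by_contra hj
          simp [reprMonomial, monomialOf_single, hφ₂, hj, -map_mul] at hl'
        subst hj
        refine ⟨rfl, h₁, ?_⟩
        rw [← hle _ ha, h₂, e₀]
      split_ifs with hif
      · obtain ⟨rfl, rfl⟩ := hif
        rw [Finset.sum_eq_single (Pi.single i 1)]
        · simp only [reprMonomial, monomialOf_single, hφ₂, map_smul]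
          rw [hf h (m - Pi.single i 1) (fun j => lt_of_le_of_lt (Nat.sub_le _ _) (hm j)) (by
            have := hsum (m - Pi.single i 1) (Pi.single i 1)
            rw [e₀, hsingle] at this
            omega)]
          simp [hC]
        · intro a ha ha'
          by_contra h0
          exact ha' (hterm a ha h0).1
        · intro ha
          refine absurd ?_ ha
          refine Fintype.mem_piFinset.2 fun j => Finset.mem_range.2 ?_
          have := congrFun e₀ j
          simp only [Pi.add_apply, Pi.sub_apply] at this
          omega
      · rw [Finset.sum_eq_zero, smul_zero]
        intro a ha
        by_contra h0
        exact hif (hterm a ha h0).2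

/-- In a relation, a term of maximal degree is isolated by its detecting form, which vanishes on all
the other terms that occur. -/
lemma linearIndependent_monomial (hr : ∀ i, IsPrimitiveRoot (χ i (g i)) (r i)) :
    LinearIndependent k fun p : G × (∀ i, Fin (r i)) =>
      L.grp p.1 * monomialOf L.x (fun i => (p.2 i : ℕ)) := by
  classical
  rw [linearIndependent_iff']
  intro s c hc
  by_contra! hne
  obtain ⟨p₁, hp₁, hp₁'⟩ := hne
  obtain ⟨p₀, hp₀, hmax⟩ := (s.filter fun p => c p ≠ 0).exists_max_image
    (fun p => ∑ i, (p.2 i : ℕ)) ⟨p₁, by simp [hp₁, hp₁']⟩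
  rw [Finset.mem_filter] at hp₀
  obtain ⟨f, hf⟩ := L.exists_functional_monomial hr _ p₀.1 (fun i => (p₀.2 i : ℕ))
    (fun i => (p₀.2 i).2) rfl
  have := congrArg f hc
  rw [map_sum, map_zero, Finset.sum_eq_single p₀] at this
  · rw [map_smul, hf _ _ (fun i => (p₀.2 i).2) le_rfl] at this
    simp at this
    exact hp₀.2 this
  · intro p hp hpp
    rw [map_smul]
    by_cases hcp : c p = 0
    · rw [hcp, zero_smul]
    · rw [hf _ _ (fun i => (p.2 i).2) (hmax p (by simp [hp, hcp])), if_neg, smul_zero]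
      rintro ⟨h₁, h₂⟩
      exact hpp (Prod.ext h₁ (funext fun i => Fin.ext (congrFun h₂ i)))
  · intro h
    exact absurd hp₀.1 h

/-- The basis of `A` of the elements `h x^m` with `0 ≤ m_i < r_i`. -/
def basis (hr : ∀ i, 1 < r i ∧ IsPrimitiveRoot (χ i (g i)) (r i)) :
    Module.Basis (G × (∀ i, Fin (r i))) k A :=
  Module.Basis.mk (L.linearIndependent_monomial fun i => (hr i).2) (by
    rw [← L.span_monomial fun i => (hr i).1]
    refine Submodule.span_mono ?_
    rintro _ ⟨h, m, hm, rfl⟩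
    exact ⟨(h, fun i => ⟨m i, hm i⟩), rfl⟩)

lemma basis_apply (hr : ∀ i, 1 < r i ∧ IsPrimitiveRoot (χ i (g i)) (r i)) (h : G)
    (m : ∀ i, Fin (r i)) :
    L.basis hr (h, m) = L.grp h * monomialOf L.x (fun i => (m i : ℕ)) := by
  simp [basis]

end LiftingWithMatrix

end Lifting

/-! ### The forms `w(γ, x^n)` and their products -/

section Lifting

variable {k : Type*} [Field k] {G : Type*} [CommGroup G] {t : ℕ} {g : Fin t → G}
  {χ : Fin t → CharGroup k G} {r : Fin t → ℕ} {α : Matrix (Fin t) (Fin t) k}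
  {A : Type*} [Ring A] [HopfAlgebra k A]

/-- A scalar equation `α (γ(h) - 1) = 0` is empty if `α = 0` and says `γ(h) = 1` otherwise, so it
suffices to compare on the generators of `Γ'`. -/
lemma mem_Omega_iff {γ : CharGroup k G} :
    γ ∈ Omega g r α ↔ ∀ x ∈ GammaPrime g r α, γ x = 1 := by
  have aux (c : k) (u : kˣ) : c * ((u : k) - 1) = 0 ↔ (c ≠ 0 → u = 1) := by
    rw [mul_eq_zero, sub_eq_zero, Units.val_eq_one, or_iff_not_imp_left]
  have h : GammaPrime g r α ≤ γ.ker ↔ γ ∈ Omega g r α := by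
    rw [GammaPrime, Subgroup.closure_le, Set.union_subset_iff]
    refine and_congr ⟨fun h i => (aux _ _).2 fun hi => h ⟨i, hi, rfl⟩, ?_⟩
      ⟨fun h i j hij => (aux _ _).2 fun hi => h ⟨i, j, hij, hi, rfl⟩, ?_⟩
    · rintro h _ ⟨i, hi, rfl⟩
      exact (aux _ _).1 (h i) hi
    · rintro h _ ⟨i, j, hij, hi, rfl⟩
      exact (aux _ _).1 (h i j hij) hi
  exact h.symm

/-- For an index `l` outside the relation, the quantum linear space condition turns `χ_l(g_i)` into
`χ_i(g_l)⁻¹`, and `χ_i^{r_i} = 1` or `χ_i χ_j = 1` applies. For `l = i` in a linking relation, `χ_i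
= χ_j` gives `χ_i(g_i g_j) = χ_j(g_i) χ_i(g_j) = 1`; this is the role of the assumption on the
linked characters. -/
lemma IsLiftingMatrix.theta_le_omega (hα : IsLiftingMatrix g χ r α)
    (hV : IsQuantumLinearSpace g χ) (hr : ∀ i, IsPrimitiveRoot (χ i (g i)) (r i))
    (hαχ : ∀ i j, i ≠ j → α i j ≠ 0 → χ i = χ j) : Theta χ ≤ Omega g r α := by
  rw [Theta, Subgroup.closure_le]
  rintro _ ⟨l, rfl⟩
  constructor
  · intro i
    rw [mul_eq_zero, or_iff_not_imp_left]
    intro hi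
    rw [sub_eq_zero, Units.val_eq_one, map_pow]
    by_cases hl : l = i
    · subst hl
      exact (hr l).pow_eq_one
    · have h₁ : χ i ^ r i = 1 := by
        by_contra h
        exact hi (hα.diag_eq_zero i (Or.inr h))
      rw [eq_inv_of_mul_eq_one_left (hV l i hl), inv_pow, ← MonoidHom.pow_apply, h₁]
      simp
  · intro i j hij
    rw [mul_eq_zero, or_iff_not_imp_left]
    intro hi
    rw [sub_eq_zero, Units.val_eq_one, map_mul]
    have hχ := hαχ i j hij hi
    by_cases hli : l = i
    · subst hli
      nth_rw 1 [hχ]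
      rw [mul_comm]
      exact hV l j hij
    by_cases hlj : l = j
    · subst hlj
      nth_rw 2 [← hχ]
      rw [mul_comm]
      exact hV i l hij
    · have h₁ : χ i * χ j = 1 := by
        by_contra h
        exact hi (hα.eq_zero i j hij (Or.inr h))
      rw [eq_inv_of_mul_eq_one_left (hV l i hli), eq_inv_of_mul_eq_one_left (hV l j hlj),
        ← mul_inv, ← MonoidHom.mul_apply, h₁]
      simp

namespace LiftingWithMatrix

variable (L : LiftingWithMatrix g χ r α A)

lemma counit_x (i : Fin t) : counit (R := k) (L.x i) = 0 := by
  have h := Coalgebra.rTensor_counit_comul (R := k) (L.x i)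
  rw [L.comul_x, map_add, LinearMap.rTensor_tmul, LinearMap.rTensor_tmul,
    (L.grp_isGroupLike _).counit_eq_one, add_eq_right] at h
  have := congrArg (fun z => counit (R := k) (TensorProduct.lid k A z)) h
  simpa using this

lemma counit_monomial [DecidableEq (Fin t → ℕ)] (h : G) (m : Fin t → ℕ) :
    counit (R := k) (L.grp h * monomialOf L.x m) = if m = 0 then 1 else 0 := by
  rw [Bialgebra.counit_mul, (L.grp_isGroupLike h).counit_eq_one, one_mul, monomialOf,
    ← Bialgebra.counitAlgHom_apply, map_list_prod, List.map_ofFn, List.prod_ofFn]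
  simp only [Function.comp_apply, map_pow, Bialgebra.counitAlgHom_apply, L.counit_x]
  split_ifs with h
  · simp [h]
  · obtain ⟨i, hi⟩ := Function.ne_iff.1 h
    exact Finset.prod_eq_zero (Finset.mem_univ i) (zero_pow hi)

variable (hr : ∀ i, 1 < r i ∧ IsPrimitiveRoot (χ i (g i)) (r i))

/-- The element `w(γ, x^n)` of `A^*`. -/
abbrev dual (γ : CharGroup k G) (n : Fin t → ℕ) : HopfDual k A := dualElt (L.basis hr) γ n

lemma dual_apply (γ : CharGroup k G) (n : Fin t → ℕ) (h : G) {m : Fin t → ℕ}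
    (hm : ∀ i, m i < r i) :
    L.dual hr γ n (L.grp h * monomialOf L.x m) = if m = n then (γ h : k) else 0 := by
  have := L.basis_apply hr h (fun i => ⟨m i, hm i⟩)
  rw [← this, dual, dualElt, HopfDual.toDual_symm_apply, Module.Basis.constr_basis]

lemma ext_monomial
    (hr : ∀ i, 1 < r i ∧ IsPrimitiveRoot (χ i (g i)) (r i))
    {f f' : HopfDual k A} (h : ∀ (h : G) (m : Fin t → ℕ), (∀ i, m i < r i) →
    f (L.grp h * monomialOf L.x m) = f' (L.grp h * monomialOf L.x m)) : f = f' := by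
  apply (HopfDual.toDual k A).injective
  refine (L.basis hr).ext fun p => ?_
  rw [show p = (p.1, p.2) from rfl, L.basis_apply]
  exact h p.1 _ fun i => (p.2 i).2

lemma mul_monomial (f f' : HopfDual k A) (h : G) (m : Fin t → ℕ) :
    (f * f') (L.grp h * monomialOf L.x m) =
      ∑ a ∈ Fintype.piFinset fun i => Finset.range (m i + 1),
        L.comulCoeff m a * f (L.grp (h * groupMonomial g (m - a)) * monomialOf L.x a) *
          f' (L.grp h * monomialOf L.x (m - a)) := by
  rw [HopfDual.mul_apply f f' (L.reprMonomial h m)]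
  refine Finset.sum_congr rfl fun a _ => ?_
  simp only [reprMonomial]
  rw [map_smul, smul_eq_mul]

lemma sub_add_of_mem {m a : Fin t → ℕ}
    (ha : a ∈ Fintype.piFinset fun i => Finset.range (m i + 1)) : m - a + a = m := by
  funext j
  have := Finset.mem_range.1 ((Fintype.mem_piFinset.1 ha) j)
  simp only [Pi.add_apply, Pi.sub_apply]
  omega

lemma add_mem_index (n a : Fin t → ℕ) :
    a ∈ Fintype.piFinset fun i => Finset.range ((n + a) i + 1) :=
  Fintype.mem_piFinset.2 fun i => Finset.mem_range.2 (by simp only [Pi.add_apply]; omega)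

lemma dual_one_zero : L.dual hr 1 0 = 1 := by
  refine L.ext_monomial hr fun h m hm => ?_
  rw [L.dual_apply hr _ _ _ hm, HopfDual.one_apply, L.counit_monomial]
  simp

/-- The product of the elements `w(γ, x^n)`. -/
lemma dual_mul_dual (γ γ' : CharGroup k G) (a n : Fin t → ℕ) :
    L.dual hr γ a * L.dual hr γ' n =
      (L.comulCoeff (n + a) a * γ (groupMonomial g n)) • L.dual hr (γ * γ') (n + a) := by
  -- If some exponent of `n + a` reaches `r_i`, no basis monomial matches and both sides are zero.
  refine L.ext_monomial hr fun h m hm => ?_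
  rw [L.mul_monomial, HopfDual.smul_apply, L.dual_apply hr _ _ _ hm]
  have hlt (b : Fin t → ℕ) (hb : b ∈ Fintype.piFinset fun i => Finset.range (m i + 1)) :
      (∀ i, b i < r i) ∧ ∀ i, (m - b) i < r i := by
    refine ⟨fun i => ?_, fun i => lt_of_le_of_lt (Nat.sub_le _ _) (hm i)⟩
    exact lt_of_le_of_lt (Nat.lt_succ_iff.1
      (Finset.mem_range.1 ((Fintype.mem_piFinset.1 hb) i))) (hm i)
  have hterm (b : Fin t → ℕ) (hb : b ∈ Fintype.piFinset fun i => Finset.range (m i + 1)) :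
      L.comulCoeff m b * L.dual hr γ a (L.grp (h * groupMonomial g (m - b)) * monomialOf L.x b) *
          L.dual hr γ' n (L.grp h * monomialOf L.x (m - b)) =
        if b = a ∧ m = n + a then
          L.comulCoeff (n + a) a * γ (groupMonomial g n) * (γ * γ') h else 0 := by
    rw [L.dual_apply hr _ _ _ (hlt b hb).1, L.dual_apply hr _ _ _ (hlt b hb).2]
    by_cases hba : b = a
    · subst hba
      by_cases hmn : m = n + b
      · subst hmn
        simp
        ring
      · have : m - b ≠ n := fun h' => hmn (by rw [← h', sub_add_of_mem hb])
        simp [this, hmn]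
    · simp [hba]
  rw [Finset.sum_congr rfl hterm]
  by_cases hmn : m = n + a
  · rw [Finset.sum_eq_single a]
    · simp [hmn]
    · intro b _ hb
      simp [hb]
    · intro h'
      exact absurd (hmn ▸ add_mem_index n a) h'
  · simp [hmn]

lemma dual_zero_mul_dual (γ γ' : CharGroup k G) (n : Fin t → ℕ) :
    L.dual hr γ 0 * L.dual hr γ' n = (γ (groupMonomial g n) : k) • L.dual hr (γ * γ') n := by
  simp [L.dual_mul_dual]

lemma dual_mul_dual_zero (γ γ' : CharGroup k G) (n : Fin t → ℕ) :
    L.dual hr γ n * L.dual hr γ' 0 = L.dual hr (γ * γ') n := by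
  simp [L.dual_mul_dual]

/-- The map `γ ↦ w(γ, 1)`. -/
def dualGrp : CharGroup k G →* HopfDual k A where
  toFun γ := L.dual hr γ 0
  map_one' := L.dual_one_zero hr
  map_mul' γ γ' := (L.dual_mul_dual_zero hr γ γ' 0).symm

/-- The element `w_i = w(χ_i, x_i)`. -/
abbrev dualVec (i : Fin t) : HopfDual k A := L.dual hr (χ i) (Pi.single i 1)

/-- The defining relation of `T(W) # k[Λ]`; it holds for every `γ`, in `Ω` or not. -/
lemma dual_zero_mul_dualVec (γ : CharGroup k G) (i : Fin t) :
    L.dual hr γ 0 * L.dualVec hr i = (γ (g i) : k) • (L.dualVec hr i * L.dual hr γ 0) := by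
  rw [L.dual_zero_mul_dual, L.dual_mul_dual_zero, groupMonomial_single,
    show γ * χ i = χ i * γ by ext; simp [mul_comm]]

lemma dual_mem_weight (γ : CharGroup k G) (n : Fin t → ℕ) :
    L.dual hr γ n ∈ HopfDual.weight L.grp γ := by
  refine fun h => L.ext_monomial hr fun h' m hm => ?_
  change L.dual hr γ n (L.grp h * (L.grp h' * monomialOf L.x m)) = _
  rw [← mul_assoc, ← map_mul, L.dual_apply hr _ _ _ hm, HopfDual.smul_apply,
    L.dual_apply hr _ _ _ hm, map_mul, Units.val_mul, mul_ite, mul_zero]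

lemma ext_of_mem_weight
    (hr : ∀ i, 1 < r i ∧ IsPrimitiveRoot (χ i (g i)) (r i))
    {γ : CharGroup k G} {f f' : HopfDual k A}
    (hf : f ∈ HopfDual.weight L.grp γ) (hf' : f' ∈ HopfDual.weight L.grp γ)
    (h : ∀ m : Fin t → ℕ, (∀ i, m i < r i) → f (monomialOf L.x m) = f' (monomialOf L.x m)) :
    f = f' := by
  rw [HopfDual.mem_weight] at hf hf'
  refine L.ext_monomial hr fun h' m hm => ?_
  rw [hf, hf', h m hm]

lemma mem_span_dual_of_mem_weight {γ : CharGroup k G} {f : HopfDual k A}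
    (hf : f ∈ HopfDual.weight L.grp γ) :
    f ∈ Submodule.span k {f' | ∃ m : Fin t → ℕ, (∀ i, m i < r i) ∧ f' = L.dual hr γ m} := by
  have : f = ∑ m : ∀ i, Fin (r i), f (monomialOf L.x fun i => (m i : ℕ)) •
      L.dual hr γ fun i => (m i : ℕ) := by
    refine L.ext_of_mem_weight hr hf (Submodule.sum_mem _ fun m _ =>
      Submodule.smul_mem _ _ (L.dual_mem_weight hr γ _)) fun m hm => ?_
    have happ (n : Fin t → ℕ) : L.dual hr γ n (monomialOf L.x m) = if m = n then 1 else 0 := by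
      have := L.dual_apply hr γ n 1 hm
      simpa using this
    rw [HopfDual.sum_apply, Finset.sum_eq_single fun i => ⟨m i, hm i⟩]
    · simp [happ]
    · intro n _ hn
      rw [HopfDual.smul_apply, happ, if_neg, mul_zero]
      rintro rfl
      exact hn rfl
    · simp
  rw [this]
  exact Submodule.sum_mem _ fun m _ => Submodule.smul_mem _ _
    (Submodule.subset_span ⟨_, fun i => (m i).2, rfl⟩)

/-- The weight fixes `f` on the group, and every nontrivial monomial ends in some `x_i`, so `f(1)`
determines `f`. -/
lemma eq_smul_dual_zero
    (hr : ∀ i, 1 < r i ∧ IsPrimitiveRoot (χ i (g i)) (r i))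
    {γ : CharGroup k G} {f : HopfDual k A}
    (hf : f ∈ HopfDual.weight L.grp γ) (hx : ∀ a i, f (a * L.x i) = 0) :
    f = f 1 • L.dual hr γ 0 := by
  refine L.ext_of_mem_weight hr hf
    (Submodule.smul_mem _ _ (L.dual_mem_weight hr γ _)) fun m hm => ?_
  have happ : L.dual hr γ 0 (monomialOf L.x m) = if m = 0 then 1 else 0 := by
    have := L.dual_apply hr γ 0 1 hm
    simpa using this
  rw [HopfDual.smul_apply, happ]
  split_ifs with h
  · rw [h, monomialOf_zero, mul_one]
  · rw [mul_zero, ← word_sortedWord]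
    have hne : sortedWord m ≠ [] := by
      intro h'
      apply h
      funext i
      rw [← count_sortedWord m i, h']
      rfl
    rw [← List.dropLast_append_getLast hne, word_append, word_cons, word_nil, mul_one]
    exact hx _ _

/-- The linear forms that vanish on the monomials of degree different from `n`. -/
def homogeneous (n : ℕ) : Submodule k (HopfDual k A) where
  carrier := {f | ∀ (h : G) (m : Fin t → ℕ), (∀ i, m i < r i) → ∑ i, m i ≠ n →
    f (L.grp h * monomialOf L.x m) = 0}
  add_mem' hf hf' h m hm hn := by simp [hf h m hm hn, hf' h m hm hn]
  zero_mem' := by simp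
  smul_mem' c f hf h m hm hn := by simp [hf h m hm hn]

lemma dual_mem_homogeneous (γ : CharGroup k G) (m : Fin t → ℕ) :
    L.dual hr γ m ∈ L.homogeneous (∑ i, m i) := by
  intro h m' hm' hne
  rw [L.dual_apply hr _ _ _ hm', if_neg]
  rintro rfl
  exact hne rfl

/-- The coproduct of an ordered monomial preserves total degree even though the product of `A` does
not, so convolution is graded. -/
lemma mul_mem_homogeneous {p q : ℕ} {f f' : HopfDual k A} (hf : f ∈ L.homogeneous p)
    (hf' : f' ∈ L.homogeneous q) : f * f' ∈ L.homogeneous (p + q) := by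
  intro h m hm hne
  rw [L.mul_monomial]
  refine Finset.sum_eq_zero fun a ha => ?_
  have hs : ∑ i, (m - a) i + ∑ i, a i = ∑ i, m i := by
    rw [← Finset.sum_add_distrib]
    exact congrArg (fun n : Fin t → ℕ => ∑ i, n i) (sub_add_of_mem ha)
  by_cases hp : ∑ i, a i = p
  · rw [hf' h (m - a) (fun i => lt_of_le_of_lt (Nat.sub_le _ _) (hm i)) (by omega), mul_zero]
  · rw [hf _ a (fun i => lt_of_le_of_lt (Nat.lt_succ_iff.1
      (Finset.mem_range.1 ((Fintype.mem_piFinset.1 ha) i))) (hm i)) hp, mul_zero, zero_mul]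

/-- The group `Γ'` inside `A`. -/
abbrev grpPrime : GammaPrime g r α →* A := L.grp.comp (GammaPrime g r α).subtype

lemma mem_weight_grpPrime {ψ : CharGroup k (GammaPrime g r α)} {f : HopfDual k A} :
    f ∈ HopfDual.weight L.grpPrime ψ ↔
      ∀ (h) (hh : h ∈ GammaPrime g r α) (a), f (L.grp h * a) = ψ ⟨h, hh⟩ * f a := by
  rw [HopfDual.mem_weight]
  exact ⟨fun H h hh => H ⟨h, hh⟩, fun H h => H h.1 h.2⟩

lemma mem_weight_grpPrime_one {f : HopfDual k A} :
    f ∈ HopfDual.weight L.grpPrime 1 ↔ ∀ h ∈ GammaPrime g r α, ∀ a, f (L.grp h * a) = f a := by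
  rw [L.mem_weight_grpPrime]
  simp

lemma dual_mem_weight_grpPrime {γ : CharGroup k G} (hγ : γ ∈ Omega g r α) (n : Fin t → ℕ) :
    L.dual hr γ n ∈ HopfDual.weight L.grpPrime 1 := by
  rw [L.mem_weight_grpPrime_one]
  intro h hh a
  rw [HopfDual.mem_weight.1 (L.dual_mem_weight hr γ n), mem_Omega_iff.1 hγ h hh]
  simp


end LiftingWithMatrix

end Lifting

/-! ### Group-likes and skew primitives of the dual -/

section Lifting

variable {k : Type*} [Field k] {G : Type*} [CommGroup G] {t : ℕ} {g : Fin t → G}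
  {χ : Fin t → CharGroup k G} {r : Fin t → ℕ} {α : Matrix (Fin t) (Fin t) k}
  {A : Type*} [Ring A] [HopfAlgebra k A]

lemma eq_one_of_mem_gammaPrime (hΘ : Theta χ ≤ Omega g r α) {h : G}
    (hh : h ∈ GammaPrime g r α) (i : Fin t) : χ i h = 1 :=
  mem_Omega_iff.1 (hΘ (Subgroup.subset_closure ⟨i, rfl⟩)) h hh

namespace LiftingWithMatrix

variable (L : LiftingWithMatrix g χ r α A)

lemma grpPrime_mul_comm (hΘ : Theta χ ≤ Omega g r α) (h : GammaPrime g r α) (a : A) :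
    L.grpPrime h * a = a * L.grpPrime h :=
  L.grp_mul_comm (eq_one_of_mem_gammaPrime hΘ h.2) a

lemma adjoin_induction' {P : A → Prop} (hg : ∀ h, P (L.grp h)) (hx : ∀ i, P (L.x i))
    (hs : ∀ c, P (algebraMap k A c)) (hadd : ∀ a b, P a → P b → P (a + b))
    (hmul : ∀ a b, P a → P b → P (a * b)) (a : A) : P a := by
  have ha : a ∈ Algebra.adjoin k (Set.range L.grp ∪ Set.range L.x) := by
    rw [L.generate]
    trivial
  induction ha using Algebra.adjoin_induction with
  | mem a ha =>
    rcases ha with ⟨h, rfl⟩ | ⟨i, rfl⟩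
    · exact hg h
    · exact hx i
  | algebraMap c => exact hs c
  | add x y _ _ hx hy => exact hadd _ _ hx hy
  | mul x y _ _ hx hy => exact hmul _ _ hx hy

section

variable (hr : ∀ i, 1 < r i ∧ IsPrimitiveRoot (χ i (g i)) (r i))

lemma dual_zero_apply_one (γ : CharGroup k G) : L.dual hr γ 0 1 = 1 := by
  have := L.dual_apply hr γ 0 1 (m := 0) fun i => (Nat.zero_lt_one.trans (hr i).1)
  simpa [monomialOf_zero] using this

lemma dualVec_apply_grp_mul_x (i j : Fin t) (h : G) :
    L.dualVec hr i (L.grp h * L.x j) = if j = i then (χ i h : k) else 0 := by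
  rw [← monomialOf_single L.x j, L.dual_apply hr]
  · refine if_congr ⟨fun h' => ?_, fun h' => by rw [h']⟩ rfl rfl
    by_contra hij
    have := congrFun h' j
    simp [hij] at this
  · intro l
    by_cases hl : l = j
    · subst hl
      simpa using (hr l).1
    · simpa [hl] using Nat.zero_lt_one.trans (hr l).1

lemma dualVec_apply_grp (i : Fin t) (h : G) : L.dualVec hr i (L.grp h) = 0 := by
  have := L.dual_apply hr (χ i) (Pi.single i 1) h (m := 0)
    fun i => (Nat.zero_lt_one.trans (hr i).1)
  rw [monomialOf_zero, mul_one] at this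
  rw [this, if_neg]
  intro h'
  simpa using congrFun h' i

end

variable [Module.Finite k A]

/-- A linear form that is invariant under `Γ'` and vanishes on the ordered monomials of degree `n`
vanishes on all words of length `n`. -/
lemma apply_grp_mul_word_eq_zero (hΘ : Theta χ ≤ Omega g r α)
    {f : HopfDual k A} (hf : f ∈ HopfDual.weight L.grpPrime 1) {n : ℕ}
    (hn : ∀ (h : G) (m : Fin t → ℕ), (∀ i, m i < r i) → ∑ i, m i = n →
      f (L.grp h * monomialOf L.x m) = 0) (h : G) {l : List (Fin t)} (hl : l.length = n) :
    f (L.grp h * L.word l) = 0 := by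
  have hsub := HopfDual.isSubcoalgebra_iff.1
    (HopfDual.isSubcoalgebra_weight (k := k) (L.grpPrime_mul_comm hΘ) 1)
  -- The common kernel of the forms invariant under `Γ'`. It contains all `(h - 1) a` with `h ∈ Γ'`,
  -- and it is stable under left multiplication because the invariants are a subcoalgebra.
  let F : Submodule k A :=
    ⨅ f : HopfDual.weight L.grpPrime 1, LinearMap.ker (HopfDual.toDual k A f.1)
  have hF (a : A) : a ∈ F ↔ ∀ f ∈ HopfDual.weight (k := k) L.grpPrime 1, f a = 0 := by
    simp [F, Submodule.mem_iInf, LinearMap.mem_ker]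
  have hF' (c : k) {h : G} (hh : c ≠ 0 → h ∈ GammaPrime g r α) (a : A) :
      c • ((L.grp h - 1) * a) ∈ F := by
    by_cases hc : c = 0
    · simp [hc]
    · refine F.smul_mem _ ((hF _).2 fun f hf => ?_)
      rw [sub_mul, one_mul, map_sub, L.mem_weight_grpPrime_one.1 hf h (hh hc), sub_self]
  -- With a constant family `F` every error term is invisible to invariant forms, so the reduction
  -- of words preserves the degree.
  have key := L.word_mem_or_exists_monomial (F := fun _ => F)
    (fun _ i a ha => (hF _).2 fun f hf => (hF a).1 ha _ (hsub f hf (L.x i)).1)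
    (fun i j l hij => hF' _ (fun hc => Subgroup.subset_closure (Or.inr ⟨i, j, hij, hc, rfl⟩)) _)
    (fun i l => hF' _ (fun hc => Subgroup.subset_closure (Or.inl ⟨i, hc, rfl⟩)) _) l
  have hfh := (hsub f hf (L.grp h)).1
  rcases key with h' | ⟨m, c, hm, hs, h'⟩
  · exact (hF _).1 h' _ hfh
  · have := (hF _).1 h' _ hfh
    rw [map_sub, sub_eq_zero, map_smul] at this
    refine this.trans ?_
    rw [HopfDual.leftTranslate_apply, hn h m hm (hs.trans hl), smul_zero]

/-- Up to a unit the argument is `h` times a word of length `∑ m_i + 1`, and `f` lives in another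
degree. -/
lemma apply_x_mul_monomial_eq_zero (hΘ : Theta χ ≤ Omega g r α)
    {f : HopfDual k A} (hf : f ∈ HopfDual.weight L.grpPrime 1) {n : ℕ}
    (hn : f ∈ L.homogeneous n) (j : Fin t) (h : G) (m : Fin t → ℕ) (hm : ∑ i, m i + 1 ≠ n) :
    f (L.x j * (L.grp h * monomialOf L.x m)) = 0 := by
  rw [L.x_mul_grp_mul, ← word_sortedWord, ← word_cons, Units.smul_def, map_smul,
    L.apply_grp_mul_word_eq_zero hΘ hf (n := ∑ i, m i + 1), smul_zero]
  · intro h m' hm' hs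
    exact hn h m' hm' (by omega)
  · rw [List.length_cons, length_sortedWord]

variable (hr : ∀ i, 1 < r i ∧ IsPrimitiveRoot (χ i (g i)) (r i))

lemma dual_zero_apply_x_mul (hΘ : Theta χ ≤ Omega g r α) {γ : CharGroup k G}
    (hγ : γ ∈ Omega g r α) (j : Fin t) (b : A) : L.dual hr γ 0 (L.x j * b) = 0 := by
  have : HopfDual.leftTranslate k (L.x j) (L.dual hr γ 0) = 0 := by
    refine L.ext_monomial hr fun h m _ => ?_
    refine L.apply_x_mul_monomial_eq_zero hΘ
      (L.dual_mem_weight_grpPrime hr hγ 0) (L.dual_mem_homogeneous hr γ 0) j h m ?_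
    simp
  exact DFunLike.congr_fun this b

/-- Multiplicativity is checked on generators in the left factor: group elements act by the weight,
and `x_j` raises the degree away from 0. -/
lemma dual_zero_isGroupLike (hΘ : Theta χ ≤ Omega g r α) {γ : CharGroup k G}
    (hγ : γ ∈ Omega g r α) : IsGroupLikeElem k (L.dual hr γ 0) := by
  rw [HopfDual.isGroupLikeElem_iff]
  refine ⟨L.dual_zero_apply_one hr γ, fun a => ?_⟩
  have hw := HopfDual.mem_weight.1 (L.dual_mem_weight hr γ 0)
  refine L.adjoin_induction' (P := fun a => ∀ b, L.dual hr γ 0 (a * b) =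
    L.dual hr γ 0 a * L.dual hr γ 0 b) ?_ ?_ ?_ ?_ ?_ a
  · intro h b
    have h1 := hw h 1
    rw [mul_one, L.dual_zero_apply_one, mul_one] at h1
    rw [hw, h1]
  · intro j b
    have h1 := L.dual_zero_apply_x_mul hr hΘ hγ j 1
    rw [mul_one] at h1
    rw [L.dual_zero_apply_x_mul hr hΘ hγ, h1, zero_mul]
  · intro c b
    rw [← Algebra.smul_def, map_smul, Algebra.algebraMap_eq_smul_one, map_smul,
      L.dual_zero_apply_one, smul_eq_mul, smul_eq_mul, mul_one]
  · intro a a' ha ha' b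
    rw [add_mul, map_add, ha, ha', map_add, add_mul]
  · intro a a' ha ha' b
    rw [mul_assoc, ha, ha', ha, mul_assoc]

/-- `w_i` has degree 1, so only the terms `x_j h` survive. -/
lemma dualVec_apply_x_mul (hΘ : Theta χ ≤ Omega g r α) (i j : Fin t) (b : A) :
    L.dualVec hr i (L.x j * b) = if j = i then counit (R := k) b else 0 := by
  have : HopfDual.leftTranslate k (L.x j) (L.dualVec hr i) = if j = i then 1 else 0 := by
    refine L.ext_monomial hr fun h m _ => ?_
    rw [HopfDual.leftTranslate_apply]
    have hc : (if j = i then (1 : HopfDual k A) else 0) (L.grp h * monomialOf L.x m) =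
        if j = i ∧ m = 0 then 1 else 0 := by
      split_ifs with h₁ h₂ h₂
      · rw [HopfDual.one_apply, L.counit_monomial, if_pos h₂.2]
      · rw [HopfDual.one_apply, L.counit_monomial, if_neg fun h' => h₂ ⟨h₁, h'⟩]
      · exact absurd h₂.1 h₁
      · rfl
    rw [hc]
    by_cases hm : m = 0
    -- Moving `h` past `x_i` gives `χ_i(h)⁻¹`, which cancels the value `χ_i(h)` of `w_i` on `h x_i`.
    -- For this reason `w_i` carries the character `χ_i`.
    · rw [hm, monomialOf_zero, mul_one, L.x_mul_grp, Units.smul_def, map_smul,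
        L.dualVec_apply_grp_mul_x]
      by_cases hij : j = i
      · subst hij
        simp
      · simp [hij]
    · rw [if_neg fun h' => hm h'.2]
      refine L.apply_x_mul_monomial_eq_zero hΘ
        (L.dual_mem_weight_grpPrime hr (hΘ (Subgroup.subset_closure ⟨i, rfl⟩)) _)
        (L.dual_mem_homogeneous hr (χ i) _) j h m ?_
      have h1 : ∑ j, (Pi.single i 1 : Fin t → ℕ) j = 1 := by simp
      rw [h1]
      intro h'
      refine hm (funext fun j => ?_)
      exact Finset.sum_eq_zero_iff.1 (by omega : ∑ i, m i = 0) j (Finset.mem_univ j)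
  have := DFunLike.congr_fun this b
  rw [HopfDual.leftTranslate_apply] at this
  rw [this]
  split_ifs <;> rfl

/-- The `w_i` are skew derivations. -/
lemma dualVec_apply_mul (hΘ : Theta χ ≤ Omega g r α) (i : Fin t) (a b : A) :
    L.dualVec hr i (a * b) = L.dualVec hr i a * counit (R := k) b +
      L.dual hr (χ i) 0 a * L.dualVec hr i b := by
  have hχ : χ i ∈ Omega g r α := hΘ (Subgroup.subset_closure ⟨i, rfl⟩)
  have hmul := (HopfDual.isGroupLikeElem_iff.1 (L.dual_zero_isGroupLike hr hΘ hχ)).2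
  have hw := HopfDual.mem_weight.1 (L.dual_mem_weight hr (χ i) (Pi.single i 1))
  have hw₀ := HopfDual.mem_weight.1 (L.dual_mem_weight hr (χ i) 0)
  refine L.adjoin_induction' (P := fun a => ∀ b, L.dualVec hr i (a * b) =
    L.dualVec hr i a * counit (R := k) b + L.dual hr (χ i) 0 a * L.dualVec hr i b)
    ?_ ?_ ?_ ?_ ?_ a b
  · intro h b
    have h1 := hw₀ h 1
    rw [mul_one, L.dual_zero_apply_one, mul_one] at h1
    rw [hw, h1, L.dualVec_apply_grp, zero_mul, zero_add]
  · intro j b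
    have h0 := L.dual_zero_apply_x_mul hr hΘ hχ j 1
    have h1 := L.dualVec_apply_x_mul hr hΘ i j 1
    rw [mul_one] at h0 h1
    rw [L.dualVec_apply_x_mul hr hΘ, h0, h1]
    split_ifs <;> simp
  · intro c b
    have h1 := L.dualVec_apply_grp hr i 1
    rw [map_one] at h1
    rw [← Algebra.smul_def, map_smul, Algebra.algebraMap_eq_smul_one, map_smul, map_smul,
      L.dual_zero_apply_one, h1]
    simp
  · intro a a' ha ha' b
    rw [add_mul, map_add, ha, ha', map_add, map_add]
    ring
  · intro a a' ha ha' b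
    rw [mul_assoc, ha, ha', ha, hmul, Bialgebra.counit_mul]
    ring

lemma comul_dualVec (hΘ : Theta χ ≤ Omega g r α) (i : Fin t) :
    comul (R := k) (L.dualVec hr i) =
      L.dualVec hr i ⊗ₜ 1 + L.dual hr (χ i) 0 ⊗ₜ L.dualVec hr i := by
  apply HopfDual.ext_pair
  intro a b
  rw [HopfDual.pair_comul, map_add, LinearMap.add_apply, HopfDual.pair_tmul, HopfDual.pair_tmul,
    HopfDual.one_apply, L.dualVec_apply_mul hr hΘ]

/-- The group-likes of `A^*` are the `w(γ, 1)` with `γ ∈ Ω`. -/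
lemma exists_eq_dual_of_isGroupLike {f : HopfDual k A} (hf : IsGroupLikeElem k f) :
    ∃ γ ∈ Omega g r α, f = L.dual hr γ 0 := by
  obtain ⟨h1, hmul⟩ := HopfDual.isGroupLikeElem_iff.1 hf
  let φ : G →* k :=
    { toFun h := f (L.grp h)
      map_one' := by rw [map_one, h1]
      map_mul' h h' := by rw [map_mul, hmul] }
  have hφ (h : G) : (φ.toHomUnits h : k) = f (L.grp h) := rfl
  -- Apply `f` to `g_i x_i = χ_i(g_i) x_i g_i`, with `χ_i(g_i) ≠ 1`.
  have hx (i : Fin t) : f (L.x i) = 0 := by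
    have h := congrArg f (L.grp_mul_x (g i) i)
    rw [map_smul, hmul, hmul, smul_eq_mul, ← hφ] at h
    have hne : (χ i (g i) : k) ≠ 1 := by
      rw [Ne, Units.val_eq_one]
      exact (hr i).2.ne_one (hr i).1
    have h' : (1 - (χ i (g i) : k)) * φ.toHomUnits (g i) * f (L.x i) = 0 := by
      linear_combination h
    rcases mul_eq_zero.1 h' with h' | h'
    · rcases mul_eq_zero.1 h' with h' | h'
      · exact absurd (sub_eq_zero.1 h').symm hne
      · exact absurd h' (Units.ne_zero _)
    · exact h'
  have hpow (a : A) (n : ℕ) : f (a ^ n) = f a ^ n := by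
    induction n with
    | zero => simp [h1]
    | succ n ih => rw [pow_succ, hmul, ih, pow_succ]
  refine ⟨φ.toHomUnits, ⟨fun i => ?_, fun i j hij => ?_⟩, ?_⟩
  · have h := congrArg f (L.x_pow i)
    rw [hpow, hx, zero_pow (by have := (hr i).1; omega), map_smul, map_sub, h1] at h
    rw [hφ]
    exact h.symm
  · have h := congrArg f (L.x_mul_x i j hij)
    rw [hmul, hx, zero_mul, map_add, map_smul, hmul, hx, zero_mul, smul_zero, zero_add, map_smul,
      map_sub, h1] at h
    rw [hφ]
    exact h.symm
  · have := L.eq_smul_dual_zero hr (γ := φ.toHomUnits) (f := f)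
      (HopfDual.mem_weight.2 fun h a => hmul _ _) fun a i => by rw [hmul, hx, mul_zero]
    rwa [h1, one_smul] at this

/-- `Ω` is the group of group-likes of `A^*`. -/
lemma exists_omega_equiv_groupLike (hΘ : Theta χ ≤ Omega g r α) :
    ∃ e : Omega g r α ≃* GroupLike k (HopfDual k A),
      ∀ γ, (e γ).val = L.dual hr (γ : CharGroup k G) 0 := by
  let φ : Omega g r α →* GroupLike k (HopfDual k A) :=
    { toFun γ := ⟨L.dual hr γ 0, L.dual_zero_isGroupLike hr hΘ γ.2⟩
      map_one' := GroupLike.ext (L.dual_one_zero hr)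
      map_mul' γ γ' := GroupLike.ext (L.dual_mul_dual_zero hr γ γ' 0).symm }
  refine ⟨MulEquiv.ofBijective φ ⟨fun γ γ' h => ?_, fun f => ?_⟩, fun γ => rfl⟩
  · have h' : L.dual hr γ 0 = L.dual hr γ' 0 := congrArg GroupLike.val h
    ext x
    have h₁ := HopfDual.mem_weight.1 (L.dual_mem_weight hr γ 0) x 1
    have h₂ := HopfDual.mem_weight.1 (L.dual_mem_weight hr γ' 0) x 1
    rw [L.dual_zero_apply_one] at h₁ h₂
    rw [h', h₂] at h₁
    simpa using h₁.symm
  · obtain ⟨γ, hγ, h⟩ := L.exists_eq_dual_of_isGroupLike hr f.2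
    exact ⟨⟨γ, hγ⟩, GroupLike.ext h.symm⟩

end LiftingWithMatrix

end Lifting

lemma IsGroupLikeElem.antipode_eq_of_mul_eq_one {k H : Type*} [Field k] [Ring H] [HopfAlgebra k H]
    {a b : H} (ha : IsGroupLikeElem k a) (hab : a * b = 1) : HopfAlgebra.antipode k a = b :=
  left_inv_eq_right_inv ha.antipode_mul_cancel hab

lemma antipode_eq_of_skewPrimitive {k H : Type*} [Field k] [Ring H] [HopfAlgebra k H]
    {x a : H} (hx : comul (R := k) x = x ⊗ₜ 1 + a ⊗ₜ x) (h0 : counit (R := k) x = 0) :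
    HopfAlgebra.antipode k x = -(HopfAlgebra.antipode k a * x) := by
  have h := HopfAlgebra.mul_antipode_rTensor_comul_apply (R := k) x
  rw [hx, map_add, map_add, LinearMap.rTensor_tmul, LinearMap.rTensor_tmul, LinearMap.mul'_apply,
    LinearMap.mul'_apply, mul_one, h0, map_zero] at h
  exact eq_neg_of_add_eq_zero_left h

/-! ### The map `T(W) # k[Λ] → A^*` and its degrees -/

section Lifting

variable {k : Type*} [Field k] {G : Type*} [CommGroup G] {t : ℕ} {g : Fin t → G}
  {χ : Fin t → CharGroup k G} {r : Fin t → ℕ} {α : Matrix (Fin t) (Fin t) k}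
  {A : Type*} [Ring A] [HopfAlgebra k A]

namespace LiftingWithMatrix

variable (L : LiftingWithMatrix g χ r α A)
  (hr : ∀ i, 1 < r i ∧ IsPrimitiveRoot (χ i (g i)) (r i))
  {Λ : Subgroup (CharGroup k G)} (hΛ : Theta χ ≤ Λ)

/-- The algebra map `T(W) # k[Λ] → A^*` with `γ ↦ w(γ, 1)` and `w_i ↦ w(χ_i, x_i)`. -/
def tensorMap : TensorSmash k (dualDeg hΛ) (dualChar Λ g) →ₐ[k] HopfDual k A :=
  TensorSmash.lift ((L.dualGrp hr).comp Λ.subtype) (L.dualVec hr)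
    fun γ i => L.dual_zero_mul_dualVec hr γ i

@[simp] lemma tensorMap_grp (γ : Λ) :
    L.tensorMap hr hΛ (TensorSmash.grp k _ _ γ) = L.dual hr γ 0 := TensorSmash.lift_grp _ _ _ γ

@[simp] lemma tensorMap_vec (i : Fin t) :
    L.tensorMap hr hΛ (TensorSmash.vec k _ _ i) = L.dualVec hr i := TensorSmash.lift_vec _ _ _ i

lemma tensorMap_deg (n : ℕ) {z : TensorSmash k (dualDeg hΛ) (dualChar Λ g)}
    (hz : z ∈ TensorSmash.deg k (dualDeg hΛ) (dualChar Λ g) n) :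
    L.tensorMap hr hΛ z ∈ L.homogeneous n := by
  induction hz using Submodule.span_induction with
  | zero => simp
  | add x y _ _ hx hy => rw [map_add]; exact add_mem hx hy
  | smul c x _ hx => rw [map_smul]; exact Submodule.smul_mem _ c hx
  | mem z hz =>
    obtain ⟨γ, l, rfl, rfl⟩ := hz
    rw [map_mul, tensorMap_grp]
    have h0 := L.dual_mem_homogeneous hr γ 0
    simp only [Pi.zero_apply, Finset.sum_const_zero] at h0
    rw [← zero_add l.length]
    refine L.mul_mem_homogeneous h0 ?_
    induction l with
    | nil =>
      have h1 := L.dual_mem_homogeneous hr 1 0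
      simp only [Pi.zero_apply, Finset.sum_const_zero] at h1
      simpa [L.dual_one_zero] using h1
    | cons i l ih =>
      have h1 := L.dual_mem_homogeneous hr (χ i) (Pi.single i 1)
      simp only [Finset.sum_pi_single', Finset.mem_univ, if_true] at h1
      rw [List.map_cons, List.prod_cons, map_mul, tensorMap_vec, List.length_cons, add_comm]
      exact L.mul_mem_homogeneous h1 ih

lemma apply_grp_eq_zero (hr : ∀ i, 1 < r i) {f : HopfDual k A} {n : ℕ} (hf : f ∈ L.homogeneous n)
    (hn : n ≠ 0) (h : G) : f (L.grp h) = 0 := by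
  have := hf h 0 (fun i => Nat.zero_lt_one.trans (hr i)) (by simpa using hn.symm)
  rwa [monomialOf_zero, mul_one] at this

lemma apply_grp_mul_x_eq_zero (hr : ∀ i, 1 < r i) {f : HopfDual k A} {n : ℕ}
    (hf : f ∈ L.homogeneous n) (hn : n ≠ 1) (h : G) (i : Fin t) : f (L.grp h * L.x i) = 0 := by
  have := hf h (Pi.single i 1) (fun j => by
    by_cases hj : j = i
    · subst hj
      simpa using hr j
    · simpa [hj] using Nat.zero_lt_one.trans (hr j)) (by simpa using hn.symm)
  rwa [monomialOf_single] at this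

lemma tensorMap_apply_of_mem_iSup_deg {z : TensorSmash k (dualDeg hΛ) (dualChar Λ g)}
    (hz : z ∈ ⨆ n ≥ 2, TensorSmash.deg k (dualDeg hΛ) (dualChar Λ g) n) :
    (∀ h, L.tensorMap hr hΛ z (L.grp h) = 0) ∧
      ∀ h i, L.tensorMap hr hΛ z (L.grp h * L.x i) = 0 := by
  have key (a : A) (ha : ∀ n ≥ 2, ∀ f ∈ L.homogeneous n, f a = 0) :
      L.tensorMap hr hΛ z a = 0 := by
    have : (⨆ n ≥ 2, TensorSmash.deg k (dualDeg hΛ) (dualChar Λ g) n) ≤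
        LinearMap.ker (LinearMap.applyₗ a ∘ₗ (HopfDual.toDual k A).toLinearMap ∘ₗ
          (L.tensorMap hr hΛ).toLinearMap) :=
      iSup₂_le fun n hn z hz => ha n hn _ (L.tensorMap_deg hr hΛ n hz)
    exact this hz
  exact ⟨fun h => key _ fun n hn f hf =>
      L.apply_grp_eq_zero (fun i => (hr i).1) hf (by omega) h,
    fun h i => key _ fun n hn f hf =>
      L.apply_grp_mul_x_eq_zero (fun i => (hr i).1) hf (by omega) h i⟩

lemma dual_zero_apply_grp (γ : CharGroup k G) (h : G) : L.dual hr γ 0 (L.grp h) = γ h := by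
  have := HopfDual.mem_weight.1 (L.dual_mem_weight hr γ 0) h 1
  rwa [mul_one, L.dual_zero_apply_one, mul_one] at this

lemma iSup_deg : (⨆ n, TensorSmash.deg k (dualDeg hΛ) (dualChar Λ g) n) = ⊤ := by
  set S := ⨆ n, TensorSmash.deg k (dualDeg hΛ) (dualChar Λ g) n with hS
  have hmem (γ : Λ) (l : List (Fin t)) : TensorSmash.grp k (dualDeg hΛ) (dualChar Λ g) γ *
      (l.map (TensorSmash.vec k (dualDeg hΛ) (dualChar Λ g))).prod ∈ S :=
    Submodule.mem_iSup_of_mem l.length (Submodule.subset_span ⟨γ, l, rfl, rfl⟩)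
  have hind {P : TensorSmash k (dualDeg hΛ) (dualChar Λ g) → Prop} (h0 : P 0)
      (hadd : ∀ x y, P x → P y → P (x + y)) (hsmul : ∀ (c : k) x, P x → P (c • x))
      (hm : ∀ (γ : Λ) (l : List (Fin t)), P (TensorSmash.grp k (dualDeg hΛ) (dualChar Λ g) γ *
        (l.map (TensorSmash.vec k (dualDeg hΛ) (dualChar Λ g))).prod)) : ∀ x ∈ S, P x := by
    intro x hx
    refine Submodule.iSup_induction _ (motive := P) hx (fun n x hx => ?_) h0 hadd
    induction hx using Submodule.span_induction with
    | zero => exact h0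
    | add x y _ _ hx hy => exact hadd _ _ hx hy
    | smul c x _ hx => exact hsmul c x hx
    | mem z hz =>
      obtain ⟨γ, l, -, rfl⟩ := hz
      exact hm γ l
  have hstable (z : TensorSmash k (dualDeg hΛ) (dualChar Λ g)) : ∀ x ∈ S, z * x ∈ S := by
    refine TensorSmash.induction (P := fun z => ∀ x ∈ S, z * x ∈ S) ?_ ?_ ?_ ?_ ?_ z
    · intro c x hx
      rw [← Algebra.smul_def]
      exact S.smul_mem c hx
    · intro γ
      refine hind (by simp) (fun x y hx hy => by rw [mul_add]; exact add_mem hx hy)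
        (fun c x hx => by rw [mul_smul_comm]; exact S.smul_mem c hx) fun γ' l => ?_
      rw [← mul_assoc, ← map_mul]
      exact hmem _ l
    · intro i
      refine hind (by simp) (fun x y hx hy => by rw [mul_add]; exact add_mem hx hy)
        (fun c x hx => by rw [mul_smul_comm]; exact S.smul_mem c hx) fun γ l => ?_
      have h := TensorSmash.grp_mul_vec k (dualDeg hΛ) (dualChar Λ g) γ i
      rw [← mul_assoc, ← inv_smul_smul₀ (Units.ne_zero (dualChar Λ g i γ))
        (TensorSmash.vec k _ _ i * TensorSmash.grp k _ _ γ), ← h, smul_mul_assoc, mul_assoc,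
        ← List.prod_cons, ← List.map_cons]
      exact S.smul_mem _ (hmem γ (i :: l))
    · intro x y hx hy z hz
      rw [add_mul]
      exact add_mem (hx z hz) (hy z hz)
    · intro x y hx hy z hz
      rw [mul_assoc]
      exact hx _ (hy z hz)
  rw [eq_top_iff]
  intro z _
  have h1 : (1 : TensorSmash k (dualDeg hΛ) (dualChar Λ g)) ∈ S := by simpa using hmem 1 []
  simpa using hstable z 1 h1

/-- Dedekind's independence of characters. -/
lemma eq_zero_of_mem_deg_zero [Finite Λ] {z : TensorSmash k (dualDeg hΛ) (dualChar Λ g)}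
    (hz : z ∈ TensorSmash.deg k (dualDeg hΛ) (dualChar Λ g) 0)
    (h0 : ∀ h, L.tensorMap hr hΛ z (L.grp h) = 0) : z = 0 := by
  have := Fintype.ofFinite Λ
  have hz' : z ∈ Submodule.span k (Set.range (TensorSmash.grp k (dualDeg hΛ) (dualChar Λ g))) := by
    refine Submodule.span_mono ?_ hz
    rintro _ ⟨γ, l, hl, rfl⟩
    rw [List.length_eq_zero_iff.1 hl]
    exact ⟨γ, by simp⟩
  obtain ⟨c, rfl⟩ := (Submodule.mem_span_range_iff_exists_fun k).1 hz'
  have hli := (linearIndependent_monoidHom G k).comp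
    (fun γ : Λ => (Units.coeHom k).comp (γ : CharGroup k G)) (fun γ γ' h => by
      ext x
      exact DFunLike.congr_fun h x)
  rw [Fintype.linearIndependent_iff] at hli
  have hc := hli c (funext fun h => by
    have := h0 h
    simpa [L.dual_zero_apply_grp] using this)
  simp [hc]

/-- On `h x_j` only the terms with `w_j` contribute, each being `γ(g_j) χ_j(h) γ(h)`. The unit
`χ_j(h)` cancels and independence of characters applies again. -/
lemma eq_zero_of_mem_deg_one [Finite Λ] {z : TensorSmash k (dualDeg hΛ) (dualChar Λ g)}
    (hz : z ∈ TensorSmash.deg k (dualDeg hΛ) (dualChar Λ g) 1)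
    (h1 : ∀ h i, L.tensorMap hr hΛ z (L.grp h * L.x i) = 0) : z = 0 := by
  have := Fintype.ofFinite Λ
  have hz' : z ∈ Submodule.span k (Set.range fun p : Λ × Fin t =>
      TensorSmash.grp k (dualDeg hΛ) (dualChar Λ g) p.1 * TensorSmash.vec k _ _ p.2) := by
    refine Submodule.span_mono ?_ hz
    rintro _ ⟨γ, l, hl, rfl⟩
    obtain ⟨i, rfl⟩ := List.length_eq_one_iff.1 hl
    exact ⟨(γ, i), by simp⟩
  obtain ⟨c, rfl⟩ := (Submodule.mem_span_range_iff_exists_fun k).1 hz'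
  have hli := (linearIndependent_monoidHom G k).comp
    (fun γ : Λ => (Units.coeHom k).comp (γ : CharGroup k G)) (fun γ γ' h => by
      ext x
      exact DFunLike.congr_fun h x)
  rw [Fintype.linearIndependent_iff] at hli
  have happ (γ : Λ) (i j : Fin t) (h : G) :
      (L.dual hr γ 0 * L.dualVec hr i) (L.grp h * L.x j) =
        if j = i then (γ : CharGroup k G) (g i) * ((γ : CharGroup k G) h * χ i h : k) else 0 := by
    have hj : ∀ l, (Pi.single j 1 : Fin t → ℕ) l < r l := fun l => by
      by_cases hl : l = j
      · subst hl
        simpa using (hr l).1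
      · simpa [hl] using Nat.zero_lt_one.trans (hr l).1
    have hij : (Pi.single j 1 : Fin t → ℕ) = Pi.single i 1 ↔ j = i := by
      refine ⟨fun h' => ?_, fun h' => by rw [h']⟩
      by_contra hij
      have := congrFun h' j
      simp [hij] at this
    rw [L.dual_zero_mul_dual, HopfDual.smul_apply, groupMonomial_single, ← monomialOf_single L.x j,
      L.dual_apply hr _ _ _ hj]
    simp only [hij]
    split_ifs <;> simp
  have hc (j : Fin t) (γ : Λ) : c (γ, j) = 0 := by
    have := hli (fun γ => c (γ, j) * (γ : CharGroup k G) (g j)) (funext fun h => by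
      have := h1 h j
      simp only [map_sum, map_smul, map_mul, tensorMap_grp, tensorMap_vec, HopfDual.sum_apply,
        HopfDual.smul_apply, happ, Fintype.sum_prod_type, mul_ite, mul_zero,
        Finset.sum_ite_eq, Finset.mem_univ, if_true] at this
      have h' : (∑ γ : Λ, c (γ, j) * (γ : CharGroup k G) (g j) * (γ : CharGroup k G) h) *
          (χ j h : k) = 0 := by
        rw [Finset.sum_mul, ← this]
        exact Finset.sum_congr rfl fun _ _ => by ring
      rcases mul_eq_zero.1 h' with h' | h'
      · simpa using h'
      · exact absurd h' (Units.ne_zero _)) γ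
    exact (mul_eq_zero.1 this).resolve_right (Units.ne_zero _)
  refine Finset.sum_eq_zero fun p _ => ?_
  rw [show p = (p.1, p.2) from rfl, hc, zero_smul]

/-- Evaluating on `h` isolates the part of degree 0, and evaluating on `h x_i` the part of degree 1;
both are then zero by injectivity. -/
lemma mem_iSup_deg_of_tensorMap_eq_zero [Finite Λ]
    {z : TensorSmash k (dualDeg hΛ) (dualChar Λ g)} (hz : L.tensorMap hr hΛ z = 0) :
    z ∈ ⨆ n ≥ 2, TensorSmash.deg k (dualDeg hΛ) (dualChar Λ g) n := by
  have htop : z ∈ TensorSmash.deg k (dualDeg hΛ) (dualChar Λ g) 0 ⊔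
      (TensorSmash.deg k (dualDeg hΛ) (dualChar Λ g) 1 ⊔
        ⨆ n ≥ 2, TensorSmash.deg k (dualDeg hΛ) (dualChar Λ g) n) := by
    have : (⨆ n, TensorSmash.deg k (dualDeg hΛ) (dualChar Λ g) n) ≤
        TensorSmash.deg k (dualDeg hΛ) (dualChar Λ g) 0 ⊔
          (TensorSmash.deg k (dualDeg hΛ) (dualChar Λ g) 1 ⊔
            ⨆ n ≥ 2, TensorSmash.deg k (dualDeg hΛ) (dualChar Λ g) n) := by
      refine iSup_le fun n => ?_
      match n with
      | 0 => exact le_sup_left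
      | 1 => exact le_sup_left.trans le_sup_right
      | n + 2 =>
        refine le_trans ?_ (le_sup_right.trans le_sup_right)
        exact le_iSup₂_of_le (f := fun n (_ : n ≥ 2) => TensorSmash.deg k _ _ n) (n + 2)
          (by omega) le_rfl
    refine this ?_
    rw [iSup_deg hΛ]
    trivial
  obtain ⟨z₀, h₀, z', hz', rfl⟩ := Submodule.mem_sup.1 htop
  obtain ⟨z₁, h₁, z₂, h₂, rfl⟩ := Submodule.mem_sup.1 hz'
  obtain ⟨e₁, e₂⟩ := L.tensorMap_apply_of_mem_iSup_deg hr hΛ h₂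
  have hr1 : ∀ i, 1 < r i := fun i => (hr i).1
  have f₀ := L.tensorMap_deg hr hΛ 0 h₀
  have f₁ := L.tensorMap_deg hr hΛ 1 h₁
  rw [map_add, map_add] at hz
  have hz₀ : z₀ = 0 := L.eq_zero_of_mem_deg_zero hr hΛ h₀ fun h => by
    have := DFunLike.congr_fun hz (L.grp h)
    rw [HopfDual.add_apply, HopfDual.add_apply, e₁,
      L.apply_grp_eq_zero hr1 f₁ one_ne_zero, add_zero, add_zero] at this
    exact this
  have hz₁ : z₁ = 0 := L.eq_zero_of_mem_deg_one hr hΛ h₁ fun h i => by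
    have := DFunLike.congr_fun hz (L.grp h * L.x i)
    rw [HopfDual.add_apply, HopfDual.add_apply, e₂,
      L.apply_grp_mul_x_eq_zero hr1 f₀ zero_ne_one, add_zero, zero_add] at this
    exact this
  rwa [hz₀, hz₁, zero_add, zero_add]

end LiftingWithMatrix

end Lifting

/-! ### Image and kernel of the map, and the Nichols algebra of `W` -/

section Lifting

variable {k : Type*} [Field k] {G : Type*} [CommGroup G] {t : ℕ} {g : Fin t → G}
  {χ : Fin t → CharGroup k G} {r : Fin t → ℕ} {α : Matrix (Fin t) (Fin t) k}
  {A : Type*} [Ring A] [HopfAlgebra k A]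

namespace LiftingWithMatrix

variable (L : LiftingWithMatrix g χ r α A)
  (hr : ∀ i, 1 < r i ∧ IsPrimitiveRoot (χ i (g i)) (r i))
  {Λ : Subgroup (CharGroup k G)} (hΛ : Theta χ ≤ Λ)

/-- Up to a nonzero scalar, `w(γ, x^{n'+e_i})` is `w_i` times `w(χ_i⁻¹ γ, x^{n'})`, so induction on
the degree works; the character stays in `Λ` because `Θ ≤ Λ`. -/
lemma dual_mem_range {γ : CharGroup k G} (hγ : γ ∈ Λ) (m : Fin t → ℕ) (hm : ∀ i, m i < r i) :
    L.dual hr γ m ∈ (L.tensorMap hr hΛ).range := by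
  induction hn : ∑ i, m i generalizing m γ with
  | zero =>
    have : m = 0 := by
      funext i
      exact Finset.sum_eq_zero_iff.1 hn i (Finset.mem_univ i)
    subst this
    exact ⟨TensorSmash.grp k _ _ ⟨γ, hγ⟩, L.tensorMap_grp hr hΛ ⟨γ, hγ⟩⟩
  | succ n ih =>
    obtain ⟨i, hi⟩ : ∃ i, m i ≠ 0 := by
      by_contra! h
      simp [h] at hn
    obtain ⟨n', rfl⟩ : ∃ n', m = n' + Pi.single i 1 :=
      ⟨m - Pi.single i 1, by
        funext j
        rcases eq_or_ne j i with rfl | hj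
        · simp only [Pi.add_apply, Pi.sub_apply, Pi.single_eq_same]
          omega
        · simp [hj]⟩
    have hi' : χ i ∈ Λ := (dualDeg hΛ i).2
    have hγ' : (χ i)⁻¹ * γ ∈ Λ := mul_mem (inv_mem hi') hγ
    have h1 := ih hγ' n' (fun j => lt_of_le_of_lt (by simp) (hm j)) (by
      simp only [Pi.add_apply, Finset.sum_add_distrib, Finset.sum_pi_single', Finset.mem_univ,
        if_true] at hn
      omega)
    have hmul := L.dual_mul_dual hr (χ i) ((χ i)⁻¹ * γ) (Pi.single i 1) n'
    rw [show χ i * ((χ i)⁻¹ * γ) = γ by ext; simp] at hmul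
    have hc : L.comulCoeff (n' + Pi.single i 1) (Pi.single i 1) *
        (χ i (groupMonomial g n') : k) ≠ 0 :=
      mul_ne_zero (L.comulCoeff_single_ne_zero (hr i).2 (by simp) (hm i)) (Units.ne_zero _)
    rw [← inv_smul_smul₀ hc (L.dual hr γ _), ← hmul]
    have hv : L.dualVec hr i ∈ (L.tensorMap hr hΛ).range :=
      ⟨TensorSmash.vec k _ _ i, L.tensorMap_vec hr hΛ i⟩
    exact Subalgebra.smul_mem _ (mul_mem hv h1) _

/-- The elements of `A^*` invariant under the annihilator of `Λ` in `G`. -/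
abbrev subgroupInvariants (N : Subgroup G) : Subalgebra k (HopfDual k A) :=
  HopfDual.invariants (L.grp.comp N.subtype) fun h => L.grp_isGroupLike h

lemma mem_subgroupInvariants {N : Subgroup G} {f : HopfDual k A} :
    f ∈ L.subgroupInvariants N ↔ ∀ h ∈ N, ∀ a, f (L.grp h * a) = f a := by
  refine HopfDual.mem_weight.trans ?_
  simp

/-- The invariants are stable under `G`, hence a sum of weight spaces. A weight that is nontrivial
on `N` contributes nothing. -/
lemma toSubmodule_subgroupInvariants_le [Finite G] [IsAlgClosed k] [CharZero k] {N : Subgroup G}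
    (hN : ∀ γ, γ ∈ Λ ↔ ∀ x ∈ N, γ x = 1) :
    Subalgebra.toSubmodule (L.subgroupInvariants N) ≤ ⨆ γ ∈ Λ, HopfDual.weight L.grp γ := by
  have hE : ∀ h, ∀ f ∈ Subalgebra.toSubmodule (L.subgroupInvariants N),
      HopfDual.translate k L.grp h f ∈ Subalgebra.toSubmodule (L.subgroupInvariants N) := by
    intro h f hf
    rw [Subalgebra.mem_toSubmodule, mem_subgroupInvariants] at *
    intro h' hh' a
    change f (L.grp h * (L.grp h' * a)) = f (L.grp h * a)
    rw [← mul_assoc, ← map_mul L.grp, mul_comm h h', map_mul L.grp, mul_assoc, hf h' hh']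
  refine (le_iSup_isotypic_inf (HopfDual.translate k L.grp) hE).trans (iSup_le fun γ => ?_)
  by_cases hγ : γ ∈ Λ
  · exact inf_le_left.trans (le_iSup₂_of_le (f := fun γ (_ : γ ∈ Λ) => HopfDual.weight L.grp γ)
      γ hγ le_rfl)
  · rintro f ⟨hf, hinv⟩
    rw [hN] at hγ
    push Not at hγ
    obtain ⟨x, hx, hne⟩ := hγ
    have : f = 0 := by
      ext a
      have h1 := HopfDual.mem_weight.1 hf x a
      rw [L.mem_subgroupInvariants.1 hinv x hx] at h1
      have h2 : ((γ x : k) - 1) * f a = 0 := by rw [sub_mul, one_mul, ← h1, sub_self]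
      refine (mul_eq_zero.1 h2).resolve_left fun h => hne ?_
      rw [sub_eq_zero] at h
      exact Units.ext h
    rw [this]
    exact zero_mem _

lemma range_tensorMap [Finite G] [IsAlgClosed k] [CharZero k] {N : Subgroup G}
    (hN : ∀ γ, γ ∈ Λ ↔ ∀ x ∈ N, γ x = 1) :
    (L.tensorMap hr hΛ).range = L.subgroupInvariants N := by
  have hdual {γ : CharGroup k G} (hγ : γ ∈ Λ) (n : Fin t → ℕ) :
      L.dual hr γ n ∈ L.subgroupInvariants N := by
    rw [mem_subgroupInvariants]
    intro h hh a
    rw [HopfDual.mem_weight.1 (L.dual_mem_weight hr γ n), (hN γ).1 hγ h hh, Units.val_one, one_mul]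
  apply le_antisymm
  · rintro _ ⟨z, rfl⟩
    change L.tensorMap hr hΛ z ∈ _
    induction z using TensorSmash.induction with
    | hs c => rw [AlgHom.commutes]; exact Subalgebra.algebraMap_mem _ c
    | hg γ => rw [tensorMap_grp]; exact hdual γ.2 0
    | hv i => rw [tensorMap_vec]; exact hdual (dualDeg hΛ i).2 _
    | hadd x y hx hy => rw [map_add]; exact add_mem hx hy
    | hmul x y hx hy => rw [map_mul]; exact mul_mem hx hy
  · refine ((L.toSubmodule_subgroupInvariants_le hN).trans (iSup₂_le fun γ hγ f hf => ?_) :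
      _ ≤ Subalgebra.toSubmodule (L.tensorMap hr hΛ).range)
    refine Submodule.span_le.2 ?_ (L.mem_span_dual_of_mem_weight hr hf)
    rintro _ ⟨m, hm, rfl⟩
    exact L.dual_mem_range hr hΛ hγ m hm

variable [Module.Finite k A]

lemma counit_dualVec (i : Fin t) : counit (R := k) (L.dualVec hr i) = 0 := by
  have := L.dualVec_apply_grp hr i 1
  rwa [map_one] at this

/-- `tensorMap` as a map of bialgebras. -/
def tensorBialgHom (hΛΩ : Λ ≤ Omega g r α) :
    TensorSmash k (dualDeg hΛ) (dualChar Λ g) →ₐc[k] HopfDual k A :=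
  BialgHom.ofAlgHom (L.tensorMap hr hΛ)
    (TensorSmash.algHom_ext
      (fun γ => by
        have := (L.dual_zero_isGroupLike hr (hΛ.trans hΛΩ) (hΛΩ γ.2)).counit_eq_one
        simpa using this)
      (fun i => by
        have := L.counit_dualVec hr i
        simpa using this))
    (TensorSmash.algHom_ext
      (fun γ => by
        have := (L.dual_zero_isGroupLike hr (hΛ.trans hΛΩ) (hΛΩ γ.2)).comul_eq_tmul_self
        simpa using this.symm)
      (fun i => by
        have := L.comul_dualVec hr (hΛ.trans hΛΩ) i
        simpa [dualDeg] using this.symm))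

lemma comul_tensorMap (hΛΩ : Λ ≤ Omega g r α)
    (z : TensorSmash k (dualDeg hΛ) (dualChar Λ g)) :
    comul (R := k) (L.tensorMap hr hΛ z) =
      TensorProduct.map (L.tensorMap hr hΛ).toLinearMap (L.tensorMap hr hΛ).toLinearMap
        (comul (R := k) z) :=
  (CoalgHomClass.map_comp_comul_apply (L.tensorBialgHom hr hΛ hΛΩ) z).symm

lemma counit_tensorMap (hΛΩ : Λ ≤ Omega g r α)
    (z : TensorSmash k (dualDeg hΛ) (dualChar Λ g)) :
    counit (R := k) (L.tensorMap hr hΛ z) = counit (R := k) z :=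
  CoalgHomClass.counit_comp_apply (L.tensorBialgHom hr hΛ hΛΩ) z

lemma antipode_dual_zero (hΘ : Theta χ ≤ Omega g r α) {γ : CharGroup k G}
    (hγ : γ ∈ Omega g r α) :
    HopfAlgebra.antipode k (L.dual hr γ 0) = L.dual hr γ⁻¹ 0 := by
  refine (L.dual_zero_isGroupLike hr hΘ hγ).antipode_eq_of_mul_eq_one ?_
  rw [L.dual_mul_dual_zero, ← L.dual_one_zero hr]
  congr 1
  ext
  simp

lemma tensorMap_antipode (hΛΩ : Λ ≤ Omega g r α)
    (z : TensorSmash k (dualDeg hΛ) (dualChar Λ g)) :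
    L.tensorMap hr hΛ (HopfAlgebra.antipode k z) =
      HopfAlgebra.antipode k (L.tensorMap hr hΛ z) := by
  induction z using TensorSmash.induction with
  | hs c => simp [Algebra.algebraMap_eq_smul_one]
  | hg γ =>
    rw [TensorSmash.antipode_grp, tensorMap_grp, tensorMap_grp,
      L.antipode_dual_zero hr (hΛ.trans hΛΩ) (hΛΩ γ.2)]
    rfl
  | hv i =>
    have hi : χ i ∈ Omega g r α := hΛΩ (dualDeg hΛ i).2
    rw [TensorSmash.antipode_vec, tensorMap_vec,
      antipode_eq_of_skewPrimitive (L.comul_dualVec hr (hΛ.trans hΛΩ) i) (L.counit_dualVec hr i),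
      L.antipode_dual_zero hr (hΛ.trans hΛΩ) hi, map_neg, map_mul, tensorMap_grp, tensorMap_vec]
    rfl
  | hadd x y hx hy => simp only [map_add, hx, hy]
  | hmul x y hx hy =>
    rw [TensorSmash.antipode_mul', map_mul, hx, hy, map_mul, HopfAlgebra.antipode_mul_antidistrib]

/-- Evaluations at `a` and at `b` both factor through the quotient by `J`, and the coideal property
says that `Δ z` vanishes in the tensor square of that quotient. -/
lemma tensorMap_apply_mul_eq_zero (hΛΩ : Λ ≤ Omega g r α)
    {J : Ideal (TensorSmash k (dualDeg hΛ) (dualChar Λ g))} (hJ : J.IsHopfIdeal k) {a b : A}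
    (ha : ∀ z ∈ J, L.tensorMap hr hΛ z a = 0) (hb : ∀ z ∈ J, L.tensorMap hr hΛ z b = 0)
    {z : TensorSmash k (dualDeg hΛ) (dualChar Λ g)} (hz : z ∈ J) :
    L.tensorMap hr hΛ z (a * b) = 0 := by
  let ev (a : A) : TensorSmash k (dualDeg hΛ) (dualChar Λ g) →ₗ[k] k :=
    LinearMap.applyₗ a ∘ₗ (HopfDual.toDual k A).toLinearMap ∘ₗ (L.tensorMap hr hΛ).toLinearMap
  let u := (J.restrictScalars k).liftQ (ev a) ha
  let v := (J.restrictScalars k).liftQ (ev b) hb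
  have key (T : TensorSmash k (dualDeg hΛ) (dualChar Λ g) ⊗[k]
      TensorSmash k (dualDeg hΛ) (dualChar Λ g)) :
      HopfDual.pair k A (TensorProduct.map (L.tensorMap hr hΛ).toLinearMap
        (L.tensorMap hr hΛ).toLinearMap T) (a ⊗ₜ b) =
      LinearMap.mul' k k (TensorProduct.map u v
        (TensorProduct.map (J.restrictScalars k).mkQ (J.restrictScalars k).mkQ T)) := by
    induction T with
    | zero => simp
    | add x y hx hy => simp only [map_add, LinearMap.add_apply, hx, hy]
    | tmul x y => exact HopfDual.pair_tmul _ _ a b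
  rw [← HopfDual.pair_comul, L.comul_tensorMap hr hΛ hΛΩ, key, hJ.map_mkQ_comul_eq_zero hz]
  simp

/-- The ideal of relations of the Nichols algebra is the kernel of `tensorMap`. -/
lemma mem_nicholsIdeal_iff [Finite Λ] (hΛΩ : Λ ≤ Omega g r α)
    {z : TensorSmash k (dualDeg hΛ) (dualChar Λ g)} :
    z ∈ nicholsIdeal k (dualDeg hΛ) (dualChar Λ g) ↔ L.tensorMap hr hΛ z = 0 := by
  constructor
  · have hle : nicholsIdeal k (dualDeg hΛ) (dualChar Λ g) ≤ RingHom.ker (L.tensorMap hr hΛ) := by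
      refine sSup_le fun J hJ z hz => ?_
      have hdeg := hJ.2.2
      change L.tensorMap hr hΛ z = 0
      ext a
      -- Degree at least 2 handles the generators of `A`, and the coideal property handles products.
      refine L.adjoin_induction' (P := fun a => ∀ z ∈ J, L.tensorMap hr hΛ z a = 0)
        (fun h z hz => (L.tensorMap_apply_of_mem_iSup_deg hr hΛ (hdeg hz)).1 h)
        (fun i z hz => ?_) (fun c z hz => ?_)
        (fun a b ha hb z hz => by rw [map_add, ha z hz, hb z hz, add_zero])
        (fun a b ha hb z hz => L.tensorMap_apply_mul_eq_zero hr hΛ hΛΩ hJ.2.1 ha hb hz) a z hz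
      · have := (L.tensorMap_apply_of_mem_iSup_deg hr hΛ (hdeg hz)).2 1 i
        rwa [map_one, one_mul] at this
      · have := (L.tensorMap_apply_of_mem_iSup_deg hr hΛ (hdeg hz)).1 1
        rw [map_one] at this
        rw [Algebra.algebraMap_eq_smul_one, map_smul, this, smul_zero]
    exact fun hz => hle hz
  · intro hz
    let N : Ideal (TensorSmash k (dualDeg hΛ) (dualChar Λ g)) := RingHom.ker (L.tensorMap hr hΛ)
    have hN : N.IsHopfIdeal k :=
      { counit_eq_zero := fun x hx => by
          have hx : L.tensorMap hr hΛ x = 0 := hx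
          rw [← L.counit_tensorMap hr hΛ hΛΩ, hx, map_zero]
        map_mkQ_comul_eq_zero := fun x hx => by
          have hx : L.tensorMap hr hΛ x = 0 := hx
          -- Over a field the tensor square of the injective map `φ` is injective, so the coideal
          -- condition can be tested in `A^* ⊗ A^*`.
          let φ := (N.restrictScalars k).liftQ (L.tensorMap hr hΛ).toLinearMap (fun _ h => h)
          have hφ : Function.Injective φ := by
            rw [← LinearMap.ker_eq_bot]
            exact Submodule.ker_liftQ_eq_bot _ _ _ fun _ h => h
          apply TensorProduct.map_injective_of_flat_flat φ φ hφ hφ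
          have hφN : φ ∘ₗ (N.restrictScalars k).mkQ = (L.tensorMap hr hΛ).toLinearMap :=
            Submodule.liftQ_mkQ _ _ _
          rw [map_zero, ← LinearMap.comp_apply, ← TensorProduct.map_comp, hφN, ← L.comul_tensorMap hr hΛ hΛΩ, hx, map_zero]
        antipode_mem := fun x hx => by
          have hx : L.tensorMap hr hΛ x = 0 := hx
          change L.tensorMap hr hΛ _ = 0
          rw [L.tensorMap_antipode hr hΛ hΛΩ, hx, map_zero] }
    have hle : N ≤ nicholsIdeal k (dualDeg hΛ) (dualChar Λ g) :=
      le_sSup ⟨inferInstance, hN, fun x hx => L.mem_iSup_deg_of_tensorMap_eq_zero hr hΛ hx⟩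
    exact hle hz

/-- The embedding of `B(W) # k[Λ]` into `A^*`. -/
def nicholsBialgHom [Finite Λ] (hΛΩ : Λ ≤ Omega g r α) :
    DualNicholsSmash g hΛ →ₐc[k] HopfDual k A :=
  BialgHom.ofAlgHom
    (Ideal.Quotient.liftₐ (nicholsIdeal k (dualDeg hΛ) (dualChar Λ g)) (L.tensorMap hr hΛ)
      fun _ hz => (L.mem_nicholsIdeal_iff hr hΛ hΛΩ).1 hz)
    (Ideal.Quotient.algHom_ext k (by
      ext z
      exact L.counit_tensorMap hr hΛ hΛΩ z))
    (Ideal.Quotient.algHom_ext k (by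
      ext z
      exact (TensorProduct.map_map _ _ _ _ _).trans (L.comul_tensorMap hr hΛ hΛΩ z).symm))

lemma nicholsBialgHom_injective [Finite Λ] (hΛΩ : Λ ≤ Omega g r α) :
    Function.Injective (L.nicholsBialgHom hr hΛ hΛΩ) := by
  rw [injective_iff_map_eq_zero]
  intro z hz
  obtain ⟨z, rfl⟩ := Ideal.Quotient.mk_surjective z
  exact Ideal.Quotient.eq_zero_iff_mem.2 ((L.mem_nicholsIdeal_iff hr hΛ hΛΩ).2 hz)

lemma range_nicholsBialgHom [Finite Λ] (hΛΩ : Λ ≤ Omega g r α) :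
    Set.range (L.nicholsBialgHom hr hΛ hΛΩ) = (L.tensorMap hr hΛ).range := by
  ext f
  constructor
  · rintro ⟨z, rfl⟩
    obtain ⟨z, rfl⟩ := Ideal.Quotient.mk_surjective z
    exact ⟨z, rfl⟩
  · rintro ⟨z, rfl⟩
    exact ⟨NicholsSmash.mk k _ _ z, rfl⟩

end LiftingWithMatrix

end Lifting

instance {k A : Type*} [Field k] [Ring A] [HopfAlgebra k A] [Module.Finite k A] :
    Module.Finite k (HopfDual k A) :=
  Module.Finite.equiv (HopfDual.toDual k A).symm

lemma IsGroupLikeElem.subcoalgebraIso_map_mulLeft {k H : Type*} [Field k] [Ring H]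
    [Bialgebra k H] {p q : H} (hp : IsGroupLikeElem k p) (hqp : q * p = 1) {D : Submodule k H}
    (hD : IsSubcoalgebra k D) : SubcoalgebraIso k D (D.map (LinearMap.mulLeft k p)) := by
  have hinj : Function.Injective (LinearMap.mulLeft k p) := by
    refine Function.LeftInverse.injective (g := fun x => q * x) fun x => ?_
    change q * (p * x) = x
    rw [← mul_assoc, hqp, one_mul]
  refine ⟨Submodule.equivMapOfInjective _ hinj D, fun d => ?_, fun d => ?_⟩
  · rw [Submodule.coe_equivMapOfInjective_apply, LinearMap.mulLeft_apply, Bialgebra.counit_mul,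
      hp.counit_eq_one, one_mul]
  · obtain ⟨T, hT⟩ := hD d d.2
    refine ⟨T, hT.symm, ?_⟩
    rw [Submodule.coe_equivMapOfInjective_apply, LinearMap.mulLeft_apply, Bialgebra.comul_mul,
      hp.comul_eq_tmul_self, ← hT]
    clear hT
    induction T with
    | zero => simp
    | tmul x y => simp
    | add x y hx hy => simp only [map_add, mul_add, hx, hy]

/-! ### The components `C(γ̄)` -/

section Lifting

variable {k : Type*} [Field k] {G : Type*} [CommGroup G] {t : ℕ} {g : Fin t → G}
  {χ : Fin t → CharGroup k G} {r : Fin t → ℕ} {α : Matrix (Fin t) (Fin t) k}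
  {A : Type*} [Ring A] [HopfAlgebra k A]

/-- The common kernel of the characters `χ i`. -/
def charKernel (χ : Fin t → CharGroup k G) : Subgroup G := ⨅ i, (χ i).ker

lemma mem_charKernel {h : G} : h ∈ charKernel χ ↔ ∀ i, χ i h = 1 := by
  simp [charKernel, Subgroup.mem_iInf, MonoidHom.mem_ker]

lemma apply_eq_one_of_mem_theta {γ : CharGroup k G} (hγ : γ ∈ Theta χ) {h : G}
    (hh : h ∈ charKernel χ) : γ h = 1 := by
  induction hγ using Subgroup.closure_induction with
  | mem γ hγ => obtain ⟨i, rfl⟩ := hγ; exact mem_charKernel.1 hh i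
  | one => rfl
  | mul γ γ' _ _ h1 h2 => rw [MonoidHom.mul_apply, h1, h2, one_mul]
  | inv γ _ h1 => rw [MonoidHom.inv_apply, h1, inv_one]

/-- By double duality the annihilator of the common kernel is no larger than `Θ`. -/
lemma mem_theta_iff [Finite G] [IsAlgClosed k] [CharZero k] {γ : CharGroup k G} :
    γ ∈ Theta χ ↔ ∀ h ∈ charKernel χ, γ h = 1 :=
  ⟨fun hγ _ hh => apply_eq_one_of_mem_theta hγ hh, fun hγ =>
    mem_of_forall_apply_eq_one _ fun x hx => hγ x (mem_charKernel.2 fun i =>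
      hx _ (Subgroup.subset_closure ⟨i, rfl⟩))⟩

lemma gammaPrime_le_charKernel (hΘ : Theta χ ≤ Omega g r α) : GammaPrime g r α ≤ charKernel χ :=
  fun _ hh => mem_charKernel.2 (eq_one_of_mem_gammaPrime hΘ hh)

namespace LiftingWithMatrix

variable (L : LiftingWithMatrix g χ r α A)

lemma grp_mul_comm_of_mem_charKernel {h : G} (hh : h ∈ charKernel χ) (a : A) :
    L.grp h * a = a * L.grp h := L.grp_mul_comm (mem_charKernel.1 hh) a

/-- The space `C(γ̄)` of the linear forms on which the common kernel of the `χ i` acts through the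
restriction of `γ`. -/
def component (c : CharGroup k G ⧸ Theta χ) : Submodule k (HopfDual k A) :=
  HopfDual.weight (L.grp.comp (charKernel χ).subtype) (c.out.comp (charKernel χ).subtype)

/-- Representatives of a class differ by an element of `Θ`, which is trivial on the common kernel;
hence the component depends only on the class. -/
lemma out_mk_apply (γ : CharGroup k G) {h : G} (hh : h ∈ charKernel χ) :
    (QuotientGroup.mk γ : CharGroup k G ⧸ Theta χ).out h = γ h := by
  obtain ⟨θ, hθ⟩ := QuotientGroup.mk_out_eq_mul (Theta χ) γ
  rw [hθ, MonoidHom.mul_apply, apply_eq_one_of_mem_theta θ.2 hh, mul_one]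

lemma mem_component_mk {γ : CharGroup k G} {f : HopfDual k A} :
    f ∈ L.component (QuotientGroup.mk γ) ↔
      ∀ h ∈ charKernel χ, ∀ a, f (L.grp h * a) = γ h * f a := by
  refine HopfDual.mem_weight.trans ⟨fun H h hh a => ?_, fun H h a => ?_⟩
  · rw [← out_mk_apply γ hh]
    exact H ⟨h, hh⟩ a
  · have := H h h.2 a
    rw [← out_mk_apply γ h.2] at this
    exact this

lemma weight_le_component (γ : CharGroup k G) :
    HopfDual.weight L.grp γ ≤ L.component (QuotientGroup.mk γ) :=
  fun _ hf => L.mem_component_mk.2 fun h _ a => HopfDual.mem_weight.1 hf h a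

lemma component_one :
    L.component 1 = Subalgebra.toSubmodule (L.subgroupInvariants (charKernel χ)) := by
  ext f
  rw [← QuotientGroup.mk_one, mem_component_mk, Subalgebra.mem_toSubmodule, mem_subgroupInvariants]
  simp

lemma mul_mem_component {c d : CharGroup k G ⧸ Theta χ} {f f' : HopfDual k A}
    (hf : f ∈ L.component c) (hf' : f' ∈ L.component d) : f * f' ∈ L.component (c * d) := by
  obtain ⟨γ, rfl⟩ := QuotientGroup.mk_surjective c
  obtain ⟨γ', rfl⟩ := QuotientGroup.mk_surjective d
  have h1 : f ∈ HopfDual.weight (L.grp.comp (charKernel χ).subtype)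
      (γ.comp (charKernel χ).subtype) :=
    HopfDual.mem_weight.2 fun h => L.mem_component_mk.1 hf h h.2
  have h2 : f' ∈ HopfDual.weight (L.grp.comp (charKernel χ).subtype)
      (γ'.comp (charKernel χ).subtype) :=
    HopfDual.mem_weight.2 fun h => L.mem_component_mk.1 hf' h h.2
  have h3 := HopfDual.mul_mem_weight (fun h : charKernel χ => L.grp_isGroupLike h) h1 h2
  rw [← QuotientGroup.mk_mul, mem_component_mk]
  exact fun h hh => HopfDual.mem_weight.1 h3 ⟨h, hh⟩

lemma antipode_surjective (L : LiftingWithMatrix g χ r α A) :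
    Function.Surjective (HopfAlgebra.antipode k : A →ₗ[k] A) := by
  have hgrp (h : G) : HopfAlgebra.antipode k (L.grp h⁻¹) = L.grp h :=
    (L.grp_isGroupLike h⁻¹).antipode_eq_of_mul_eq_one (by rw [← map_mul]; simp)
  -- Since `S(x_i) = -g_i⁻¹ x_i` and `S` reverses products, `S(x_i · (-g_i⁻¹)) = (-g_i)(-g_i⁻¹ x_i)
  -- = x_i`.
  refine L.adjoin_induction' (P := fun a => ∃ b, HopfAlgebra.antipode k b = a)
    (fun h => ⟨_, hgrp h⟩) (fun i => ⟨L.x i * -L.grp (g i)⁻¹, ?_⟩)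
    (fun c => ⟨algebraMap k A c, by simp [Algebra.algebraMap_eq_smul_one]⟩) ?_ ?_
  · have hg := hgrp (g i)⁻¹
    rw [inv_inv] at hg
    rw [HopfAlgebra.antipode_mul_antidistrib, map_neg, hgrp,
      antipode_eq_of_skewPrimitive (L.comul_x i) (L.counit_x i), hg, neg_mul_neg, ← mul_assoc,
      ← map_mul]
    simp
  · rintro a b ⟨a, rfl⟩ ⟨b, rfl⟩
    exact ⟨a + b, map_add _ _ _⟩
  · rintro a b ⟨a, rfl⟩ ⟨b, rfl⟩
    exact ⟨b * a, HopfAlgebra.antipode_mul_antidistrib _ _⟩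

section Finite

variable [Module.Finite k A]

lemma isSubcoalgebra_component (c : CharGroup k G ⧸ Theta χ) :
    IsSubcoalgebra k (L.component c) :=
  HopfDual.isSubcoalgebra_weight (fun (h : charKernel χ) a => L.grp_mul_comm_of_mem_charKernel h.2 a) _

lemma antipode_mem_component {c : CharGroup k G ⧸ Theta χ} {f : HopfDual k A}
    (hf : f ∈ L.component c) : HopfAlgebra.antipode k f ∈ L.component c⁻¹ := by
  obtain ⟨γ, rfl⟩ := QuotientGroup.mk_surjective c
  have h1 : f ∈ HopfDual.weight (L.grp.comp (charKernel χ).subtype)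
      (γ.comp (charKernel χ).subtype) :=
    HopfDual.mem_weight.2 fun h => L.mem_component_mk.1 hf h h.2
  have h2 := HopfDual.antipode_mem_weight (fun h : charKernel χ => L.grp_isGroupLike h)
    (fun (h : charKernel χ) a => L.grp_mul_comm_of_mem_charKernel h.2 a) h1
  rw [← QuotientGroup.mk_inv, mem_component_mk]
  exact fun h hh => HopfDual.mem_weight.1 h2 ⟨h, hh⟩

lemma antipode_dual_injective (L : LiftingWithMatrix g χ r α A) :
    Function.Injective (HopfAlgebra.antipode k : HopfDual k A →ₗ[k] HopfDual k A) := by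
  intro f f' h
  ext a
  obtain ⟨b, rfl⟩ := L.antipode_surjective a
  exact DFunLike.congr_fun h b

/-- The antipode maps each component injectively into that of the inverse class. Doing this for both
classes shows that the dimensions agree. -/
lemma map_antipode_component (c : CharGroup k G ⧸ Theta χ) :
    (L.component c).map (HopfAlgebra.antipode k) = L.component c⁻¹ := by
  have hle (c : CharGroup k G ⧸ Theta χ) :
      (L.component c).map (HopfAlgebra.antipode k) ≤ L.component c⁻¹ := by
    rintro _ ⟨f, hf, rfl⟩
    exact L.antipode_mem_component hf
  have hrank (E : Submodule k (HopfDual k A)) :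
      Module.finrank k (E.map (HopfAlgebra.antipode k)) = Module.finrank k E :=
    (Submodule.equivMapOfInjective _ L.antipode_dual_injective E).symm.finrank_eq
  refine Submodule.eq_of_le_of_finrank_le (hle c) ?_
  rw [hrank, ← hrank (L.component c⁻¹)]
  have := Submodule.finrank_mono (hle c⁻¹)
  rwa [inv_inv] at this

end Finite

section Decomposition

variable [Finite G] [IsAlgClosed k] [CharZero k]

/-- Distinct classes modulo `Θ` restrict to distinct characters of the common kernel, so these are
distinct weight spaces. -/
lemma iSupIndep_component : iSupIndep L.component := by
  refine (iSupIndep_isotypic (HopfDual.translate k (L.grp.comp (charKernel χ).subtype))).comp ?_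
  intro c d h
  rw [← QuotientGroup.out_eq' c, ← QuotientGroup.out_eq' d, QuotientGroup.eq, mem_theta_iff]
  intro x hx
  have : c.out x = d.out x := DFunLike.congr_fun h (⟨x, hx⟩ : charKernel χ)
  rw [MonoidHom.mul_apply, MonoidHom.inv_apply, this, inv_mul_cancel]

lemma iSup_component : ⨆ c, L.component c = ⊤ := by
  rw [eq_top_iff]
  refine (le_iSup_isotypic_inf (HopfDual.translate k L.grp) (E := ⊤) (by simp)).trans
    (iSup_le fun γ => inf_le_left.trans ((L.weight_le_component γ).trans (le_iSup _ _)))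

lemma toSubmodule_subgroupInvariants_gammaPrime (hΘ : Theta χ ≤ Omega g r α) :
    Subalgebra.toSubmodule (L.subgroupInvariants (GammaPrime g r α)) =
      ⨆ γ ∈ Omega g r α, L.component (QuotientGroup.mk γ) := by
  apply le_antisymm
  · exact (L.toSubmodule_subgroupInvariants_le fun _ => mem_Omega_iff).trans
      (iSup₂_mono fun γ _ => L.weight_le_component γ)
  · refine iSup₂_le fun γ hγ f hf => L.mem_subgroupInvariants.2 fun h hh a => ?_
    rw [L.mem_component_mk.1 hf h (gammaPrime_le_charKernel hΘ hh), mem_Omega_iff.1 hγ h hh,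
      Units.val_one, one_mul]

end Decomposition

section Translation

variable (hr : ∀ i, 1 < r i ∧ IsPrimitiveRoot (χ i (g i)) (r i))

lemma dual_zero_mem_component (γ : CharGroup k G) :
    L.dual hr γ 0 ∈ L.component (QuotientGroup.mk γ) :=
  L.weight_le_component γ (L.dual_mem_weight hr γ 0)

lemma dual_zero_mul_inv (γ : CharGroup k G) : L.dual hr γ 0 * L.dual hr γ⁻¹ 0 = 1 := by
  rw [L.dual_mul_dual_zero, ← L.dual_one_zero hr]
  congr 1
  ext
  simp

lemma dual_zero_inv_mul (γ : CharGroup k G) : L.dual hr γ⁻¹ 0 * L.dual hr γ 0 = 1 := by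
  rw [L.dual_mul_dual_zero, ← L.dual_one_zero hr]
  congr 1
  ext
  simp

/-- For the harder inclusion write `f = w(γ,1) (w(γ⁻¹,1) f)`; these elements are inverse to each
other even when `γ ∉ Ω`. -/
lemma component_mul (hr : ∀ i, 1 < r i ∧ IsPrimitiveRoot (χ i (g i)) (r i))
    (c d : CharGroup k G ⧸ Theta χ) :
    L.component c * L.component d = L.component (c * d) := by
  apply le_antisymm
  · exact Submodule.mul_le.2 fun f hf f' hf' => L.mul_mem_component hf hf'
  · obtain ⟨γ, rfl⟩ := QuotientGroup.mk_surjective c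
    intro f hf
    have h1 := L.mul_mem_component (L.dual_zero_mem_component hr γ⁻¹) hf
    rw [show (QuotientGroup.mk γ⁻¹ : CharGroup k G ⧸ Theta χ) * (QuotientGroup.mk γ * d) = d from
      inv_mul_cancel_left (QuotientGroup.mk γ : CharGroup k G ⧸ Theta χ) d] at h1
    have := Submodule.mul_mem_mul (L.dual_zero_mem_component hr γ) h1
    rwa [← mul_assoc, L.dual_zero_mul_inv, one_mul] at this

lemma component_eq_map_mulLeft (γ : CharGroup k G) :
    L.component (QuotientGroup.mk γ) =
      (L.component 1).map (LinearMap.mulLeft k (L.dual hr γ 0)) := by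
  ext f
  constructor
  · intro hf
    have h1 := L.mul_mem_component (L.dual_zero_mem_component hr γ⁻¹) hf
    rw [show (QuotientGroup.mk γ⁻¹ : CharGroup k G ⧸ Theta χ) * QuotientGroup.mk γ = 1 from
      inv_mul_cancel (QuotientGroup.mk γ : CharGroup k G ⧸ Theta χ)] at h1
    exact ⟨_, h1, by rw [LinearMap.mulLeft_apply, ← mul_assoc, L.dual_zero_mul_inv, one_mul]⟩
  · rintro ⟨f, hf, rfl⟩
    have := L.mul_mem_component (L.dual_zero_mem_component hr γ) hf
    rwa [mul_one] at this

lemma component_eq_map_mulRight (γ : CharGroup k G) :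
    L.component (QuotientGroup.mk γ) =
      (L.component 1).map (LinearMap.mulRight k (L.dual hr γ 0)) := by
  ext f
  constructor
  · intro hf
    have h1 := L.mul_mem_component hf (L.dual_zero_mem_component hr γ⁻¹)
    rw [show (QuotientGroup.mk γ : CharGroup k G ⧸ Theta χ) * QuotientGroup.mk γ⁻¹ = 1 from
      mul_inv_cancel (QuotientGroup.mk γ : CharGroup k G ⧸ Theta χ)] at h1
    exact ⟨_, h1, by rw [LinearMap.mulRight_apply, mul_assoc, L.dual_zero_inv_mul, mul_one]⟩
  · rintro ⟨f, hf, rfl⟩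
    have := L.mul_mem_component hf (L.dual_zero_mem_component hr γ)
    rwa [one_mul] at this

lemma subcoalgebraIso_component [Module.Finite k A]
    (hr : ∀ i, 1 < r i ∧ IsPrimitiveRoot (χ i (g i)) (r i))
    (hΘ : Theta χ ≤ Omega g r α)
    {γ : CharGroup k G} (hγ : γ ∈ Omega g r α) :
    SubcoalgebraIso k (L.component 1) (L.component (QuotientGroup.mk γ)) := by
  rw [L.component_eq_map_mulLeft hr]
  exact (L.dual_zero_isGroupLike hr hΘ hγ).subcoalgebraIso_map_mulLeft
    (L.dual_zero_inv_mul hr γ) (L.isSubcoalgebra_component 1)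

end Translation

end LiftingWithMatrix

end Lifting

/-! ### The coradical of the dual -/

section Coradical

variable {k C : Type*} [Field k] [AddCommGroup C] [Module k C] [Coalgebra k C]

lemma corad_le (D : Submodule k C) : corad k D ≤ D := sSup_le fun _ hE => hE.2

lemma corad_mono {D D' : Submodule k C} (h : D ≤ D') : corad k D ≤ corad k D' :=
  sSup_le_sSup fun _ hE => ⟨hE.1, hE.2.trans h⟩

lemma IsSimpleSubcoalgebra.le_corad {D E : Submodule k C} (hE : IsSimpleSubcoalgebra k E)
    (h : E ≤ D) : E ≤ corad k D := le_sSup ⟨hE, h⟩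

end Coradical

section Lifting

variable {k : Type*} [Field k] {G : Type*} [CommGroup G] {t : ℕ} {g : Fin t → G}
  {χ : Fin t → CharGroup k G} {r : Fin t → ℕ} {α : Matrix (Fin t) (Fin t) k}
  {A : Type*} [Ring A] [HopfAlgebra k A]

namespace LiftingWithMatrix

variable (L : LiftingWithMatrix g χ r α A)

lemma apply_mul_grp_sub_one (hΘ : Theta χ ≤ Omega g r α) {f : HopfDual k A}
    (hf : f ∈ L.subgroupInvariants (GammaPrime g r α)) {h : G} (hh : h ∈ GammaPrime g r α) (a : A) :
    f (a * (L.grp h - 1)) = 0 := by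
  rw [mul_sub, mul_one, map_sub, ← L.grp_mul_comm (eq_one_of_mem_gammaPrime hΘ hh),
    L.mem_subgroupInvariants.1 hf h hh, sub_self]

/-- The linking term lies in `A (h - 1)` with `h ∈ Γ'` central, and `f` does not see it. -/
lemma apply_mul_x_mul_x (hΘ : Theta χ ≤ Omega g r α) {f : HopfDual k A}
    (hf : f ∈ L.subgroupInvariants (GammaPrime g r α)) {i j : Fin t} (hij : i ≠ j) (a : A) :
    f (a * (L.x i * L.x j)) = χ j (g i) * f (a * (L.x j * L.x i)) := by
  have h0 : α i j * f (a * (L.grp (g i * g j) - 1)) = 0 := by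
    by_cases h : α i j = 0
    · rw [h, zero_mul]
    · rw [L.apply_mul_grp_sub_one hΘ hf (Subgroup.subset_closure (Or.inr ⟨i, j, hij, h, rfl⟩)),
        mul_zero]
  rw [L.x_mul_x i j hij, mul_add, mul_smul_comm, mul_smul_comm, map_add, map_smul, map_smul,
    smul_eq_mul, smul_eq_mul, h0, add_zero]

lemma apply_mul_x_pow (hΘ : Theta χ ≤ Omega g r α) {f : HopfDual k A}
    (hf : f ∈ L.subgroupInvariants (GammaPrime g r α)) (i : Fin t) (a : A) :
    f (a * L.x i ^ r i) = 0 := by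
  rw [L.x_pow, mul_smul_comm, map_smul, smul_eq_mul]
  by_cases h : α i i = 0
  · rw [h, zero_mul]
  · rw [L.apply_mul_grp_sub_one hΘ hf (Subgroup.subset_closure (Or.inl ⟨i, h, rfl⟩)), mul_zero]

lemma mem_omega_of_dual_zero_mem
    (hr : ∀ i, 1 < r i ∧ IsPrimitiveRoot (χ i (g i)) (r i)) {γ : CharGroup k G}
    (h : L.dual hr γ 0 ∈ L.subgroupInvariants (GammaPrime g r α)) : γ ∈ Omega g r α := by
  refine mem_Omega_iff.2 fun x hx => Units.ext ?_
  have := L.mem_subgroupInvariants.1 h x hx 1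
  rwa [mul_one, L.dual_zero_apply_grp, L.dual_zero_apply_one] at this

lemma component_le_subgroupInvariants [Finite G] [IsAlgClosed k] [CharZero k]
    (hΘ : Theta χ ≤ Omega g r α) {γ : CharGroup k G}
    (hγ : γ ∈ Omega g r α) : L.component (QuotientGroup.mk γ) ≤
      Subalgebra.toSubmodule (L.subgroupInvariants (GammaPrime g r α)) := by
  rw [L.toSubmodule_subgroupInvariants_gammaPrime hΘ]
  exact le_iSup₂_of_le (f := fun γ (_ : γ ∈ Omega g r α) => L.component (QuotientGroup.mk γ))
    γ hγ le_rfl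

variable [Module.Finite k A]

/-- A nonzero subcoalgebra of the invariants of `Γ'` contains a nonzero element that vanishes on the
left ideals generated by the `x i`. -/
lemma exists_ne_zero_forall_apply_mul_x_eq_zero (hΘ : Theta χ ≤ Omega g r α)
    {E : Submodule k (HopfDual k A)} (hE : IsSubcoalgebra k E) (h0 : E ≠ ⊥)
    (hEB : E ≤ Subalgebra.toSubmodule (L.subgroupInvariants (GammaPrime g r α)))
    (s : Finset (Fin t)) : ∃ f ∈ E, f ≠ 0 ∧ ∀ i ∈ s, ∀ a, f (a * L.x i) = 0 := by
  induction s using Finset.induction_on with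
  | empty =>
    obtain ⟨f, hf, hf0⟩ := Submodule.exists_mem_ne_zero_of_ne_bot h0
    exact ⟨f, hf, hf0, by simp⟩
  | insert j s hj ih =>
    obtain ⟨f, hf, hf0, hs⟩ := ih
    have hR (n : ℕ) : HopfDual.rightTranslate k (L.x j ^ n) f ∈ E :=
      (HopfDual.isSubcoalgebra_iff.1 hE f hf _).2
    have hRs (n : ℕ) : ∀ i ∈ s, ∀ a, f (a * L.x i * L.x j ^ n) = 0 := by
      intro i hi
      induction n with
      | zero => simpa using hs i hi
      | succ n ih =>
        intro a
        have hij : i ≠ j := fun h => hj (h ▸ hi)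
        have h1 := L.apply_mul_x_mul_x hΘ (hEB (hR n)) hij a
        rw [HopfDual.rightTranslate_apply, HopfDual.rightTranslate_apply, ← mul_assoc a (L.x j),
          ih, mul_zero, mul_assoc, mul_assoc, ← pow_succ', ← mul_assoc] at h1
        exact h1
    have hex : ∃ n, HopfDual.rightTranslate k (L.x j ^ n) f = 0 :=
      ⟨r j, by ext a; exact L.apply_mul_x_pow hΘ (hEB hf) j a⟩
    classical
    -- The last nonzero iterate under the nilpotent operator `x_j`. It is still killed by the
    -- earlier `x_i` because the operators commute up to scalars.
    obtain ⟨n, hn, hn'⟩ : ∃ n, HopfDual.rightTranslate k (L.x j ^ n) f ≠ 0 ∧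
        HopfDual.rightTranslate k (L.x j ^ (n + 1)) f = 0 := by
      have hpos : Nat.find hex ≠ 0 := fun h => by
        have := Nat.find_spec hex
        rw [h, pow_zero] at this
        exact hf0 (by ext a; simpa using DFunLike.congr_fun this a)
      obtain ⟨n, hn⟩ := Nat.exists_eq_succ_of_ne_zero hpos
      exact ⟨n, Nat.find_min hex (by omega), by
         rw [← Nat.succ_eq_add_one, ← hn]; exact Nat.find_spec hex⟩
    refine ⟨_, hR n, hn, fun i hi a => ?_⟩
    rcases Finset.mem_insert.1 hi with rfl | hi
    · have := DFunLike.congr_fun hn' a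
      rwa [HopfDual.rightTranslate_apply, pow_succ', ← mul_assoc] at this
    · exact hRs n i hi a

variable (hr : ∀ i, 1 < r i ∧ IsPrimitiveRoot (χ i (g i)) (r i))

variable [Finite G] [IsAlgClosed k] [CharZero k]

/-- The simple subcoalgebras of the invariants of `Γ'` are spanned by group-likes. -/
lemma exists_eq_span_of_isSimpleSubcoalgebra (hΘ : Theta χ ≤ Omega g r α)
    {E : Submodule k (HopfDual k A)} (hE : IsSimpleSubcoalgebra k E)
    (hEB : E ≤ Subalgebra.toSubmodule (L.subgroupInvariants (GammaPrime g r α))) :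
    ∃ γ ∈ Omega g r α, E = Submodule.span k {L.dual hr γ 0} := by
  -- The part of `E` killed by right translation by all `x_i`. Left translations by the group
  -- commute with right ones, so `F` contains a weight vector.
  let F : Submodule k (HopfDual k A) :=
    { carrier := {f | f ∈ E ∧ ∀ i a, f (a * L.x i) = 0}
      add_mem' := fun hf hf' => ⟨add_mem hf.1 hf'.1, fun i a => by simp [hf.2, hf'.2]⟩
      zero_mem' := ⟨zero_mem _, by simp⟩
      smul_mem' := fun c f hf => ⟨E.smul_mem c hf.1, fun i a => by simp [hf.2]⟩ }
  have hF0 : F ≠ ⊥ := by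
    obtain ⟨f, hf, hf0, hx⟩ :=
      L.exists_ne_zero_forall_apply_mul_x_eq_zero hΘ hE.1 hE.2.1 hEB Finset.univ
    exact fun h => hf0 ((Submodule.eq_bot_iff _).1 h f ⟨hf, fun i => hx i (Finset.mem_univ i)⟩)
  have hFG : ∀ h, ∀ f ∈ F, HopfDual.translate k L.grp h f ∈ F := fun h f hf =>
    ⟨(HopfDual.isSubcoalgebra_iff.1 hE.1 f hf.1 _).1, fun i a => by
      change f (L.grp h * (a * L.x i)) = 0
      rw [← mul_assoc, hf.2]⟩
  obtain ⟨γ, hγ⟩ := exists_isotypic_inf_ne_bot _ hFG hF0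
  obtain ⟨f, ⟨hfγ, hfE, hfx⟩, hf0⟩ := Submodule.exists_mem_ne_zero_of_ne_bot hγ
  have hf := L.eq_smul_dual_zero hr hfγ fun a i => hfx i a
  have hf1 : f 1 ≠ 0 := fun h => hf0 (by rw [hf, h, zero_smul])
  have hd : L.dual hr γ 0 ∈ E := by
    rw [← inv_smul_smul₀ hf1 (L.dual hr γ 0), ← hf]
    exact E.smul_mem _ hfE
  have hΩ := L.mem_omega_of_dual_zero_mem hr (hEB hd)
  have hs := HopfDual.isSimpleSubcoalgebra_span (L.dual_zero_isGroupLike hr hΘ hΩ)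
  exact ⟨γ, hΩ, ((hE.2.2 _ ((Submodule.span_singleton_le_iff_mem _ _).2 hd) hs.1).resolve_left
    hs.2.1).symm⟩

lemma isPointed_subgroupInvariants
    (hr : ∀ i, 1 < r i ∧ IsPrimitiveRoot (χ i (g i)) (r i)) (hΘ : Theta χ ≤ Omega g r α) :
    IsPointed k (Subalgebra.toSubmodule (L.subgroupInvariants (GammaPrime g r α))) := by
  intro E hEB hE
  obtain ⟨γ, -, rfl⟩ := L.exists_eq_span_of_isSimpleSubcoalgebra hr hΘ hE hEB
  refine finrank_span_singleton fun h => ?_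
  have := L.dual_zero_apply_one hr γ
  rw [h] at this
  exact zero_ne_one this

/-- A weight vector of `E` makes the intersection with some component a nonzero subcoalgebra, so
simplicity forces `E` inside. -/
lemma exists_le_component {E : Submodule k (HopfDual k A)} (hE : IsSimpleSubcoalgebra k E) :
    ∃ γ : CharGroup k G, E ≤ L.component (QuotientGroup.mk γ) := by
  obtain ⟨γ, hγ⟩ := exists_isotypic_inf_ne_bot (HopfDual.translate k L.grp) (E := E)
    (fun h f hf => (HopfDual.isSubcoalgebra_iff.1 hE.1 f hf _).1) hE.2.1
  refine ⟨γ, ?_⟩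
  have hne : L.component (QuotientGroup.mk γ) ⊓ E ≠ ⊥ := fun h =>
    hγ (le_bot_iff.1 ((inf_le_inf_right E (L.weight_le_component γ)).trans h.le))
  have := (hE.2.2 _ inf_le_right
    (HopfDual.isSubcoalgebra_inf (L.isSubcoalgebra_component _) hE.1)).resolve_left hne
  exact inf_eq_right.1 this

/-- Each simple subcoalgebra lies in one component. If its class is in `Ω`, it lies in `B` and is
spanned by a group-like. -/
lemma corad_top (hΘ : Theta χ ≤ Omega g r α) :
    corad k (⊤ : Submodule k (HopfDual k A)) =
      Submodule.span k ((fun γ => L.dual hr γ 0) '' (Omega g r α : Set (CharGroup k G))) ⊔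
        ⨆ γ ∉ Omega g r α, corad k (L.component (QuotientGroup.mk γ)) := by
  apply le_antisymm
  · refine sSup_le fun E hE => ?_
    obtain ⟨γ, hγ⟩ := L.exists_le_component hE.1
    by_cases hΩ : γ ∈ Omega g r α
    · obtain ⟨γ', hγ', rfl⟩ := L.exists_eq_span_of_isSimpleSubcoalgebra hr hΘ hE.1
        (hγ.trans (L.component_le_subgroupInvariants hΘ hΩ))
      exact le_sup_of_le_left
        (Submodule.span_mono (Set.singleton_subset_iff.2 ⟨γ', hγ', rfl⟩))
    · exact le_sup_of_le_right (le_iSup₂_of_le (f := fun γ (_ : γ ∉ Omega g r α) =>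
        corad k (L.component (QuotientGroup.mk γ))) γ hΩ (hE.1.le_corad hγ))
  · refine sup_le (Submodule.span_le.2 ?_) (iSup₂_le fun γ _ => corad_mono le_top)
    rintro _ ⟨γ, hγ, rfl⟩
    exact (HopfDual.isSimpleSubcoalgebra_span (L.dual_zero_isGroupLike hr hΘ hγ)).le_corad le_top
      (Submodule.mem_span_singleton_self _)

lemma disjoint_span_iSup_corad (hΘ : Theta χ ≤ Omega g r α) :
    Disjoint
      (Submodule.span k ((fun γ => L.dual hr γ 0) '' (Omega g r α : Set (CharGroup k G))))
      (⨆ γ ∉ Omega g r α, corad k (L.component (QuotientGroup.mk γ))) := by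
  -- Since `Θ ≤ Ω`, a class modulo `Θ` lies entirely inside or entirely outside `Ω`; the two sides
  -- sit in complementary families of components.
  let S : Set (CharGroup k G ⧸ Theta χ) := QuotientGroup.mk '' (Omega g r α : Set (CharGroup k G))
  have hd : Disjoint (⨆ c ∈ S, L.component c) (⨆ c ∈ Sᶜ, L.component c) :=
    L.iSupIndep_component.disjoint_biSup_biSup disjoint_compl_right
  refine hd.mono (Submodule.span_le.2 ?_) (iSup₂_le fun γ hγ => (corad_le _).trans ?_)
  · rintro _ ⟨γ, hγ, rfl⟩
    exact (le_iSup₂_of_le (f := fun c (_ : c ∈ S) => L.component c) (QuotientGroup.mk γ)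
      ⟨γ, hγ, rfl⟩ le_rfl) (L.dual_zero_mem_component hr γ)
  · refine le_iSup₂_of_le (f := fun c (_ : c ∈ Sᶜ) => L.component c) (QuotientGroup.mk γ) ?_ le_rfl
    rintro ⟨γ', hγ', h⟩
    have := mul_mem hγ' (hΘ (QuotientGroup.eq.1 h))
    rw [show γ' * (γ'⁻¹ * γ) = γ by ext; simp] at this
    exact hγ this

end LiftingWithMatrix

end Lifting

end

theorem proposition3p2 {k : Type*} [Field k] [IsAlgClosed k] [CharZero k]
    {Γ : Type*} [CommGroup Γ] [Finite Γ] {t : ℕ}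
    (g : Fin t → Γ) (χ : Fin t → CharGroup k Γ) (r : Fin t → ℕ)
    (hV : IsQuantumLinearSpace g χ)
    (hr : ∀ i, 1 < r i ∧ IsPrimitiveRoot (χ i (g i)) (r i))
    (α : Matrix (Fin t) (Fin t) k) (hα : IsLiftingMatrix g χ r α)
    {A : Type*} [Ring A] [HopfAlgebra k A] [Module.Finite k A]
    (L : LiftingWithMatrix g χ r α A)
    (hαχ : ∀ i j, i ≠ j → α i j ≠ 0 → χ i = χ j) :
    -- the elements `h x^m` are a basis of `A`; it defines the elements `w(γ, x^m)` of `A^*`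
    ∃ b : Module.Basis (Γ × (∀ i, Fin (r i))) k A,
      (∀ h m, b (h, m) = L.grp h * monomialOf L.x (fun i => (m i : ℕ))) ∧
    -- the characters of `Γ / Γ'` are the elements of `Ω`
    (∃ e : CharGroup k (Γ ⧸ GammaPrime g r α) ≃* Omega g r α,
      ∀ ψ h, (e ψ : CharGroup k Γ) h = ψ (QuotientGroup.mk h)) ∧
    -- `Θ` is a subgroup of `Ω`, and `Ω` is the group of group-likes of `A^*`
    ∃ hΘΩ : Theta χ ≤ Omega g r α,
    (∃ e : Omega g r α ≃* GroupLike k (HopfDual k A),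
      ∀ γ, (e γ).val = dualElt b (γ : CharGroup k Γ) 0) ∧
    -- `C₁ ≅ B(W) # k[Θ]` and `B ≅ B(W) # k[Ω]` are pointed sub-Hopf algebras of `A^*`
    ∃ C₁ B : Subalgebra k (HopfDual k A),
    IsHopfSubalgebra C₁ ∧ IsHopfSubalgebra B ∧ C₁ ≤ B ∧
    IsPointed k (Subalgebra.toSubmodule C₁) ∧ IsPointed k (Subalgebra.toSubmodule B) ∧
    (∃ φ : DualNicholsSmash g (le_refl (Theta χ)) →ₐc[k] HopfDual k A,
      Function.Injective φ ∧ Set.range φ = (C₁ : Set (HopfDual k A)) ∧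
      (∀ γ : Theta χ, φ (NicholsSmash.grp _ _ _ γ) = dualElt b (γ : CharGroup k Γ) 0) ∧
      ∀ i, φ (NicholsSmash.vec _ _ _ i) = dualElt b (χ i) (Pi.single i 1)) ∧
    (∃ φ : DualNicholsSmash g hΘΩ →ₐc[k] HopfDual k A,
      Function.Injective φ ∧ Set.range φ = (B : Set (HopfDual k A)) ∧
      (∀ γ : Omega g r α, φ (NicholsSmash.grp _ _ _ γ) = dualElt b (γ : CharGroup k Γ) 0) ∧
      ∀ i, φ (NicholsSmash.vec _ _ _ i) = dualElt b (χ i) (Pi.single i 1)) ∧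
    -- the subcoalgebras `C(γ̄) = γ C₁ = C₁ γ`, the decompositions of `A^*` and `B`, the coradical
    ∃ C : CharGroup k Γ ⧸ Theta χ → Submodule k (HopfDual k A),
    (∀ γ : CharGroup k Γ,
      C (QuotientGroup.mk γ) = (Subalgebra.toSubmodule C₁).map
        (LinearMap.mulLeft k (dualElt b γ 0)) ∧
      C (QuotientGroup.mk γ) = (Subalgebra.toSubmodule C₁).map
        (LinearMap.mulRight k (dualElt b γ 0))) ∧
    C 1 = Subalgebra.toSubmodule C₁ ∧
    (∀ c, IsSubcoalgebra k (C c)) ∧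
    iSupIndep C ∧ (⨆ c, C c) = ⊤ ∧
    (∀ γ ∈ Omega g r α, SubcoalgebraIso k (C 1) (C (QuotientGroup.mk γ))) ∧
    Subalgebra.toSubmodule B = (⨆ γ ∈ Omega g r α, C (QuotientGroup.mk γ)) ∧
    corad k (⊤ : Submodule k (HopfDual k A)) =
      Submodule.span k ((fun γ => dualElt b γ 0) '' (Omega g r α : Set (CharGroup k Γ))) ⊔
        (⨆ γ ∉ Omega g r α, corad k (C (QuotientGroup.mk γ))) ∧
    Disjoint
      (Submodule.span k ((fun γ => dualElt b γ 0) '' (Omega g r α : Set (CharGroup k Γ))))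
      (⨆ γ ∉ Omega g r α, corad k (C (QuotientGroup.mk γ))) ∧
    iSupIndep (fun c : {c : CharGroup k Γ ⧸ Theta χ // ∃ γ ∉ Omega g r α,
      QuotientGroup.mk γ = c} => corad k (C c)) ∧
    -- products and antipodes of the `C(γ̄)`
    (∀ c d, C c * C d = C (c * d)) ∧
    ∀ c, (C c).map (HopfAlgebra.antipode k) = C c⁻¹ := by
  have hΘΩ := hα.theta_le_omega hV (fun i => (hr i).2) hαχ
  have hgrp (N : Subgroup Γ) : ∀ h : N, IsGroupLikeElem k ((L.grp.comp N.subtype) h) :=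
    fun h => L.grp_isGroupLike h
  have hC₁B : L.subgroupInvariants (charKernel χ) ≤ L.subgroupInvariants (GammaPrime g r α) :=
    fun f hf => L.mem_subgroupInvariants.2 fun h hh =>
      L.mem_subgroupInvariants.1 hf h (gammaPrime_le_charKernel hΘΩ hh)
  have hB := L.isPointed_subgroupInvariants hr hΘΩ
  -- The witnesses are `C₁`, the forms invariant under the common kernel of the `χ_i`, and `B`, the
  -- forms invariant under `Γ'`. As `Γ'` lies in that kernel, `C₁ ≤ B`, and `C₁` inherits
  -- pointedness.
  refine ⟨L.basis hr, L.basis_apply hr, ⟨quotientCharEquiv _ _ fun _ => mem_Omega_iff,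
    fun _ _ => rfl⟩, hΘΩ, L.exists_omega_equiv_groupLike hr hΘΩ,
    L.subgroupInvariants (charKernel χ), L.subgroupInvariants (GammaPrime g r α),
    HopfDual.isHopfSubalgebra_invariants (hgrp _)
      fun h a => L.grp_mul_comm_of_mem_charKernel h.2 a,
    HopfDual.isHopfSubalgebra_invariants (hgrp _) (L.grpPrime_mul_comm hΘΩ), hC₁B,
    fun E hE => hB E (hE.trans hC₁B), hB,
    ⟨L.nicholsBialgHom hr _ hΘΩ, L.nicholsBialgHom_injective hr _ hΘΩ, ?_,
      L.tensorMap_grp hr _, L.tensorMap_vec hr _⟩,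
    ⟨L.nicholsBialgHom hr hΘΩ le_rfl, L.nicholsBialgHom_injective hr _ le_rfl, ?_,
      L.tensorMap_grp hr _, L.tensorMap_vec hr _⟩,
    L.component, fun γ => ⟨?_, ?_⟩, L.component_one, L.isSubcoalgebra_component,
    L.iSupIndep_component, L.iSup_component, fun γ => L.subcoalgebraIso_component hr hΘΩ,
    L.toSubmodule_subgroupInvariants_gammaPrime hΘΩ, L.corad_top hr hΘΩ,
    L.disjoint_span_iSup_corad hr hΘΩ, ?_, L.component_mul hr, L.map_antipode_component⟩
  · rw [L.range_nicholsBialgHom, L.range_tensorMap hr _ fun _ => mem_theta_iff]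
  · rw [L.range_nicholsBialgHom, L.range_tensorMap hr _ fun _ => mem_Omega_iff]
  · rw [← L.component_one]
    exact L.component_eq_map_mulLeft hr γ
  · rw [← L.component_one]
    exact L.component_eq_map_mulRight hr γ
  · exact (L.iSupIndep_component.comp Subtype.val_injective).mono fun _ => corad_le _
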